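/- Let $d\ge 3$. For a positive definite real symmetric $d\times d$ matrix $g$ and a real antisymmetric $d\times d$ matrix $B$, and for $m,n\in\mathbb{Z}^d$, put $$\mathcal{M}^2(m,n)=(m+Bn)^t g^{-1}(m+Bn)+n^t g\,n ,\qquad Z_{d,d}(g,B;\tau)=\tau_2^{d/2}\sum_{m,n\in\mathbb{Z}^d} e^{-\pi\tau_2\mathcal{M}^2(m,n)-2\pi i\tau_1\, m\cdot n}\quad(\tau=\tau_1+i\tau_2,\ \tau_2>0).$$ Let $\mathcal{F}=\{|\tau|\ge1,\ |\tau_1|\le\frac12\}$ be the fundamental domain of $SL(2,\mathbb{Z})$ in the upper half-plane, and let $I_d$ be the integral $2\pi\int_{\mathcal F}\frac{d\tau_1 d\tau_2}{\tau_2^2}Z_{d,d}(g,B;\tau)$, regularized by $$I_d(g,B)=\lim_{T\to\infty}\left[2\pi\int_{\mathcal{F}\cap\{\tau_2\le T\}}\frac{d\tau_1 d\tau_2}{\tau_2^2}\,Z_{d,d}(g,B;\tau)-2\pi\,\frac{T^{d/2-1}}{d/2-1}\right].$$ The vector Eisenstein series of $SO(d,d,\mathbb{Z})$, $$\mathcal{E}_{\mathbf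 V;s}(g,B)=\sum_{\substack{(m,n)\in\mathbb{Z}^{2d}\setminus\{0\}\\ m\cdot n=0}}\left[\mathcal{M}^2(m,n)\right]^{-s},$$ converges absolutely for $\mathrm{Re}(s)>d$ and has a meromorphic continuation to $s\in\mathbb{C}$, which is analytic at $s=d/2-1$. For all $(g,B)$ the limit defining $I_d(g,B)$ exists, and $$I_d(g,B)=2\,\frac{\Gamma(\frac d2-1)}{\pi^{\frac d2-2}}\;\mathcal{E}_{\mathbf V;s=\frac d2-1}(g,B).$$ If $2\pi\,T^{d/2-1}/(d/2-1)$ is replaced by any function $c(T)$ independent of $(g,B)$ for which the limit exists at some $(g,B)$, then the limit exists at all $(g,B)$, and the formula holds up to an additive constant independent of $(g,B)$. -/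

import Mathlib

open Filter Topology MeasureTheory
open scoped UpperHalfPlane

noncomputable section

/-- The moduli `(g, B)` of a string compactification on the torus `T^d`: a flat metric `g`
(a positive definite real symmetric matrix) and a two-form background `B` (a real antisymmetric
matrix). -/
structure NarainModuli (d : ℕ) where
  g : Matrix (Fin d) (Fin d) ℝ
  B : Matrix (Fin d) (Fin d) ℝ
  g_posDef : g.PosDef
  B_antisymm : B.transpose = -B

/-- A charge vector in the `(d,d)` Narain lattice: momenta `m_i` (first component) and winding
numbers `n^i` (second component). -/
abbrev NarainCharge (d : ℕ) : Type := (Fin d → ℤ) × (Fin d → ℤ)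

namespace NarainCharge

variable {d : ℕ}

/-- The momenta `m_i` as a real vector. -/
def mom (p : NarainCharge d) : Fin d → ℝ := fun i => (p.1 i : ℝ)

/-- The winding numbers `n^i` as a real vector. -/
def wind (p : NarainCharge d) : Fin d → ℝ := fun i => (p.2 i : ℝ)

/-- The pairing `m ∧ m = m_i n^i`. -/
def pairing (p : NarainCharge d) : ℤ := ∑ i, p.1 i * p.2 i

end NarainCharge

namespace NarainModuli

variable {d : ℕ}

/-- The dressed momenta `m_i + B_{ij} n^j`. -/
def dressedMom (M : NarainModuli d) (p : NarainCharge d) : Fin d → ℝ :=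
  p.mom + M.B.mulVec p.wind

/-- The mass squared in the vector representation,
`(m_i + B_{ij} n^j) g^{ik} (m_k + B_{kl} n^l) + n^i g_{ij} n^j`. -/
def massSq (M : NarainModuli d) (p : NarainCharge d) : ℝ :=
  dotProduct (M.dressedMom p) (M.g⁻¹.mulVec (M.dressedMom p)) +
    dotProduct p.wind (M.g.mulVec p.wind)

/-- The lattice partition function
`Z_{d,d}(g,B;τ) = τ₂^{d/2} ∑_{m,n} exp(-π τ₂ 𝓜²(m,n) - 2π i τ₁ m_i n^i)`. -/
def latticePartition (M : NarainModuli d) (τ : ℍ) : ℂ :=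
  ((τ.im ^ ((d : ℝ) / 2) : ℝ) : ℂ) *
    ∑' p : NarainCharge d,
      Complex.exp (-(Real.pi : ℂ) * (τ.im : ℂ) * (M.massSq p : ℂ)
        - 2 * (Real.pi : ℂ) * Complex.I * (τ.re : ℂ) * (p.pairing : ℂ))

end NarainModuli

/-- The part `τ₂ ≤ T` of the standard fundamental domain `|τ| ≥ 1`, `|τ₁| ≤ 1/2` of `SL(2,ℤ)`. -/
def truncatedFundamentalDomain (T : ℝ) : Set ℍ :=
  {τ | τ ∈ ModularGroup.fd ∧ τ.im ≤ T}

namespace NarainModuli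

variable {d : ℕ}

/-- The integral `2π ∫ (dτ₁ dτ₂ / τ₂²) Z_{d,d}(g,B;τ)` over the fundamental domain with infrared
cutoff `τ₂ ≤ T`. The measure on `ℍ` is Mathlib's, which is `dτ₁ dτ₂ / τ₂²`. -/
def cutoffIntegral (M : NarainModuli d) (T : ℝ) : ℂ :=
  2 * (Real.pi : ℂ) * ∫ τ in truncatedFundamentalDomain T, M.latticePartition τ

/-- `I` is the value at `(g, B)` of the one-loop integral `2π ∫_𝓕 (d²τ/τ₂²) Z_{d,d}`, regularized
by cutting off the fundamental domain at `τ₂ ≤ T`, subtracting the counterterm `c T` and letting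
`T → ∞`. -/
structure IsRegularizedOneLoop (M : NarainModuli d) (c : ℝ → ℂ) (I : ℂ) : Prop where
  integrableOn : ∀ T : ℝ, IntegrableOn M.latticePartition (truncatedFundamentalDomain T)
  tendsto : Tendsto (fun T : ℝ => M.cutoffIntegral T - c T) atTop (𝓝 I)

/-- The nonzero charges with `m_i n^i = 0` (half-BPS charges). -/
abbrev HalfBPSCharge (d : ℕ) : Type := {p : NarainCharge d // p ≠ 0 ∧ p.pairing = 0}

/-- `E` is the vector Eisenstein series of `SO(d,d,ℤ)` at the point `(g, B)` as a function of its
order `s`: the meromorphic continuation to the whole plane of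
`∑_{(m,n) ≠ 0, m_i n^i = 0} 𝓜²(m,n)^{-s}`. The half-plane `Re s > d`, where already the sum without
the constraint converges absolutely, suffices to determine the continuation. -/
structure IsVectorEisenstein (M : NarainModuli d) (E : ℂ → ℂ) : Prop where
  meromorphic : Meromorphic E
  hasSum : ∀ s : ℂ, (d : ℝ) < s.re →
    HasSum (fun p : HalfBPSCharge d => ((M.massSq p.1 : ℝ) : ℂ) ^ (-s)) (E s)

end NarainModuli

/-- The counterterm of minimal subtraction: `2π ∫^T τ₂^{d/2} dτ₂/τ₂² = 2π T^{d/2-1}/(d/2-1)`,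
the contribution of the zero charge, which alone makes the integral diverge. -/
def minimalCounterterm (d : ℕ) (T : ℝ) : ℂ :=
  ((2 * Real.pi * (T ^ ((d : ℝ) / 2 - 1) / ((d : ℝ) / 2 - 1)) : ℝ) : ℂ)

/-- The factor `2 Γ(d/2-1) / π^{d/2-2}`. -/
def eisensteinFactor (d : ℕ) : ℂ :=
  ((2 * Real.Gamma ((d : ℝ) / 2 - 1) / Real.pi ^ ((d : ℝ) / 2 - 2) : ℝ) : ℂ)

end

/-! Put s = d/2, y = τ₂ and write Z for `latticePartition`. Poisson summation over the momenta
brings Z to a form in which S only permutes the charges, so Z is SL(2,ℤ)-invariant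
(`latticePartition_smul`). At the cusp the zero charge contributes y^s and the other charges decay
faster than any power of y. Let E be the Eisenstein series ∑ Im(γτ)^s over Γ_∞\SL(2,ℤ), almost
everywhere finite because d ≥ 3 gives s > 1. Then Z - E is invariant and integrable over 𝓕; call its
integral R (`regularizedIntegral`). For T ≥ 2 the Eisenstein series with its leading term y^s cut
off at height T unfolds to exactly T^{s-1}/(s-1), so minimal subtraction converges to 2πR
(`isRegularizedOneLoop_minimalCounterterm`).

The number R is then recognised as a residue, by the Rankin–Selberg method in theta form. Integrate
Z - E against θ_t(τ) = ∑ exp(-πt|mτ+n|²/y). The zero vector gives R. The nonzero vectors are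
positive multiples of bottom rows of SL(2,ℤ), hence unfold 𝓕 to the strip, where the τ₁-integral
keeps only the charges with m·n = 0 and the constant term of E. The outcome
(`integral_torusTheta_smul`) is ∫ θ_t (Z - E) = R + Φ(t) - κ t^{-s}, with Φ the `thetaTransform` and
κ a constant that does not depend on (g,B).

The relation θ_{1/t} = t θ_t becomes a functional equation for Φ (`thetaTransform_inv`). On the
other hand, the Mellin transform of Φ at w = z - d/2 + 1 is 2Λ(2w) π^{-z} Γ(z) 𝓔(z), where Λ is the
completed zeta function and 𝓔 the vector Eisenstein series (`mellin_thetaTransform`,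
`hasSum_mellin_halfBPSSum`). Riemann's argument continues this Mellin transform as an entire
function plus R(1/(w-1) - 1/w) - κ(1/(w+s-1) - 1/(w-s)) (`mul_mellin_thetaTransform`). The point z =
d/2 - 1 is w = 0: there the continuation has polar part -R/w and 2Λ(2w) has polar part -1/w, so
π^{-z} Γ(z) 𝓔(z) equals R. The terms with κ are regular at w = 0, and κ never has to be evaluated.

Two counterterms that both work at one point (g,B) differ by a function of T with a limit; this
gives the last claim. -/

noncomputable section

/-! ### Quadratic forms and sums over integer points -/

/-- A continuous positive definite quadratic form dominates a multiple of the squared norm. -/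
lemma exists_mul_norm_sq_le_of_homogeneous {V : Type*} [NormedAddCommGroup V] [NormedSpace ℝ V]
    [FiniteDimensional ℝ V] {q : V → ℝ} (hc : Continuous q)
    (hq : ∀ (c : ℝ) v, q (c • v) = c ^ 2 * q v) (hp : ∀ v ≠ 0, 0 < q v) :
    ∃ ε > 0, ∀ v, ε * ‖v‖ ^ 2 ≤ q v := by
  have hq0 : q 0 = 0 := by simpa using hq 0 0
  -- The unit sphere is empty when V = 0, which happens for d = 0; otherwise ε is the minimum of q
  -- on the sphere.
  rcases (Metric.sphere (0 : V) 1).eq_empty_or_nonempty with he | hne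
  · refine ⟨1, one_pos, fun v => ?_⟩
    have hv : v = 0 := by
      by_contra hv
      have : (‖v‖⁻¹ • v) ∈ Metric.sphere (0 : V) 1 := by
        simp [norm_smul, norm_ne_zero_iff.mpr hv]
      simp [he] at this
    simp [hv, hq0]
  · obtain ⟨x, hx, hmin⟩ := (isCompact_sphere (0 : V) 1).exists_isMinOn hne hc.continuousOn
    refine ⟨q x, hp x (by rintro rfl; simp at hx), fun v => ?_⟩
    by_cases hv : v = 0
    · simp [hv, hq0]
    have hm : (‖v‖⁻¹ • v) ∈ Metric.sphere (0 : V) 1 := by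
      simp [norm_smul, norm_ne_zero_iff.mpr hv]
    have h1 : q x ≤ q (‖v‖⁻¹ • v) := hmin hm
    rw [hq] at h1
    have hn : 0 < ‖v‖ := norm_pos_iff.mpr hv
    calc q x * ‖v‖ ^ 2 ≤ (‖v‖⁻¹ ^ 2 * q v) * ‖v‖ ^ 2 := by gcongr
      _ = q v := by field_simp

namespace NarainCharge

variable {d : ℕ}

/-- Charges are the points of a lattice of rank 2d, and the rank is the convergence threshold. -/
lemma summable_norm_rpow (d : ℕ) {r : ℝ} (hr : r < -(2 * d)) :
    Summable fun p : NarainCharge d => ‖p‖ ^ r := by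
  let b := (Pi.basisFun ℝ (Fin d)).prod (Pi.basisFun ℝ (Fin d))
  let L := Submodule.span ℤ (Set.range b)
  have hf : Module.finrank ℤ L = 2 * d := by
    rw [ZLattice.rank ℝ L]
    simp [two_mul]
  have hs := ZLattice.summable_norm_rpow L r (by rw [hf]; push_cast; exact hr)
  have hmem : ∀ p : NarainCharge d, (p.mom, p.wind) ∈ L := by
    intro p
    rw [b.mem_span_iff_repr_mem ℤ]
    rintro (i | i)
    · exact ⟨p.1 i, by simp [b, mom]⟩
    · exact ⟨p.2 i, by simp [b, wind]⟩
  have hinj : Function.Injective fun p : NarainCharge d => (⟨(p.mom, p.wind), hmem p⟩ : L) := by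
    intro p q h
    simp only [Subtype.mk.injEq, Prod.mk.injEq] at h
    refine Prod.ext (funext fun i => ?_) (funext fun i => ?_)
    · have := congrFun h.1 i
      simpa [mom] using this
    · have := congrFun h.2 i
      simpa [wind] using this
  refine (hs.comp_injective hinj).congr fun p => ?_
  rfl

lemma one_le_norm {p : NarainCharge d} (hp : p ≠ 0) : 1 ≤ ‖p‖ := by
  rw [Ne, Prod.ext_iff, not_and_or] at hp
  have key : ∀ v : Fin d → ℤ, v ≠ 0 → 1 ≤ ‖v‖ := by
    intro v hv
    obtain ⟨i, hi⟩ := Function.ne_iff.mp hv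
    refine le_trans ?_ (norm_le_pi_norm v i)
    rw [Int.norm_eq_abs]
    exact_mod_cast Int.one_le_abs hi
  rcases hp with h | h
  · exact (key _ h).trans (le_max_left _ _)
  · exact (key _ h).trans (le_max_right _ _)

end NarainCharge

namespace NarainModuli

variable {d : ℕ} (M : NarainModuli d)

/-- The mass is a quadratic form on ℝ^{2d} evaluated at integer points. It is positive definite: the
g-term is positive for n ≠ 0, and for n = 0 the first term is the g⁻¹-norm of m. -/
lemma exists_mul_norm_sq_le_massSq : ∃ ε > 0, ∀ p : NarainCharge d, ε * ‖p‖ ^ 2 ≤ M.massSq p := by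
  let q : (Fin d → ℝ) × (Fin d → ℝ) → ℝ := fun v =>
    dotProduct (v.1 + M.B.mulVec v.2) (M.g⁻¹.mulVec (v.1 + M.B.mulVec v.2)) +
      dotProduct v.2 (M.g.mulVec v.2)
  have hc : Continuous q := by
    simp only [q, dotProduct, Matrix.mulVec, Pi.add_apply]
    fun_prop
  have hh : ∀ (c : ℝ) v, q (c • v) = c ^ 2 * q v := by
    intro c v
    simp only [q, Prod.smul_fst, Prod.smul_snd, Matrix.mulVec_smul, ← smul_add, smul_dotProduct,
      dotProduct_smul, smul_eq_mul]
    ring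
  have hpos : ∀ v ≠ 0, 0 < q v := by
    intro v hv
    by_cases h2 : v.2 = 0
    · have h1 : v.1 ≠ 0 := fun h1 => hv (Prod.ext h1 h2)
      have := M.g_posDef.inv.dotProduct_mulVec_pos h1
      simpa [q, h2] using this
    · have h1 := M.g_posDef.dotProduct_mulVec_pos h2
      have h3 := M.g_posDef.inv.posSemidef.dotProduct_mulVec_nonneg (v.1 + M.B.mulVec v.2)
      simp only [star_trivial] at h1 h3
      simp only [q]
      linarith
  obtain ⟨ε, hε, h⟩ := exists_mul_norm_sq_le_of_homogeneous hc hh hpos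
  exact ⟨ε, hε, fun p => h (p.mom, p.wind)⟩

lemma massSq_pos {p : NarainCharge d} (hp : p ≠ 0) : 0 < M.massSq p := by
  obtain ⟨ε, hε, h⟩ := M.exists_mul_norm_sq_le_massSq
  have := NarainCharge.one_le_norm hp
  exact lt_of_lt_of_le (by positivity) (h p)

@[simp] lemma massSq_zero : M.massSq 0 = 0 := by
  have h1 : NarainCharge.mom (0 : NarainCharge d) = 0 := by ext; simp [NarainCharge.mom]
  have h2 : NarainCharge.wind (0 : NarainCharge d) = 0 := by ext; simp [NarainCharge.wind]
  simp [massSq, dressedMom, h1, h2]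

lemma massSq_nonneg (p : NarainCharge d) : 0 ≤ M.massSq p := by
  by_cases hp : p = 0
  · simp [hp]
  · exact (M.massSq_pos hp).le

lemma summable_massSq_rpow {σ : ℝ} (hσ : d < σ) :
    Summable fun p : {p : NarainCharge d // p ≠ 0} => M.massSq p.1 ^ (-σ) := by
  obtain ⟨ε, hε, h⟩ := M.exists_mul_norm_sq_le_massSq
  have hσ0 : 0 < σ := lt_of_le_of_lt (Nat.cast_nonneg d) hσ
  have hs : Summable fun p : NarainCharge d => ε ^ (-σ) * ‖p‖ ^ (-(2 * σ)) :=
    (NarainCharge.summable_norm_rpow d (by linarith)).mul_left _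
  refine (hs.subtype _).of_nonneg_of_le (fun p => Real.rpow_nonneg (M.massSq_nonneg _) _)
    fun p => ?_
  have hn : 0 < ‖p.1‖ := one_pos.trans_le (NarainCharge.one_le_norm p.2)
  calc M.massSq p.1 ^ (-σ) ≤ (ε * ‖p.1‖ ^ 2) ^ (-σ) :=
        Real.rpow_le_rpow_of_nonpos (by positivity) (h _) (by linarith)
    _ = ε ^ (-σ) * ‖p.1‖ ^ (-(2 * σ)) := by
        rw [Real.mul_rpow hε.le (by positivity), ← Real.rpow_natCast, ← Real.rpow_mul hn.le]
        congr 2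
        push_cast; ring

end NarainModuli

/-- The exponent is free, so exponential sums can be bounded by different powers near 0 and near ∞;
all Mellin-type integrals below are controlled in this way. -/
lemma Real.exists_exp_neg_le_rpow {σ : ℝ} (hσ : 0 ≤ σ) :
    ∃ C > 0, ∀ x > 0, Real.exp (-x) ≤ C * x ^ (-σ) := by
  obtain ⟨n, hn⟩ := exists_nat_ge σ
  refine ⟨n.factorial + 1, by positivity, fun x hx => ?_⟩
  have h1 : x ^ σ ≤ (n.factorial + 1) * Real.exp x := by
    rcases le_total x 1 with h | h
    · calc x ^ σ ≤ 1 := Real.rpow_le_one hx.le h hσ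
        _ ≤ (n.factorial + 1 : ℝ) * 1 := by
          have : (0 : ℝ) ≤ n.factorial := by positivity
          linarith
        _ ≤ _ := by gcongr; exact Real.one_le_exp hx.le
    · have h2 := Real.pow_div_factorial_le_exp x hx.le n
      have hf : (0 : ℝ) < n.factorial := by positivity
      rw [div_le_iff₀ hf] at h2
      calc x ^ σ ≤ x ^ (n : ℝ) := Real.rpow_le_rpow_of_exponent_le h hn
        _ = x ^ n := Real.rpow_natCast x n
        _ ≤ Real.exp x * n.factorial := h2
        _ ≤ _ := by nlinarith [Real.exp_pos x]
  rw [Real.rpow_neg hx.le, Real.exp_neg, ← div_eq_mul_inv, le_div_iff₀ (by positivity),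
    inv_mul_le_iff₀ (Real.exp_pos x)]
  linarith

namespace NarainModuli

variable {d : ℕ} (M : NarainModuli d)

lemma summable_exp_massSq {y : ℝ} (hy : 0 < y) :
    Summable fun p : NarainCharge d => Real.exp (-Real.pi * y * M.massSq p) := by
  have hσ : (d : ℝ) < d + 1 := by linarith
  obtain ⟨C, hC, h⟩ := Real.exists_exp_neg_le_rpow (σ := (d : ℝ) + 1) (by positivity)
  have h1 : Summable fun p : {p : NarainCharge d // p ≠ 0} =>
      Real.exp (-Real.pi * y * M.massSq p.1) := by
    refine ((M.summable_massSq_rpow hσ).mul_left (C * (Real.pi * y) ^ (-((d : ℝ) + 1)))).of_nonneg_of_le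
      (fun p => (Real.exp_pos _).le) fun p => ?_
    have hm := M.massSq_pos p.2
    have hπ := Real.pi_pos
    have := h (Real.pi * y * M.massSq p.1) (by positivity)
    rw [Real.mul_rpow (by positivity) hm.le, ← mul_assoc] at this
    simpa only [neg_mul] using this
  exact ((Set.finite_singleton (0 : NarainCharge d)).summable_compl_iff
    (f := fun p : NarainCharge d => Real.exp (-Real.pi * y * M.massSq p))).mp h1

/-- The contribution of the nonzero charges to the lattice sum at `τ₁ = 0`. -/
def nonzeroSum (y : ℝ) : ℝ :=
  ∑' p : {p : NarainCharge d // p ≠ 0}, Real.exp (-Real.pi * y * M.massSq p.1)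

/-- A large σ expresses rapid decay as y → ∞, and a σ close to d limits the growth as y → 0. -/
lemma exists_nonzeroSum_le {σ : ℝ} (hσ : d < σ) :
    ∃ C > 0, ∀ y > 0, M.nonzeroSum y ≤ C * y ^ (-σ) := by
  have hσ0 : 0 < σ := lt_of_le_of_lt (Nat.cast_nonneg d) hσ
  obtain ⟨C, hC, h⟩ := Real.exists_exp_neg_le_rpow hσ0.le
  have hs := M.summable_massSq_rpow hσ
  refine ⟨C * Real.pi ^ (-σ) * ((∑' p : {p : NarainCharge d // p ≠ 0}, M.massSq p.1 ^ (-σ)) + 1), ?_,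
    fun y hy => ?_⟩
  · have : 0 ≤ ∑' p : {p : NarainCharge d // p ≠ 0}, M.massSq p.1 ^ (-σ) :=
      tsum_nonneg fun p => Real.rpow_nonneg (M.massSq_nonneg _) _
    have := Real.pi_pos
    positivity
  have h1 : M.nonzeroSum y ≤ ∑' p : {p : NarainCharge d // p ≠ 0},
      C * Real.pi ^ (-σ) * y ^ (-σ) * M.massSq p.1 ^ (-σ) := by
    refine ((M.summable_exp_massSq hy).subtype _).tsum_le_tsum (fun p => ?_) (hs.mul_left _)
    have hm := M.massSq_pos p.2
    have hπ := Real.pi_pos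
    have := h (Real.pi * y * M.massSq p.1) (by positivity)
    rw [Real.mul_rpow (by positivity) hm.le, Real.mul_rpow hπ.le hy.le] at this
    simp only [neg_mul]
    linarith
  rw [tsum_mul_left] at h1
  refine h1.trans ?_
  have : 0 < Real.pi ^ (-σ) := Real.rpow_pos_of_pos Real.pi_pos _
  have : 0 < y ^ (-σ) := Real.rpow_pos_of_pos hy _
  have : 0 < C * Real.pi ^ (-σ) * y ^ (-σ) := by positivity
  nlinarith

end NarainModuli

/-! ### Poisson summation in several variables -/

section Poisson

variable {d : ℕ}

/-- An integer vector as a real vector. -/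
def intVec (m : Fin d → ℤ) : Fin d → ℝ := fun i => (m i : ℝ)

lemma norm_intVec (m : Fin d → ℤ) : ‖intVec m‖ = ‖m‖ := rfl

lemma summable_one_add_norm_int_rpow {r : ℝ} (hr : d < r) :
    Summable fun m : Fin d → ℤ => (1 + ‖m‖) ^ (-r) := by
  let b := Pi.basisFun ℝ (Fin d)
  let L := Submodule.span ℤ (Set.range b)
  have hf : Module.finrank ℤ L = d := by
    rw [ZLattice.rank ℝ L]
    simp
  have hs := ZLattice.summable_norm_rpow L (-r) (by rw [hf]; linarith)
  have hmem : ∀ m : Fin d → ℤ, intVec m ∈ L := by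
    intro m
    rw [b.mem_span_iff_repr_mem ℤ]
    exact fun i => ⟨m i, by simp [b, intVec]⟩
  have hinj : Function.Injective fun m : Fin d → ℤ => (⟨intVec m, hmem m⟩ : L) := by
    intro p q h
    simp only [Subtype.mk.injEq] at h
    refine funext fun i => ?_
    have := congrFun h i
    simpa [intVec] using this
  have hs' : Summable fun m : Fin d → ℤ => ‖m‖ ^ (-r) :=
    (hs.comp_injective hinj).congr fun p => rfl
  refine Summable.of_norm_bounded_eventually (g := fun m : Fin d → ℤ => ‖m‖ ^ (-r)) hs' ?_
  filter_upwards [(Set.finite_singleton (0 : Fin d → ℤ)).compl_mem_cofinite] with m hm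
  have hm0 : 0 < ‖m‖ := norm_pos_iff.mpr hm
  rw [Real.norm_of_nonneg (by positivity)]
  have hr0 : 0 ≤ r := (Nat.cast_nonneg d).trans hr.le
  exact Real.rpow_le_rpow_of_nonpos hm0 (by linarith) (by linarith)

/-- Peetre's inequality, from 1 + ‖v‖ ≤ (1 + ‖x‖)(1 + ‖x + v‖). It takes a translation out of a
decay bound, so that periodisations converge locally uniformly. -/
lemma one_add_norm_rpow_le {V : Type*} [NormedAddCommGroup V] {r : ℝ} (hr : 0 ≤ r) (x v : V) :
    (1 + ‖x + v‖) ^ (-r) ≤ (1 + ‖x‖) ^ r * (1 + ‖v‖) ^ (-r) := by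
  have h : 1 + ‖v‖ ≤ (1 + ‖x‖) * (1 + ‖x + v‖) := by
    have : ‖v‖ ≤ ‖x‖ + ‖x + v‖ := by
      calc ‖v‖ = ‖(x + v) - x‖ := by simp
        _ ≤ ‖x + v‖ + ‖x‖ := norm_sub_le _ _
        _ = _ := add_comm _ _
    nlinarith [norm_nonneg x, norm_nonneg (x + v)]
  have h1 : 0 < 1 + ‖x‖ := by positivity
  have h2 : 0 < 1 + ‖v‖ := by positivity
  have h3 : 0 < 1 + ‖x + v‖ := by positivity
  calc (1 + ‖x + v‖) ^ (-r) ≤ ((1 + ‖v‖) / (1 + ‖x‖)) ^ (-r) := by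
        apply Real.rpow_le_rpow_of_nonpos (by positivity) _ (by linarith)
        rw [div_le_iff₀ h1]; linarith
    _ = _ := by
        rw [Real.div_rpow h2.le h1.le, Real.rpow_neg h1.le, Real.rpow_neg h2.le]
        field_simp

lemma UnitAddTorus.isQuotientMap_coe :
    IsQuotientMap fun (x : Fin d → ℝ) (i : Fin d) => (x i : UnitAddCircle) :=
  (IsOpenQuotientMap.piMap (f := fun (_ : Fin d) (x : ℝ) => (x : UnitAddCircle))
    fun _ => QuotientAddGroup.isOpenQuotientMap_mk).isQuotientMap

lemma UnitAddTorus.mFourier_coe (k : Fin d → ℤ) (x : Fin d → ℝ) :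
    UnitAddTorus.mFourier k (fun i => (x i : UnitAddCircle)) =
      Complex.exp (2 * Real.pi * Complex.I * (intVec k ⬝ᵥ x : ℝ)) := by
  simp only [UnitAddTorus.mFourier, ContinuousMap.coe_mk, fourier_coe_apply, ← Complex.exp_sum]
  congr 1
  simp only [dotProduct, intVec, Complex.ofReal_sum, Finset.mul_sum]
  refine Finset.sum_congr rfl fun i _ => ?_
  push_cast
  ring

lemma UnitAddTorus.mFourier_coe_add_intVec (k m : Fin d → ℤ) (x : Fin d → ℝ) :
    UnitAddTorus.mFourier k (fun i => ((x + intVec m) i : UnitAddCircle)) =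
      UnitAddTorus.mFourier k (fun i => (x i : UnitAddCircle)) := by
  congr 1
  funext i
  simp only [Pi.add_apply, intVec, AddCircle.coe_add]
  have : ((m i : ℝ) : UnitAddCircle) = 0 := by
    rw [AddCircle.coe_eq_zero_iff]
    exact ⟨m i, by simp⟩
  rw [this, add_zero]

/-- **Poisson summation** on `ℝ^d` for a continuous function of sufficiently fast decay with
summable Fourier transform. -/
theorem tsum_intVec_eq_tsum_integral {f : (Fin d → ℝ) → ℂ} (hf : Continuous f) {C r : ℝ}
    (hr : d < r) (hC : ∀ x, ‖f x‖ ≤ C * (1 + ‖x‖) ^ (-r))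
    (hs : Summable fun k : Fin d → ℤ =>
      ∫ x, Complex.exp (-(2 * Real.pi * Complex.I * (intVec k ⬝ᵥ x : ℝ))) * f x) :
    ∑' m : Fin d → ℤ, f (intVec m) = ∑' k : Fin d → ℤ,
      ∫ x, Complex.exp (-(2 * Real.pi * Complex.I * (intVec k ⬝ᵥ x : ℝ))) * f x := by
  have hr0 : 0 ≤ r := (Nat.cast_nonneg d).trans hr.le
  have hC0 : 0 ≤ C := by
    have := (norm_nonneg _).trans (hC 0)
    simpa using this
  have hbound : ∀ (x : Fin d → ℝ) (m : Fin d → ℤ),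
      ‖f (x + intVec m)‖ ≤ C * (1 + ‖x‖) ^ r * (1 + ‖m‖) ^ (-r) := by
    intro x m
    refine (hC _).trans ?_
    rw [mul_assoc]
    gcongr
    simpa [norm_intVec] using one_add_norm_rpow_le hr0 x (intVec m)
  have hsum := summable_one_add_norm_int_rpow hr
  -- The periodisation of f; its Fourier coefficients on the torus will be the Fourier transform of
  -- f at integer points.
  let Φ : (Fin d → ℝ) → ℂ := fun x => ∑' m : Fin d → ℤ, f (x + intVec m)
  have hΦ : Continuous Φ := by
    rw [continuous_iff_continuousAt]
    intro x₀
    refine ContinuousOn.continuousAt (s := Metric.ball 0 (‖x₀‖ + 1)) ?_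
      (Metric.isOpen_ball.mem_nhds (by simp))
    refine continuousOn_tsum (u := fun m => C * (1 + (‖x₀‖ + 1)) ^ r * (1 + ‖m‖) ^ (-r))
      (fun m => (hf.comp (continuous_id.add continuous_const)).continuousOn)
      (hsum.mul_left _) fun m x hx => (hbound x m).trans ?_
    have : ‖x‖ ≤ ‖x₀‖ + 1 := by
      rw [Metric.mem_ball, dist_zero_right] at hx
      exact hx.le
    gcongr
  have hper : ∀ x (m : Fin d → ℤ), Φ (x + intVec m) = Φ x := by
    intro x m
    simp only [Φ]
    rw [← (Equiv.addLeft m).tsum_eq fun n => f (x + intVec n)]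
    refine tsum_congr fun n => ?_
    congr 1
    funext i
    simp [intVec, add_assoc]
  let π : (Fin d → ℝ) → UnitAddTorus (Fin d) := fun x i => (x i : UnitAddCircle)
  have hπ : IsQuotientMap π := UnitAddTorus.isQuotientMap_coe
  -- A set-theoretic section suffices to descend Φ to the torus: by periodicity Φ ∘ σ ∘ π = Φ, and
  -- continuity follows since π is a quotient map.
  let σ := Function.surjInv hπ.surjective
  have hσ : ∀ x, Φ (σ (π x)) = Φ x := by
    intro x
    have h1 : π (σ (π x)) = π x := Function.surjInv_eq hπ.surjective _
    have h2 : ∀ i, ∃ n : ℤ, σ (π x) i = x i + n := by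
      intro i
      have := congrFun h1 i
      simp only [π] at this
      rw [← sub_eq_zero, ← AddCircle.coe_sub, AddCircle.coe_eq_zero_iff] at this
      obtain ⟨n, hn⟩ := this
      refine ⟨n, ?_⟩
      simp only [zsmul_eq_mul, mul_one] at hn
      linarith
    choose n hn using h2
    have : σ (π x) = x + intVec n := funext fun i => by simp [hn, intVec]
    rw [this, hper]
  let F : C(UnitAddTorus (Fin d), ℂ) :=
    ⟨fun t => Φ (σ t), hπ.continuous_iff.mpr (hΦ.congr fun x => (hσ x).symm)⟩
  have hF : ∀ x, F (π x) = Φ x := hσ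
  have hint : ∀ k : Fin d → ℤ, Integrable fun x =>
      Complex.exp (-(2 * Real.pi * Complex.I * (intVec k ⬝ᵥ x : ℝ))) * f x := by
    intro k
    have h1 : Integrable f := by
      refine ((integrable_one_add_norm (E := Fin d → ℝ) (μ := volume) (r := r)
        (by simpa using hr)).const_mul C).mono' hf.aestronglyMeasurable (ae_of_all _ hC)
    refine h1.mono (Continuous.aestronglyMeasurable (by
      simp only [dotProduct]; fun_prop)) (ae_of_all _ fun x => ?_)
    rw [norm_mul, Complex.norm_exp]
    simp
  -- Half-open unit cubes at the integer points tile ℝ^d, so the integral over the line of cubes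
  -- glues to the integral over ℝ^d.
  let cube : (Fin d → ℤ) → Set (Fin d → ℝ) := fun m =>
    {x | ∀ i, x i ∈ Set.Ioc (intVec m i) (intVec m i + 1)}
  have hcube_meas : ∀ m, MeasurableSet (cube m) := fun m =>
    MeasurableSet.univ_pi' fun i => measurableSet_Ioc
  have hcube_union : ⋃ m, cube m = Set.univ := by
    refine Set.eq_univ_of_forall fun x => ?_
    rw [Set.mem_iUnion]
    refine ⟨fun i => ⌈x i⌉ - 1, fun i => ?_⟩
    simp only [intVec, Set.mem_Ioc, Int.cast_sub, Int.cast_one]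
    constructor
    · linarith [Int.ceil_lt_add_one (x i)]
    · linarith [Int.le_ceil (x i)]
  have hcube_disj : Pairwise (Function.onFun Disjoint cube) := by
    intro m n hmn
    rw [Function.onFun, Set.disjoint_left]
    intro x hx hx'
    apply hmn
    funext i
    have h1 := hx i
    have h2 := hx' i
    simp only [intVec, Set.mem_Ioc] at h1 h2
    have h3 : (m i : ℝ) < n i + 1 := by linarith
    have h4 : (n i : ℝ) < m i + 1 := by linarith
    have h3' : m i < n i + 1 := by exact_mod_cast h3
    have h4' : n i < m i + 1 := by exact_mod_cast h4
    omega
  have hshift : ∀ (g : (Fin d → ℝ) → ℂ) (m : Fin d → ℤ),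
      ∫ x in cube m, g x = ∫ x in cube 0, g (x + intVec m) := by
    intro g m
    have hmp : MeasurePreserving (fun x : Fin d → ℝ => x + intVec m) volume volume :=
      measurePreserving_add_right volume (intVec m)
    have hpre : (fun x : Fin d → ℝ => x + intVec m) ⁻¹' (cube m) = cube 0 := by
      ext x
      simp only [cube, Set.mem_preimage, Set.mem_ofPred_eq, Pi.add_apply, Set.mem_Ioc, intVec,
        Pi.zero_apply, Int.cast_zero]
      refine forall_congr' fun i => ?_
      constructor <;> rintro ⟨h1, h2⟩ <;> constructor <;> linarith
    rw [← hpre, hmp.setIntegral_preimage_emb (MeasurableEquiv.addRight _).measurableEmbedding]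
  have hcube_norm : ∀ x ∈ cube 0, ‖x‖ ≤ 1 := by
    intro x hx
    rw [pi_norm_le_iff_of_nonneg zero_le_one]
    intro i
    have := hx i
    simp only [intVec, Pi.zero_apply, Int.cast_zero, Set.mem_Ioc] at this
    rw [Real.norm_eq_abs, abs_le]
    constructor <;> linarith
  have hcube_vol : volume (cube 0) ≠ ⊤ := by
    have : cube 0 ⊆ Metric.closedBall 0 1 := fun x hx => by simpa using hcube_norm x hx
    exact ((measure_mono this).trans_lt measure_closedBall_lt_top).ne
  have hcoeff : ∀ k : Fin d → ℤ, UnitAddTorus.mFourierCoeff F k =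
      ∫ x, Complex.exp (-(2 * Real.pi * Complex.I * (intVec k ⬝ᵥ x : ℝ))) * f x := by
    intro k
    set e : (Fin d → ℝ) → ℂ := fun x =>
      Complex.exp (-(2 * Real.pi * Complex.I * (intVec k ⬝ᵥ x : ℝ))) with he
    have he' : ∀ x, UnitAddTorus.mFourier (-k) (π x) = e x := by
      intro x
      simp only [π, he]
      rw [UnitAddTorus.mFourier_coe]
      congr 1
      simp [intVec, dotProduct, Complex.ofReal_sum, Finset.mul_sum]
    have hep : ∀ x (m : Fin d → ℤ), e (x + intVec m) = e x := by
      intro x m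
      rw [← he', ← he']
      exact UnitAddTorus.mFourier_coe_add_intVec _ _ _
    have hen : ∀ x, ‖e x‖ = 1 := by
      intro x
      simp [he, Complex.norm_exp]
    have hec : Continuous e := by
      simp only [he, dotProduct]; fun_prop
    rw [UnitAddTorus.mFourierCoeff_eq_integral _ _ (intVec 0)]
    calc ∫ x in cube 0, UnitAddTorus.mFourier (-k) (π x) • F (π x)
        = ∫ x in cube 0, ∑' m : Fin d → ℤ, e x * f (x + intVec m) := by
          refine setIntegral_congr_fun (hcube_meas 0) fun x _ => ?_
          simp only [smul_eq_mul, he', hF, Φ, tsum_mul_left]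
      _ = ∑' m : Fin d → ℤ, ∫ x in cube 0, e x * f (x + intVec m) := by
          have hb : ∀ m : Fin d → ℤ, ∀ x ∈ cube 0,
              ‖e x * f (x + intVec m)‖ ≤ C * 2 ^ r * (1 + ‖m‖) ^ (-r) := by
            intro m x hx
            rw [norm_mul, hen, one_mul]
            refine (hbound x m).trans ?_
            have := hcube_norm x hx
            have h2 : 1 + ‖x‖ ≤ 2 := by linarith
            gcongr
          symm
          refine (hasSum_integral_of_summable_integral_norm
            (F := fun (m : Fin d → ℤ) x => e x * f (x + intVec m)) (fun m => ?_) ?_).tsum_eq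
          · refine Measure.integrableOn_of_bounded hcube_vol
              (Continuous.aestronglyMeasurable (by fun_prop)) (M := C * 2 ^ r * (1 + ‖m‖) ^ (-r)) ?_
            exact (ae_restrict_iff' (hcube_meas 0)).mpr (ae_of_all _ (hb m))
          · refine Summable.of_norm_bounded
              ((hsum.mul_left (C * 2 ^ r)).mul_right (volume.real (cube 0))) fun m => ?_
            refine norm_setIntegral_le_of_norm_le_const hcube_vol.lt_top fun x hx => ?_
            rw [norm_norm]
            exact hb m x hx
      _ = ∑' m : Fin d → ℤ, ∫ x in cube m, e x * f x := by
          refine tsum_congr fun m => ?_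
          rw [hshift (fun x => e x * f x) m]
          simp only [hep]
      _ = ∫ x in ⋃ m, cube m, e x * f x :=
          (integral_iUnion hcube_meas hcube_disj (hint k).integrableOn).symm
      _ = ∫ x, e x * f x := by rw [hcube_union, setIntegral_univ]
  have hsF : Summable (UnitAddTorus.mFourierCoeff F) := by
    simpa only [funext hcoeff] using hs
  -- With summable coefficients the Fourier series converges to the function at every point; the
  -- origin gives the formula.
  have key := (UnitAddTorus.hasSum_mFourier_series_apply_of_summable hsF (π 0)).tsum_eq
  rw [hF] at key
  simp only [Φ, zero_add] at key
  rw [← key]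
  refine tsum_congr fun k => ?_
  rw [hcoeff, show UnitAddTorus.mFourier k (π 0) = 1 by
    simp only [π]; rw [UnitAddTorus.mFourier_coe]; simp]
  simp

end Poisson

/-! ### Fourier transforms and Poisson summation of Gaussians -/

section Gaussian

variable {d : ℕ}

lemma Matrix.PosDef.exists_eq_transpose_mul_self {G : Matrix (Fin d) (Fin d) ℝ} (hG : G.PosDef) :
    ∃ A : Matrix (Fin d) (Fin d) ℝ, G = A.transpose * A ∧ A.det ≠ 0 ∧ |A.det| = √G.det := by
  obtain ⟨A, hA⟩ : ∃ A : Matrix (Fin d) (Fin d) ℝ, G = A.transpose * A := by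
    open scoped MatrixOrder in
    obtain ⟨A, hA⟩ := CStarAlgebra.nonneg_iff_eq_star_mul_self.mp hG.posSemidef.nonneg
    exact ⟨A, by rw [hA, Matrix.star_eq_conjTranspose, Matrix.conjTranspose_eq_transpose_of_trivial]⟩
  have hdet : G.det = A.det ^ 2 := by rw [hA, Matrix.det_mul, Matrix.det_transpose, sq]
  refine ⟨A, hA, fun h => ?_, ?_⟩
  · have := hG.det_pos
    rw [hdet, h] at this
    simp at this
  · rw [hdet, Real.sqrt_sq_eq_abs]

lemma Matrix.dotProduct_transpose_mul_self_mulVec (A : Matrix (Fin d) (Fin d) ℝ)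
    (v : Fin d → ℝ) :
    v ⬝ᵥ (A.transpose * A).mulVec v = ∑ i, (A.mulVec v) i ^ 2 := by
  rw [← Matrix.mulVec_mulVec, Matrix.dotProduct_mulVec, Matrix.vecMul_transpose]
  simp [dotProduct, sq]

/-- The Fourier transform of a Gaussian attached to a positive definite quadratic form. -/
lemma integral_gaussian_quadraticForm {G : Matrix (Fin d) (Fin d) ℝ} (hG : G.PosDef)
    (k : Fin d → ℝ) :
    ∫ u : Fin d → ℝ, Complex.exp (-(Real.pi : ℂ) * (u ⬝ᵥ G⁻¹.mulVec u : ℝ)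
        - 2 * Real.pi * Complex.I * (k ⬝ᵥ u : ℝ)) =
      (√G.det : ℝ) * Complex.exp (-(Real.pi : ℂ) * (k ⬝ᵥ G.mulVec k : ℝ)) := by
  obtain ⟨A, hA, hA0, hdet⟩ := hG.exists_eq_transpose_mul_self
  have hAu : IsUnit A.det := hA0.isUnit
  have hmap := Real.map_matrix_volume_pi_eq_smul_volume_pi
    (M := A.transpose) (by rwa [Matrix.det_transpose])
  rw [Matrix.det_transpose] at hmap
  set f : (Fin d → ℝ) → ℂ := fun u => Complex.exp (-(Real.pi : ℂ) * (u ⬝ᵥ G⁻¹.mulVec u : ℝ)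
        - 2 * Real.pi * Complex.I * (k ⬝ᵥ u : ℝ)) with hf
  have hfc : Continuous f := by
    simp only [hf, dotProduct, Matrix.mulVec]
    fun_prop
  have h1 : ∫ w, f (A.transpose.mulVec w) = |A.det⁻¹| • ∫ u, f u := by
    have := integral_map (μ := volume) (φ := Matrix.toLin' A.transpose) (f := f)
      (LinearMap.continuous_of_finiteDimensional _).aemeasurable hfc.aestronglyMeasurable
    rw [hmap, integral_smul_measure, ENNReal.toReal_ofReal (abs_nonneg _)] at this
    simpa using this.symm
  have hk : ∑ i, (A.mulVec k) i ^ 2 = k ⬝ᵥ G.mulVec k := by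
    rw [hA, Matrix.dotProduct_transpose_mul_self_mulVec]
  -- Under u = Aᵀw with G = AᵀA the form u·G⁻¹u becomes ∑ wᵢ² and k·u becomes (Ak)·w, so the
  -- standard Gaussian integral applies.
  have h2 : ∀ w, f (A.transpose.mulVec w) = Complex.exp (-(Real.pi : ℂ) * ∑ i, (w i : ℂ) ^ 2 +
      ∑ i, (-(2 * Real.pi * Complex.I * (A.mulVec k i : ℝ))) * w i) := by
    intro w
    have e1 : A.transpose.mulVec w ⬝ᵥ G⁻¹.mulVec (A.transpose.mulVec w) = ∑ i, w i ^ 2 := by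
      have : G⁻¹.mulVec (A.transpose.mulVec w) = A⁻¹.mulVec w := by
        rw [hA, Matrix.mul_inv_rev, Matrix.mulVec_mulVec, Matrix.mul_assoc,
          Matrix.nonsing_inv_mul _ (by rwa [Matrix.det_transpose]), Matrix.mul_one]
      rw [this, Matrix.mulVec_transpose, ← Matrix.dotProduct_mulVec, Matrix.mulVec_mulVec,
        Matrix.mul_nonsing_inv _ hAu, Matrix.one_mulVec]
      simp [dotProduct, sq]
    have e2 : k ⬝ᵥ A.transpose.mulVec w = ∑ i, A.mulVec k i * w i := by
      rw [Matrix.dotProduct_mulVec, Matrix.vecMul_transpose]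
      rfl
    simp only [hf, e1, e2]
    congr 1
    push_cast
    rw [sub_eq_add_neg, Finset.mul_sum (a := 2 * (Real.pi : ℂ) * Complex.I),
      ← Finset.sum_neg_distrib]
    congr 1
    refine Finset.sum_congr rfl fun i _ => by ring
  have h3 : ∫ w, f (A.transpose.mulVec w) =
      Complex.exp (-(Real.pi : ℂ) * (k ⬝ᵥ G.mulVec k : ℝ)) := by
    simp only [h2]
    rw [GaussianFourier.integral_cexp_neg_mul_sum_add (by simpa using Real.pi_pos), div_self
      (by exact_mod_cast Real.pi_ne_zero), Complex.one_cpow, one_mul, ← hk]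
    congr 1
    push_cast
    rw [Finset.mul_sum, Finset.sum_div]
    refine Finset.sum_congr rfl fun i _ => ?_
    have : (Real.pi : ℂ) ≠ 0 := by exact_mod_cast Real.pi_ne_zero
    field_simp
    rw [Complex.I_sq]
    ring
  rw [← h3, h1, ← hdet, abs_inv, Complex.real_smul, ← mul_assoc, ← Complex.ofReal_mul,
    mul_inv_cancel₀ (abs_ne_zero.mpr hA0), Complex.ofReal_one, one_mul]

lemma exists_exp_neg_quadraticForm_le {G : Matrix (Fin d) (Fin d) ℝ} (hG : G.PosDef) {r : ℝ}
    (hr : 0 ≤ r) :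
    ∃ C > 0, ∀ u : Fin d → ℝ,
      Real.exp (-Real.pi * (u ⬝ᵥ G.mulVec u)) ≤ C * (1 + ‖u‖) ^ (-r) := by
  obtain ⟨ε, hε, h⟩ := exists_mul_norm_sq_le_of_homogeneous
    (q := fun u : Fin d → ℝ => u ⬝ᵥ G.mulVec u)
    (by simp only [dotProduct, Matrix.mulVec]; fun_prop)
    (fun c v => by
      simp only [Matrix.mulVec_smul, smul_dotProduct, dotProduct_smul, smul_eq_mul]; ring)
    (fun v hv => by simpa using hG.dotProduct_mulVec_pos hv)
  obtain ⟨C, hC, hexp⟩ := Real.exists_exp_neg_le_rpow hr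
  have hπ := Real.pi_pos
  set δ := Real.pi * ε with hδ
  have hδ0 : 0 < δ := by positivity
  refine ⟨Real.exp (3 * δ) * C * (2 * δ) ^ (-r), by positivity, fun u => ?_⟩
  -- From δ(‖u‖ - 1)² ≥ 0: δ‖u‖² ≥ 2δ‖u‖ - δ = 2δ(1 + ‖u‖) - 3δ.
  have h1 : -Real.pi * (u ⬝ᵥ G.mulVec u) ≤ 3 * δ + -(2 * δ * (1 + ‖u‖)) := by
    have := h u
    nlinarith [mul_nonneg hδ0.le (sq_nonneg (‖u‖ - 1))]
  calc Real.exp (-Real.pi * (u ⬝ᵥ G.mulVec u))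
      ≤ Real.exp (3 * δ) * Real.exp (-(2 * δ * (1 + ‖u‖))) := by
        rw [← Real.exp_add]; exact Real.exp_le_exp.mpr h1
    _ ≤ Real.exp (3 * δ) * (C * (2 * δ * (1 + ‖u‖)) ^ (-r)) := by
        gcongr
        exact hexp _ (by positivity)
    _ = _ := by
        rw [Real.mul_rpow (by positivity) (by positivity)]
        ring

/-- Poisson summation for a shifted Gaussian with a character. -/
theorem tsum_gaussian_eq_tsum_gaussian {G : Matrix (Fin d) (Fin d) ℝ} (hG : G.PosDef)
    (b z : Fin d → ℝ) :
    ∑' m : Fin d → ℤ, Complex.exp (-(Real.pi : ℂ) *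
        ((intVec m + b) ⬝ᵥ G⁻¹.mulVec (intVec m + b) : ℝ)
          - 2 * Real.pi * Complex.I * (z ⬝ᵥ intVec m : ℝ)) =
      (√G.det : ℝ) * ∑' k : Fin d → ℤ, Complex.exp (-(Real.pi : ℂ) *
        ((intVec k + z) ⬝ᵥ G.mulVec (intVec k + z) : ℝ)
          + 2 * Real.pi * Complex.I * ((intVec k + z) ⬝ᵥ b : ℝ)) := by
  obtain ⟨r, hr⟩ : ∃ r : ℝ, (d : ℝ) < r := exists_gt _
  have hr0 : 0 ≤ r := (Nat.cast_nonneg d).trans hr.le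
  obtain ⟨C, hC, hCb⟩ := exists_exp_neg_quadraticForm_le hG.inv hr0
  obtain ⟨C', hC', hCb'⟩ := exists_exp_neg_quadraticForm_le hG hr0
  set f : (Fin d → ℝ) → ℂ := fun u => Complex.exp (-(Real.pi : ℂ) *
        ((u + b) ⬝ᵥ G⁻¹.mulVec (u + b) : ℝ) - 2 * Real.pi * Complex.I * (z ⬝ᵥ u : ℝ)) with hf
  have hfc : Continuous f := by
    simp only [hf, dotProduct, Matrix.mulVec, Pi.add_apply]
    fun_prop
  have hfn : ∀ u, ‖f u‖ ≤ (C * (1 + ‖b‖) ^ r) * (1 + ‖u‖) ^ (-r) := by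
    intro u
    have h1 : ‖f u‖ = Real.exp (-Real.pi * ((u + b) ⬝ᵥ G⁻¹.mulVec (u + b))) := by
      simp only [hf, Complex.norm_exp]
      simp
    rw [h1, mul_assoc]
    refine (hCb _).trans ?_
    rw [add_comm u b]
    gcongr
    exact one_add_norm_rpow_le hr0 b u
  have hcoeff : ∀ k : Fin d → ℤ,
      ∫ x, Complex.exp (-(2 * Real.pi * Complex.I * (intVec k ⬝ᵥ x : ℝ))) * f x =
      (√G.det : ℝ) * Complex.exp (-(Real.pi : ℂ) *
        ((intVec k + z) ⬝ᵥ G.mulVec (intVec k + z) : ℝ)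
          + 2 * Real.pi * Complex.I * ((intVec k + z) ⬝ᵥ b : ℝ)) := by
    intro k
    rw [Complex.exp_add, ← mul_assoc, ← integral_gaussian_quadraticForm hG, ← integral_mul_const]
    -- Translating the Gaussian integral by b turns the character at k + z into the phase that
    -- belongs to the shift b.
    conv_rhs => rw [← integral_add_right_eq_self _ b]
    refine integral_congr_ae (ae_of_all _ fun u => ?_)
    simp only [hf, ← Complex.exp_add]
    congr 1
    simp only [add_dotProduct, dotProduct_add]
    push_cast
    ring
  have key := tsum_intVec_eq_tsum_integral hfc hr hfn ?_
  · rw [key, ← tsum_mul_left]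
    exact tsum_congr hcoeff
  · rw [funext hcoeff]
    refine Summable.mul_left _ (Summable.of_norm_bounded
      ((summable_one_add_norm_int_rpow hr).mul_left (C' * (1 + ‖z‖) ^ r)) fun k => ?_)
    have h1 : ‖Complex.exp (-(Real.pi : ℂ) * ((intVec k + z) ⬝ᵥ G.mulVec (intVec k + z) : ℝ)
          + 2 * Real.pi * Complex.I * ((intVec k + z) ⬝ᵥ b : ℝ))‖ =
        Real.exp (-Real.pi * ((intVec k + z) ⬝ᵥ G.mulVec (intVec k + z))) := by
      simp only [Complex.norm_exp]
      simp
    rw [h1, mul_assoc]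
    refine (hCb' _).trans ?_
    rw [add_comm (intVec k) z, ← norm_intVec k]
    gcongr
    exact one_add_norm_rpow_le hr0 z (intVec k)

end Gaussian

/-! ### Modular invariance of the lattice partition function -/

namespace NarainCharge

variable {d : ℕ}

lemma mom_eq_intVec (p : NarainCharge d) : p.mom = intVec p.1 := rfl

lemma wind_eq_intVec (p : NarainCharge d) : p.wind = intVec p.2 := rfl

lemma pairing_cast (p : NarainCharge d) : ((p.pairing : ℤ) : ℝ) = p.mom ⬝ᵥ p.wind := by
  simp [pairing, dotProduct, mom, wind]

/-- Comparison with the moduli g = 1, B = 0, whose mass is at most 2d‖p‖²; the constant 2d + 1 stays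
positive for d = 0. -/
lemma summable_exp_neg_of_le {Q : NarainCharge d → ℝ} {ε : ℝ} (hε : 0 < ε)
    (h : ∀ p, ε * ‖p‖ ^ 2 ≤ Q p) : Summable fun p => Real.exp (-Real.pi * Q p) := by
  let M : NarainModuli d := ⟨1, 0, Matrix.PosDef.one, by simp⟩
  have hM : ∀ p : NarainCharge d, M.massSq p ≤ (2 * d + 1) * ‖p‖ ^ 2 := by
    intro p
    have hb : ∀ v : Fin d → ℤ, ‖v‖ ≤ ‖p‖ → intVec v ⬝ᵥ intVec v ≤ d * ‖p‖ ^ 2 := by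
      intro v hv
      calc intVec v ⬝ᵥ intVec v ≤ ∑ _i : Fin d, ‖p‖ ^ 2 := by
            refine Finset.sum_le_sum fun i _ => ?_
            have h1 : |(v i : ℝ)| ≤ ‖p‖ := by
              have := (norm_le_pi_norm v i).trans hv
              rwa [Int.norm_eq_abs] at this
            rw [intVec, ← sq, ← sq_abs]
            gcongr
        _ = _ := by simp
    have h1 := hb p.1 (le_max_left _ _)
    have h2 := hb p.2 (le_max_right _ _)
    have : M.massSq p = intVec p.1 ⬝ᵥ intVec p.1 + intVec p.2 ⬝ᵥ intVec p.2 := by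
      simp [NarainModuli.massSq, NarainModuli.dressedMom, M, mom_eq_intVec, wind_eq_intVec]
    rw [this]
    nlinarith [sq_nonneg ‖p‖]
  have hs := M.summable_exp_massSq (y := ε / (2 * d + 1)) (by positivity)
  refine hs.of_nonneg_of_le (fun p => (Real.exp_pos _).le) fun p => ?_
  rw [Real.exp_le_exp]
  have h1 : ε / (2 * d + 1) * M.massSq p ≤ Q p := by
    refine le_trans ?_ (h p)
    calc ε / (2 * d + 1) * M.massSq p ≤ ε / (2 * d + 1) * ((2 * d + 1) * ‖p‖ ^ 2) := by
          gcongr; exact hM p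
      _ = _ := by field_simp
  have := Real.pi_pos
  nlinarith

end NarainCharge

namespace NarainModuli

variable {d : ℕ} (M : NarainModuli d)

/-- The exponent of the Lagrangian (world-sheet instanton) form of the partition function. -/
def lagrangianForm (τ : ℍ) (v : (Fin d → ℝ) × (Fin d → ℝ)) : ℝ :=
  (v.1 + τ.re • v.2) ⬝ᵥ (τ.im⁻¹ • M.g).mulVec (v.1 + τ.re • v.2) +
    τ.im * (v.2 ⬝ᵥ M.g.mulVec v.2)

/-- A term of the Lagrangian form of the partition function. -/
def lagrangianTerm (τ : ℍ) (p : NarainCharge d) : ℂ :=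
  Complex.exp (-(Real.pi : ℂ) * (M.lagrangianForm τ (p.mom, p.wind) : ℝ)
    + 2 * Real.pi * Complex.I * (p.mom ⬝ᵥ M.B.mulVec p.wind : ℝ))

lemma summable_lagrangianTerm (τ : ℍ) : Summable (M.lagrangianTerm τ) := by
  have hy := τ.im_pos
  have hG : (τ.im⁻¹ • M.g).PosDef := M.g_posDef.smul (inv_pos.mpr hy)
  obtain ⟨ε, hε, h⟩ := exists_mul_norm_sq_le_of_homogeneous (q := M.lagrangianForm τ)
    (by
      unfold lagrangianForm
      simp only [dotProduct, Matrix.mulVec, Pi.add_apply, Pi.smul_apply]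
      fun_prop)
    (fun c v => by
      simp only [lagrangianForm, Prod.smul_fst, Prod.smul_snd, Matrix.mulVec_smul,
        smul_comm τ.re c, ← smul_add, smul_dotProduct, dotProduct_smul, smul_eq_mul]
      ring)
    (fun v hv => by
      unfold lagrangianForm
      by_cases h2 : v.2 = 0
      · have h1 : v.1 ≠ 0 := fun h1 => hv (Prod.ext h1 h2)
        have := hG.dotProduct_mulVec_pos h1
        simpa [h2] using this
      · have h1 := mul_pos hy (M.g_posDef.dotProduct_mulVec_pos h2)
        have h3 := hG.posSemidef.dotProduct_mulVec_nonneg (v.1 + τ.re • v.2)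
        simp only [star_trivial] at h1 h3
        linarith)
  refine Summable.of_norm ((NarainCharge.summable_exp_neg_of_le hε
    (fun p => h (p.mom, p.wind))).congr fun p => ?_)
  simp only [lagrangianTerm, Complex.norm_exp]
  simp

lemma norm_exp_massSq_pairing (x y : ℝ) (p : NarainCharge d) :
    ‖Complex.exp (-(Real.pi : ℂ) * (y : ℂ) * (M.massSq p : ℂ)
        - 2 * (Real.pi : ℂ) * Complex.I * (x : ℂ) * (p.pairing : ℂ))‖ =
      Real.exp (-Real.pi * y * M.massSq p) := by
  simp only [Complex.norm_exp]
  simp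

lemma summable_latticeTerm (x : ℝ) {y : ℝ} (hy : 0 < y) :
    Summable fun p : NarainCharge d => Complex.exp (-(Real.pi : ℂ) * (y : ℂ) * (M.massSq p : ℂ)
        - 2 * (Real.pi : ℂ) * Complex.I * (x : ℂ) * (p.pairing : ℂ)) :=
  Summable.of_norm ((M.summable_exp_massSq hy).congr fun p =>
    (M.norm_exp_massSq_pairing x y p).symm)

lemma wind_dotProduct_B (n : Fin d → ℝ) : n ⬝ᵥ M.B.mulVec n = 0 := by
  have h : n ⬝ᵥ M.B.mulVec n = -(n ⬝ᵥ M.B.mulVec n) := by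
    conv_lhs => rw [Matrix.dotProduct_mulVec, ← Matrix.mulVec_transpose, M.B_antisymm,
      Matrix.neg_mulVec, neg_dotProduct, dotProduct_comm]
  linarith

/-- Poisson summation over m at fixed n, with shift Bn and character τ₁n. The cross term τ₁ n·Bn
vanishes by antisymmetry, and √det(g/τ₂) cancels the prefactor τ₂^{d/2}. -/
theorem latticePartition_eq_tsum_lagrangianTerm (τ : ℍ) :
    M.latticePartition τ = (√M.g.det : ℝ) * ∑' p, M.lagrangianTerm τ p := by
  have hy := τ.im_pos
  have hG : (τ.im⁻¹ • M.g).PosDef := M.g_posDef.smul (inv_pos.mpr hy)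
  have hinv : (τ.im⁻¹ • M.g)⁻¹ = τ.im • M.g⁻¹ := by
    have hdet : IsUnit M.g.det := M.g_posDef.det_pos.ne'.isUnit
    refine Matrix.inv_eq_left_inv ?_
    rw [Matrix.smul_mul, Matrix.mul_smul, Matrix.nonsing_inv_mul _ hdet, smul_smul,
      mul_inv_cancel₀ hy.ne', one_smul]
  have hdet : √(τ.im⁻¹ • M.g).det = τ.im ^ (-((d : ℝ) / 2)) * √M.g.det := by
    rw [Matrix.det_smul, Fintype.card_fin, Real.sqrt_mul (by positivity), Real.sqrt_eq_rpow,
      ← Real.rpow_natCast, Real.inv_rpow hy.le, ← Real.rpow_neg hy.le, ← Real.rpow_mul hy.le]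
    congr 2
    ring
  unfold latticePartition
  have hswap : ∀ f : NarainCharge d → ℂ, Summable f → ∑' p, f p = ∑' n, ∑' m, f (m, n) := by
    intro f hf
    rw [← (Equiv.prodComm (Fin d → ℤ) (Fin d → ℤ)).tsum_eq f]
    exact ((Equiv.prodComm _ _).summable_iff.mpr hf).tsum_prod
  rw [hswap _ (M.summable_latticeTerm τ.re hy), hswap _ (M.summable_lagrangianTerm τ),
    ← tsum_mul_left, ← tsum_mul_left]
  refine tsum_congr fun n => ?_
  have key := tsum_gaussian_eq_tsum_gaussian hG (M.B.mulVec (intVec n)) (τ.re • intVec n)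
  rw [hinv, hdet] at key
  have hL : ∀ m : Fin d → ℤ, Complex.exp (-(Real.pi : ℂ) * (τ.im : ℂ) * (M.massSq (m, n) : ℂ)
        - 2 * (Real.pi : ℂ) * Complex.I * (τ.re : ℂ) * (NarainCharge.pairing (m, n) : ℂ)) =
      Complex.exp (-(Real.pi : ℂ) * (τ.im : ℂ) * (intVec n ⬝ᵥ M.g.mulVec (intVec n) : ℝ)) *
      Complex.exp (-(Real.pi : ℂ) * ((intVec m + M.B.mulVec (intVec n)) ⬝ᵥ
        (τ.im • M.g⁻¹).mulVec (intVec m + M.B.mulVec (intVec n)) : ℝ)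
          - 2 * Real.pi * Complex.I * ((τ.re • intVec n) ⬝ᵥ intVec m : ℝ)) := by
    intro m
    rw [← Complex.exp_add]
    congr 1
    have hp : ((NarainCharge.pairing (m, n) : ℤ) : ℂ) = ((intVec n ⬝ᵥ intVec m : ℝ) : ℂ) := by
      rw [dotProduct_comm, ← Complex.ofReal_intCast, NarainCharge.pairing_cast]
      rfl
    rw [hp]
    simp only [massSq, dressedMom, NarainCharge.mom_eq_intVec, NarainCharge.wind_eq_intVec,
      Matrix.smul_mulVec, dotProduct_smul, smul_dotProduct, smul_eq_mul]
    push_cast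
    ring
  have hR : ∀ k : Fin d → ℤ, M.lagrangianTerm τ (k, n) =
      Complex.exp (-(Real.pi : ℂ) * (τ.im : ℂ) * (intVec n ⬝ᵥ M.g.mulVec (intVec n) : ℝ)) *
      Complex.exp (-(Real.pi : ℂ) * ((intVec k + τ.re • intVec n) ⬝ᵥ
        (τ.im⁻¹ • M.g).mulVec (intVec k + τ.re • intVec n) : ℝ)
          + 2 * Real.pi * Complex.I *
            ((intVec k + τ.re • intVec n) ⬝ᵥ M.B.mulVec (intVec n) : ℝ)) := by
    intro k
    rw [← Complex.exp_add, lagrangianTerm]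
    congr 1
    simp only [lagrangianForm, NarainCharge.mom_eq_intVec, NarainCharge.wind_eq_intVec]
    rw [add_dotProduct (intVec k) _ (M.B.mulVec _), smul_dotProduct, M.wind_dotProduct_B]
    push_cast
    simp only [smul_zero, Complex.ofReal_zero]
    ring
  rw [tsum_congr hL, tsum_congr hR, tsum_mul_left, tsum_mul_left, key]
  have hyy : ((τ.im ^ ((d : ℝ) / 2) : ℝ) : ℂ) * ((τ.im ^ (-((d : ℝ) / 2)) : ℝ) : ℂ) = 1 := by
    rw [← Complex.ofReal_mul, ← Real.rpow_add hy]
    simp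
  push_cast at hyy ⊢
  linear_combination ((√M.g.det : ℂ) *
    Complex.exp (-(Real.pi : ℂ) * (τ.im : ℂ) * (intVec n ⬝ᵥ M.g.mulVec (intVec n) : ℝ)) *
    ∑' k : Fin d → ℤ, Complex.exp (-(Real.pi : ℂ) * ((intVec k + τ.re • intVec n) ⬝ᵥ
        (τ.im⁻¹ • M.g).mulVec (intVec k + τ.re • intVec n) : ℝ)
          + 2 * Real.pi * Complex.I *
            ((intVec k + τ.re • intVec n) ⬝ᵥ M.B.mulVec (intVec n) : ℝ))) * hyy

lemma latticePartition_T_smul (τ : ℍ) :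
    M.latticePartition (ModularGroup.T • τ) = M.latticePartition τ := by
  simp only [latticePartition, ModularGroup.im_T_smul, ModularGroup.re_T_smul]
  congr 1
  refine tsum_congr fun p => ?_
  rw [Complex.exp_eq_exp_iff_exists_int]
  refine ⟨-p.pairing, ?_⟩
  push_cast
  ring

/-- The exponent in the resummed form is the g-norm |m + nτ|²/τ₂. Replacing τ by -1/τ is undone by
(m,n) ↦ (-n,m), and this substitution fixes m·Bn because B is antisymmetric. -/
lemma latticePartition_S_smul (τ : ℍ) :
    M.latticePartition (ModularGroup.S • τ) = M.latticePartition τ := by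
  rw [latticePartition_eq_tsum_lagrangianTerm, latticePartition_eq_tsum_lagrangianTerm]
  congr 1
  let e : NarainCharge d ≃ NarainCharge d :=
    (Equiv.prodComm _ _).trans ((Equiv.neg _).prodCongr (Equiv.refl _))
  rw [← e.tsum_eq]
  refine tsum_congr fun p => ?_
  have h1 : (e p).mom = -p.wind := by
    funext i; simp [e, NarainCharge.mom, NarainCharge.wind]
  have h2 : (e p).wind = p.mom := by
    funext i; simp [e, NarainCharge.mom, NarainCharge.wind]
  have hy := τ.im_pos
  have hN : 0 < τ.re ^ 2 + τ.im ^ 2 := by positivity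
  have hNs : Complex.normSq (τ : ℂ) = τ.re ^ 2 + τ.im ^ 2 := by
    rw [Complex.normSq_apply]; simp [sq]
  have hre : (ModularGroup.S • τ).re = -τ.re / (τ.re ^ 2 + τ.im ^ 2) := by
    rw [UpperHalfPlane.modular_S_smul, ← UpperHalfPlane.coe_re]
    simp [Complex.inv_re, hNs, neg_div]
  have him : (ModularGroup.S • τ).im = τ.im / (τ.re ^ 2 + τ.im ^ 2) := by
    rw [UpperHalfPlane.modular_S_smul, ← UpperHalfPlane.coe_im]
    simp [Complex.inv_im, hNs, neg_div]
  have hsymm : p.wind ⬝ᵥ M.g.mulVec p.mom = p.mom ⬝ᵥ M.g.mulVec p.wind := by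
    have hg : M.g.transpose = M.g := by
      have := M.g_posDef.isHermitian
      rwa [Matrix.IsHermitian, Matrix.conjTranspose_eq_transpose_of_trivial] at this
    rw [Matrix.dotProduct_mulVec, ← Matrix.mulVec_transpose, hg, dotProduct_comm]
  have hB : p.mom ⬝ᵥ M.B.mulVec p.wind = -(p.wind ⬝ᵥ M.B.mulVec p.mom) := by
    rw [Matrix.dotProduct_mulVec, ← Matrix.mulVec_transpose, M.B_antisymm, Matrix.neg_mulVec,
      neg_dotProduct, dotProduct_comm]
  unfold lagrangianTerm
  rw [h1, h2, neg_dotProduct, hB]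
  congr 3
  norm_cast
  simp only [lagrangianForm, hre, him, Matrix.smul_mulVec, Matrix.mulVec_add, Matrix.mulVec_smul,
    Matrix.mulVec_neg, dotProduct_smul, smul_dotProduct, add_dotProduct, dotProduct_add,
    neg_dotProduct, dotProduct_neg, smul_eq_mul, hsymm]
  field_simp
  ring

theorem latticePartition_smul (γ : Matrix.SpecialLinearGroup (Fin 2) ℤ) (τ : ℍ) :
    M.latticePartition (γ • τ) = M.latticePartition τ := by
  have hγ : γ ∈ Subgroup.closure {ModularGroup.S, ModularGroup.T} := by
    simp [SpecialLinearGroup.SL2Z_generators]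
  induction hγ using Subgroup.closure_induction generalizing τ with
  | mem x hx =>
    rcases hx with rfl | rfl
    · exact M.latticePartition_S_smul τ
    · exact M.latticePartition_T_smul τ
  | one => rw [one_smul]
  | mul x y _ _ hx hy => rw [mul_smul, hx, hy]
  | inv x _ hx => rw [← hx (x⁻¹ • τ), smul_inv_smul]

end NarainModuli

/-! ### Unfolding over the modular group -/

section Unfolding

open Matrix.SpecialLinearGroup

/-- The modular group. -/
local notation "Γ" => Matrix.SpecialLinearGroup (Fin 2) ℤ

lemma measurePreserving_modular_smul (γ : Γ) :
    MeasurePreserving (fun τ : ℍ => γ • τ) volume volume :=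
  measurePreserving_smul (mapGL ℝ γ : GL (Fin 2) ℝ) (volume : Measure ℍ)

lemma measurableEmbedding_modular_smul (γ : Γ) : MeasurableEmbedding (fun τ : ℍ => γ • τ) :=
  measurableEmbedding_const_smul (mapGL ℝ γ : GL (Fin 2) ℝ)

lemma measurable_modular_smul (γ : Γ) : Measurable (fun τ : ℍ => γ • τ) :=
  (measurableEmbedding_modular_smul γ).measurable

lemma UpperHalfPlane.measurable_re : Measurable UpperHalfPlane.re :=
  UpperHalfPlane.continuous_re.measurable

lemma UpperHalfPlane.measurable_im : Measurable UpperHalfPlane.im :=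
  UpperHalfPlane.continuous_im.measurable

lemma measurableSet_fdo : MeasurableSet ModularGroup.fdo := ModularGroup.isOpen_fdo.measurableSet

lemma volume_eq_zero_of_coe_image {s : Set ℍ} (hs : volume ((↑) '' s : Set ℂ) = 0) :
    volume s = 0 := by
  rw [UpperHalfPlane.volume_eq_lintegral]
  exact setLIntegral_measure_zero _ _ hs

lemma volume_re_eq (c : ℝ) : volume {z : ℂ | z.re = c} = 0 := by
  have h := Complex.volume_preserving_equiv_real_prod.measure_preimage
    (s := {c} ×ˢ Set.univ) (by measurability)
  rw [Measure.volume_eq_prod, Measure.prod_prod, Real.volume_singleton, zero_mul] at h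
  convert h using 2
  ext z
  simp [Complex.measurableEquivRealProd]

lemma fd_ae_eq_fdo : ModularGroup.fd =ᵐ[volume] ModularGroup.fdo := by
  have h0 : volume {z : ℂ | ‖z‖ = 1 ∨ z.re = 1 / 2 ∨ z.re = -(1 / 2)} = 0 := by
    have h1 : {z : ℂ | ‖z‖ = 1 ∨ z.re = 1 / 2 ∨ z.re = -(1 / 2)} =
        Metric.sphere 0 1 ∪ ({z : ℂ | z.re = 1 / 2} ∪ {z : ℂ | z.re = -(1 / 2)}) := by
      ext z; simp
    rw [h1]
    exact measure_union_null (Measure.addHaar_sphere _ _ _)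
      (measure_union_null (volume_re_eq _) (volume_re_eq _))
  have h2 : volume (ModularGroup.fd \ ModularGroup.fdo) = 0 := by
    refine volume_eq_zero_of_coe_image (measure_mono_null ?_ h0)
    rintro _ ⟨τ, ⟨⟨h1, h2⟩, h3⟩, rfl⟩
    simp only [Set.mem_ofPred_eq]
    by_contra hcon
    push Not at hcon
    refine h3 ⟨lt_of_le_of_ne h1 fun h => hcon.1 ?_, lt_of_le_of_ne h2 fun h => ?_⟩
    · rw [Complex.normSq_eq_norm_sq] at h
      nlinarith [norm_nonneg (τ : ℂ)]
    · rcases eq_or_eq_neg_of_abs_eq h with h | h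
      · exact hcon.2.1 h
      · exact hcon.2.2 h
  exact (ae_eq_set.mpr ⟨h2, by
    rw [Set.sdiff_eq_empty.mpr ModularGroup.fdo_subset_fd, measure_empty]⟩)

/-- If γ₀ brings τ into the open domain, then γ₀ and -γ₀ are the only elements that do; they are
distinct and act alike, whence the factor 2. -/
lemma tsum_indicator_modular_smul_fdo {τ : ℍ}
    (hτ : ∃ γ : Γ, γ • τ ∈ ModularGroup.fdo) (c : ENNReal) :
    ∑' γ : Γ, Set.indicator ModularGroup.fdo (fun _ => c) (γ • τ) = 2 * c := by
  classical
  obtain ⟨γ₀, h₀⟩ := hτ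
  have hne : γ₀ ≠ -γ₀ := by
    intro h
    have h1 : ∀ i j, γ₀ i j = 0 := by
      intro i j
      have := congrArg (fun g : Γ => g i j) h
      simp only [Matrix.SpecialLinearGroup.coe_neg, Matrix.neg_apply] at this
      omega
    have := γ₀.det_coe
    rw [Matrix.det_fin_two] at this
    simp [h1] at this
  rw [tsum_eq_sum (s := {γ₀, -γ₀})]
  · rw [Finset.sum_pair hne, ModularGroup.SL_neg_smul, Set.indicator_of_mem h₀, two_mul]
  · intro γ hγ
    refine Set.indicator_of_notMem (fun hmem => hγ ?_) _
    have h1 : (γ * γ₀⁻¹) • (γ₀ • τ) ∈ ModularGroup.fdo := by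
      rwa [smul_smul, inv_mul_cancel_right]
    rcases ModularGroup.eq_one_or_neg_one_of_mem_fdo_mem_fdo h₀ h1 with h | h
    · rw [mul_inv_eq_one] at h
      simp [h]
    · have : γ = -γ₀ := by
        rw [mul_inv_eq_iff_eq_mul] at h
        simpa using h
      simp [this]

instance : Countable Γ :=
  haveI : Countable (Matrix (Fin 2) (Fin 2) ℤ) := inferInstanceAs (Countable (Fin 2 → Fin 2 → ℤ))
  Subtype.countable

/-- The translates of the open fundamental domain cover almost all of `ℍ` exactly twice. -/
lemma tsum_lintegral_fdo_smul {f : ℍ → ENNReal} (hf : Measurable f) :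
    ∑' γ : Γ, ∫⁻ τ in ModularGroup.fdo, f (γ • τ) = 2 * ∫⁻ τ, f τ := by
  have h1 : ∀ γ : Γ, ∫⁻ τ in ModularGroup.fdo, f (γ • τ) =
      ∫⁻ τ, Set.indicator ModularGroup.fdo (fun _ => f τ) (γ⁻¹ • τ) := by
    intro γ
    rw [← lintegral_indicator measurableSet_fdo]
    conv_rhs => rw [← (measurePreserving_modular_smul γ).lintegral_comp_emb
      (measurableEmbedding_modular_smul γ)]
    refine lintegral_congr fun τ => ?_
    rw [inv_smul_smul]
    rfl
  simp_rw [h1]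
  rw [← (Equiv.inv Γ).tsum_eq]
  simp only [Equiv.inv_apply, inv_inv]
  rw [← lintegral_tsum, ← lintegral_const_mul _ hf]
  · refine lintegral_congr_ae ?_
    -- Points with a translate on the boundary of the domain form a null set; every other orbit
    -- meets the open domain.
    have hnull : volume (⋃ γ : Γ, (fun τ : ℍ => γ • τ) ⁻¹'
        (ModularGroup.fd \ ModularGroup.fdo)) = 0 := by
      rw [measure_iUnion_null_iff]
      intro γ
      refine ((measurePreserving_modular_smul γ).quasiMeasurePreserving).preimage_null ?_
      exact (ae_eq_set.mp fd_ae_eq_fdo).1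
    filter_upwards [compl_mem_ae_iff.mpr hnull] with τ hτ
    apply tsum_indicator_modular_smul_fdo
    obtain ⟨γ, hγ⟩ := ModularGroup.exists_smul_mem_fd τ
    refine ⟨γ, by_contra fun h => hτ ?_⟩
    exact Set.mem_iUnion.mpr ⟨γ, hγ, h⟩
  · intro γ
    have : (fun τ : ℍ => Set.indicator ModularGroup.fdo (fun _ => f τ) (γ • τ)) =
        Set.indicator ((fun τ : ℍ => γ • τ) ⁻¹' ModularGroup.fdo) f := by
      rfl
    rw [this]
    exact (hf.indicator (measurable_modular_smul γ measurableSet_fdo)).aemeasurable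

/-- Pairs of coprime integers: the possible bottom rows of elements of `SL(2, ℤ)`. -/
abbrev CoprimePair : Type := {v : Fin 2 → ℤ // IsCoprime (v 0) (v 1)}

/-- An element of the modular group with given bottom row. -/
def CoprimePair.toModular (p : CoprimePair) : Γ :=
  (ModularGroup.bottom_row_surj (R := ℤ) p.2).choose

lemma CoprimePair.toModular_row (p : CoprimePair) : p.toModular 1 = p.1 :=
  (ModularGroup.bottom_row_surj (R := ℤ) p.2).choose_spec.2

lemma T_zpow_mul_row (n : ℤ) (γ : Γ) : (ModularGroup.T ^ n * γ) 1 = γ 1 := by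
  ext j
  rw [ModularGroup.T_pow_mul_apply_one]

lemma exists_eq_T_zpow_mul_of_row_eq {γ γ' : Γ} (h : γ 1 = γ' 1) :
    ∃ n : ℤ, γ = ModularGroup.T ^ n * γ' := by
  have h0 : γ 1 0 = γ' 1 0 := congrFun h 0
  have h1 : γ 1 1 = γ' 1 1 := congrFun h 1
  have hd := γ.det_coe
  have hd' := γ'.det_coe
  rw [Matrix.det_fin_two] at hd hd'
  rw [h0, h1] at hd
  refine ⟨(γ * γ'⁻¹) 0 1, ?_⟩
  rw [← mul_inv_eq_iff_eq_mul]
  ext i j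
  rw [ModularGroup.coe_T_zpow]
  fin_cases i <;> fin_cases j <;>
    simp [Matrix.SpecialLinearGroup.coe_inv, Matrix.adjugate_fin_two, Matrix.mul_apply,
      Fin.sum_univ_two, h0, h1] <;> linarith

/-- The modular group as a product of the translations and the set of bottom rows. -/
def coprimePairProdIntEquiv : CoprimePair × ℤ ≃ Γ :=
  Equiv.ofBijective (fun q => ModularGroup.T ^ q.2 * q.1.toModular) <| by
    constructor
    · rintro ⟨p, n⟩ ⟨p', n'⟩ h
      simp only at h
      have hp : p = p' := by
        apply Subtype.ext
        have := congrArg (fun γ : Γ => γ 1) h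
        simp only [T_zpow_mul_row, CoprimePair.toModular_row] at this
        exact this
      subst hp
      have h2 := mul_right_cancel h
      have h3 := congrArg (fun γ : Γ => γ 0 1) h2
      simp only [ModularGroup.coe_T_zpow] at h3
      simp at h3
      rw [h3]
    · intro γ
      let p : CoprimePair := ⟨γ 1, ModularGroup.bottom_row_coprime γ⟩
      obtain ⟨n, hn⟩ := exists_eq_T_zpow_mul_of_row_eq (γ := γ) (γ' := p.toModular)
        p.toModular_row.symm
      exact ⟨(p, n), hn.symm⟩

lemma tsum_modular_eq_tsum_coprimePair (φ : Γ → ENNReal) :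
    ∑' γ, φ γ = ∑' p : CoprimePair, ∑' n : ℤ, φ (ModularGroup.T ^ n * p.toModular) := by
  rw [← coprimePairProdIntEquiv.tsum_eq, ← ENNReal.tsum_prod]
  rfl

/-- The vertical strip `-1/2 ≤ τ₁ < 1/2`, a fundamental domain for the translations. -/
def verticalStrip : Set ℍ := {τ | τ.re ∈ Set.Ico (-(1 / 2) : ℝ) (1 / 2)}

lemma measurableSet_verticalStrip : MeasurableSet verticalStrip :=
  UpperHalfPlane.measurable_re measurableSet_Ico

lemma tsum_indicator_verticalStrip (τ : ℍ) (c : ENNReal) :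
    ∑' n : ℤ, Set.indicator verticalStrip (fun _ => c) (ModularGroup.T ^ n • τ) = c := by
  have hmem : ∀ n : ℤ, ModularGroup.T ^ n • τ ∈ verticalStrip ↔ n = -⌊τ.re + 1 / 2⌋ := by
    intro n
    rw [verticalStrip, Set.mem_ofPred_eq, ModularGroup.re_T_zpow_smul, Set.mem_Ico,
      eq_neg_iff_add_eq_zero, add_comm n, ← Int.floor_add_intCast, Int.floor_eq_zero_iff,
      Set.mem_Ico]
    constructor <;> rintro ⟨h1, h2⟩ <;> constructor <;> linarith
  rw [tsum_eq_single (-⌊τ.re + 1 / 2⌋)]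
  · rw [Set.indicator_of_mem ((hmem _).mpr rfl)]
  · intro n hn
    exact Set.indicator_of_notMem (fun h => hn ((hmem n).mp h)) _

/-- The imaginary part of `γ • τ` for `γ` with bottom row `v`. -/
def rowIm (v : Fin 2 → ℤ) (τ : ℍ) : ℝ := τ.im / Complex.normSq (v 0 * τ + v 1)

lemma CoprimePair.im_toModular_smul (p : CoprimePair) (τ : ℍ) :
    (p.toModular • τ).im = rowIm p.1 τ := by
  rw [ModularGroup.im_smul_eq_div_normSq, rowIm, ← p.toModular_row]
  simp [UpperHalfPlane.denom]

lemma measurable_rowIm (v : Fin 2 → ℤ) : Measurable (rowIm v) := by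
  unfold rowIm
  refine UpperHalfPlane.measurable_im.div (Complex.continuous_normSq.measurable.comp ?_)
  exact (UpperHalfPlane.measurable_coe.const_mul _).add_const _

/-- The **unfolding** identity for non-negative functions. -/
theorem lintegral_fdo_mul_tsum_rowIm {h : ℍ → ENNReal} (hh : Measurable h)
    (hinv : ∀ (γ : Γ) τ, h (γ • τ) = h τ) {G : ℝ → ENNReal} (hG : Measurable G) :
    ∫⁻ τ in ModularGroup.fdo, h τ * ∑' p : CoprimePair, G (rowIm p.1 τ) =
      2 * ∫⁻ τ in verticalStrip, h τ * G τ.im := by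
  have hf : Measurable fun τ : ℍ => h τ * G τ.im := hh.mul (hG.comp UpperHalfPlane.measurable_im)
  rw [← lintegral_indicator measurableSet_verticalStrip,
    ← tsum_lintegral_fdo_smul (hf.indicator measurableSet_verticalStrip), ← lintegral_tsum]
  · refine lintegral_congr fun τ => ?_
    -- Elements with the same bottom row differ by a translation Tⁿ. Neither h nor the height sees
    -- Tⁿ, and exactly one translate falls in the strip, so each row contributes a single term.
    rw [tsum_modular_eq_tsum_coprimePair, ← ENNReal.tsum_mul_left]
    refine tsum_congr fun p => ?_
    have : ∀ n : ℤ, Set.indicator verticalStrip (fun τ : ℍ => h τ * G τ.im)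
        ((ModularGroup.T ^ n * p.toModular) • τ) = Set.indicator verticalStrip
          (fun _ => h τ * G (rowIm p.1 τ)) (ModularGroup.T ^ n • (p.toModular • τ)) := by
      intro n
      rw [mul_smul]
      by_cases hm : ModularGroup.T ^ n • (p.toModular • τ) ∈ verticalStrip
      · rw [Set.indicator_of_mem hm, Set.indicator_of_mem hm, hinv, hinv,
          ModularGroup.im_T_zpow_smul, p.im_toModular_smul]
      · rw [Set.indicator_of_notMem hm, Set.indicator_of_notMem hm]
    rw [tsum_congr this, tsum_indicator_verticalStrip]
  · intro γ
    exact ((hf.indicator measurableSet_verticalStrip).comp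
      (measurable_modular_smul γ)).aemeasurable

/-- The **unfolding** identity as an identity of measures: an invariant function has the same
distribution with respect to the two weighted measures. -/
lemma map_withDensity_fdo_eq_map_withDensity_strip {E : Type*} [MeasurableSpace E] {h : ℍ → E}
    (hh : Measurable h) (hinv : ∀ (γ : Γ) τ, h (γ • τ) = h τ) {G : ℝ → ENNReal}
    (hG : Measurable G) :
    Measure.map h ((volume.restrict ModularGroup.fdo).withDensity
        fun τ => ∑' p : CoprimePair, G (rowIm p.1 τ)) =
      Measure.map h ((volume.restrict verticalStrip).withDensity fun τ => 2 * G τ.im) := by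
  have hK : Measurable fun τ : ℍ => ∑' p : CoprimePair, G (rowIm p.1 τ) :=
    Measurable.tsum fun p => hG.comp (measurable_rowIm p.1)
  ext s hs
  rw [Measure.map_apply hh hs, Measure.map_apply hh hs, withDensity_apply _ (hh hs),
    withDensity_apply _ (hh hs), ← lintegral_indicator (hh hs), ← lintegral_indicator (hh hs)]
  have key := lintegral_fdo_mul_tsum_rowIm (h := Set.indicator (h ⁻¹' s) 1)
    (measurable_one.indicator (hh hs)) (fun γ τ => by
      have hiff : γ • τ ∈ h ⁻¹' s ↔ τ ∈ h ⁻¹' s := by rw [Set.mem_preimage, hinv]; rfl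
      by_cases hm : τ ∈ h ⁻¹' s
      · rw [Set.indicator_of_mem hm, Set.indicator_of_mem (hiff.mpr hm)]; rfl
      · rw [Set.indicator_of_notMem hm, Set.indicator_of_notMem (hm ∘ hiff.mp)]) hG
  have hm : Measurable fun τ : ℍ => Set.indicator (h ⁻¹' s) 1 τ * G τ.im :=
    (measurable_one.indicator (hh hs)).mul (hG.comp UpperHalfPlane.measurable_im)
  rw [← lintegral_const_mul _ hm] at key
  refine (lintegral_congr fun τ => ?_).trans (key.trans (lintegral_congr fun τ => ?_))
  · by_cases hm : τ ∈ h ⁻¹' s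
    · rw [Set.indicator_of_mem hm, Set.indicator_of_mem hm, Pi.one_apply, one_mul]
    · rw [Set.indicator_of_notMem hm, Set.indicator_of_notMem hm, zero_mul]
  · by_cases hm : τ ∈ h ⁻¹' s
    · rw [Set.indicator_of_mem hm, Set.indicator_of_mem hm, Pi.one_apply, one_mul]
    · rw [Set.indicator_of_notMem hm, Set.indicator_of_notMem hm, zero_mul, mul_zero]

variable {h : ℍ → ℂ} {G : ℝ → ENNReal}

/-- Integrability and the integral of h depend only on the push-forward of the measure under h.
Equality of the two push-forwards therefore carries unfolding from non-negative to complex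
functions, with no splitting into parts and no exchange of sum and integral. -/
lemma integrable_strip_of_integrable_fdo (hh : Measurable h)
    (hinv : ∀ (γ : Γ) τ, h (γ • τ) = h τ) (hG : Measurable G) (hGtop : ∀ y > 0, G y ≠ ⊤)
    (hKtop : ∀ τ : ℍ, ∑' p : CoprimePair, G (rowIm p.1 τ) ≠ ⊤)
    (hint : Integrable (fun τ => (∑' p : CoprimePair, G (rowIm p.1 τ)).toReal • h τ)
      (volume.restrict ModularGroup.fdo)) :
    Integrable (fun τ : ℍ => (2 * G τ.im).toReal • h τ) (volume.restrict verticalStrip) := by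
  have hK : Measurable fun τ : ℍ => ∑' p : CoprimePair, G (rowIm p.1 τ) :=
    Measurable.tsum fun p => hG.comp (measurable_rowIm p.1)
  have hG' : Measurable fun τ : ℍ => 2 * G τ.im :=
    (hG.comp UpperHalfPlane.measurable_im).const_mul _
  rw [← integrable_withDensity_iff_integrable_smul' hG' (ae_of_all _ fun τ =>
    (ENNReal.mul_ne_top ENNReal.ofNat_ne_top (hGtop _ τ.im_pos)).lt_top)]
  rw [← integrable_withDensity_iff_integrable_smul' hK (ae_of_all _ fun τ => (hKtop τ).lt_top)]
    at hint
  have h1 := (integrable_map_measure (f := h) (g := (id : ℂ → ℂ))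
    measurable_id.aestronglyMeasurable hh.aemeasurable).mpr hint
  rw [map_withDensity_fdo_eq_map_withDensity_strip hh hinv hG] at h1
  exact (integrable_map_measure (f := h) (g := (id : ℂ → ℂ))
    measurable_id.aestronglyMeasurable hh.aemeasurable).mp h1

lemma integral_fdo_tsum_rowIm_smul (hh : Measurable h)
    (hinv : ∀ (γ : Γ) τ, h (γ • τ) = h τ) (hG : Measurable G) (hGtop : ∀ y > 0, G y ≠ ⊤)
    (hKtop : ∀ τ : ℍ, ∑' p : CoprimePair, G (rowIm p.1 τ) ≠ ⊤) :
    ∫ τ in ModularGroup.fdo, (∑' p : CoprimePair, G (rowIm p.1 τ)).toReal • h τ =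
      ∫ τ in verticalStrip, (2 * G τ.im).toReal • h τ := by
  have hK : Measurable fun τ : ℍ => ∑' p : CoprimePair, G (rowIm p.1 τ) :=
    Measurable.tsum fun p => hG.comp (measurable_rowIm p.1)
  have hG' : Measurable fun τ : ℍ => 2 * G τ.im :=
    (hG.comp UpperHalfPlane.measurable_im).const_mul _
  rw [← integral_withDensity_eq_integral_toReal_smul hK (ae_of_all _ fun τ => (hKtop τ).lt_top),
    ← integral_withDensity_eq_integral_toReal_smul hG' (ae_of_all _ fun τ =>
    (ENNReal.mul_ne_top ENNReal.ofNat_ne_top (hGtop _ τ.im_pos)).lt_top)]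
  have h1 := fun μ : Measure ℍ => integral_map (μ := μ) (φ := h) (f := (id : ℂ → ℂ))
    hh.aemeasurable measurable_id.aestronglyMeasurable
  simp only [id] at h1
  rw [← h1, ← h1, map_withDensity_fdo_eq_map_withDensity_strip hh hinv hG]

end Unfolding

/-! ### Rectangular coordinates on the upper half-plane -/

/-- The point `x + iy` of the upper half-plane, with junk value `x + i` for `y ≤ 0`. -/
def upperPoint (q : ℝ × ℝ) : ℍ :=
  ⟨⟨q.1, if 0 < q.2 then q.2 else 1⟩, by dsimp only; split_ifs with h <;> simp [h]⟩

@[simp] lemma upperPoint_re (q : ℝ × ℝ) : (upperPoint q).re = q.1 := rfl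

lemma upperPoint_im {q : ℝ × ℝ} (h : 0 < q.2) : (upperPoint q).im = q.2 := by
  change (if 0 < q.2 then q.2 else 1) = q.2
  rw [if_pos h]

lemma coe_upperPoint {q : ℝ × ℝ} (h : 0 < q.2) : (upperPoint q : ℂ) = ⟨q.1, q.2⟩ := by
  apply Complex.ext
  · exact upperPoint_re q
  · exact upperPoint_im h

lemma measurable_upperPoint : Measurable upperPoint := by
  rw [measurable_comap_iff]
  have h : UpperHalfPlane.coe ∘ upperPoint = fun q : ℝ × ℝ =>
      Complex.equivRealProd.symm (q.1, if 0 < q.2 then q.2 else 1) := by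
    ext q; rfl
  rw [h]
  refine Complex.measurableEquivRealProd.symm.measurable.comp ?_
  exact measurable_fst.prodMk (Measurable.ite (measurable_snd measurableSet_Ioi)
    measurable_snd measurable_const)

/-- The measure `dy / y²` on the positive half-line. -/
def heightMeasure : Measure ℝ :=
  (volume.restrict (Set.Ioi 0)).withDensity fun y => ENNReal.ofReal (y ^ (-2 : ℝ))

lemma measurable_heightDensity : Measurable fun y : ℝ => ENNReal.ofReal (y ^ (-2 : ℝ)) := by
  fun_prop

instance : SFinite heightMeasure := by unfold heightMeasure; infer_instance

/-- This exhibits the hyperbolic measure as the product of dx and dy/y², the form in which Tonelli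
and Fubini apply on the strip. -/
lemma map_upperPoint_prod : Measure.map upperPoint (volume.prod heightMeasure) = volume := by
  ext s hs
  rw [Measure.map_apply measurable_upperPoint hs, UpperHalfPlane.volume_eq_lintegral,
    heightMeasure, prod_withDensity_right measurable_heightDensity,
    withDensity_apply _ (measurable_upperPoint hs)]
  have h1 : (volume : Measure ℝ).prod (volume.restrict (Set.Ioi (0 : ℝ))) =
      (volume : Measure (ℝ × ℝ)).restrict (Set.univ ×ˢ Set.Ioi 0) := by
    rw [Measure.volume_eq_prod, ← Measure.prod_restrict, Measure.restrict_univ]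
  rw [h1, Measure.restrict_restrict (measurable_upperPoint hs)]
  have hpre : Complex.measurableEquivRealProd ⁻¹'
      (upperPoint ⁻¹' s ∩ Set.univ ×ˢ Set.Ioi 0) = (↑) '' s := by
    ext z
    simp only [Set.mem_preimage, Set.mem_inter_iff, Set.mem_prod, Set.mem_univ, true_and,
      Set.mem_Ioi, Set.mem_image]
    constructor
    · rintro ⟨hz, hpos⟩
      exact ⟨_, hz, coe_upperPoint hpos⟩
    · rintro ⟨τ, hτ, rfl⟩
      have hpos : 0 < (Complex.measurableEquivRealProd (τ : ℂ)).2 := τ.im_pos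
      refine ⟨?_, hpos⟩
      convert hτ
      apply UpperHalfPlane.ext
      rw [coe_upperPoint hpos]
      rfl
  rw [← hpre, ← Complex.volume_preserving_equiv_real_prod.setLIntegral_comp_preimage_emb
    Complex.measurableEquivRealProd.measurableEmbedding]
  refine setLIntegral_congr_fun (Complex.measurableEquivRealProd.measurable
    ((measurable_upperPoint hs).inter (MeasurableSet.univ.prod measurableSet_Ioi))) fun z hz => ?_
  have hz : 0 < z.im := hz.2.2
  change ENNReal.ofReal (z.im ^ (-2 : ℝ)) = _
  rw [ENNReal.ofReal]
  congr 1
  ext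
  rw [Real.coe_toNNReal _ (by positivity), Real.rpow_neg hz.le]
  simp

lemma restrict_verticalStrip : (volume : Measure ℍ).restrict verticalStrip =
    Measure.map upperPoint
      ((volume.restrict (Set.Ico (-(1 / 2) : ℝ) (1 / 2))).prod heightMeasure) := by
  rw [← map_upperPoint_prod, Measure.restrict_map measurable_upperPoint measurableSet_verticalStrip]
  congr 1
  conv_rhs => rw [← Measure.restrict_univ (μ := heightMeasure)]
  rw [Measure.prod_restrict]
  congr 1
  ext q
  simp [verticalStrip]

lemma lintegral_verticalStrip {f : ℍ → ENNReal} (hf : Measurable f) :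
    ∫⁻ τ in verticalStrip, f τ = ∫⁻ y in Set.Ioi (0 : ℝ), ENNReal.ofReal (y ^ (-2 : ℝ)) *
      ∫⁻ x in Set.Ico (-(1 / 2) : ℝ) (1 / 2), f (upperPoint (x, y)) := by
  have hm : Measurable fun q => f (upperPoint q) := hf.comp measurable_upperPoint
  rw [restrict_verticalStrip, lintegral_map hf measurable_upperPoint,
    lintegral_prod_symm' _ hm, heightMeasure,
    lintegral_withDensity_eq_lintegral_mul _ measurable_heightDensity hm.lintegral_prod_left']
  rfl

lemma integral_verticalStrip {f : ℍ → ℂ} (hf : IntegrableOn f verticalStrip) :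
    ∫ τ in verticalStrip, f τ = ∫ y in Set.Ioi (0 : ℝ), ((y ^ (-2 : ℝ) : ℝ) : ℂ) *
      ∫ x in Set.Ico (-(1 / 2) : ℝ) (1 / 2), f (upperPoint (x, y)) := by
  rw [IntegrableOn, restrict_verticalStrip] at hf
  rw [restrict_verticalStrip, integral_map measurable_upperPoint.aemeasurable hf.1,
    integral_prod_symm (fun q => f (upperPoint q)) (hf.comp_measurable measurable_upperPoint),
    heightMeasure,
    integral_withDensity_eq_integral_toReal_smul measurable_heightDensity
      (ae_of_all _ fun _ => ENNReal.ofReal_lt_top)]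
  refine setIntegral_congr_fun measurableSet_Ioi fun y hy => ?_
  have : 0 ≤ y ^ (-2 : ℝ) := Real.rpow_nonneg (le_of_lt hy) _
  simp only [ENNReal.toReal_ofReal this, Complex.real_smul]

lemma fdo_subset_verticalStrip : ModularGroup.fdo ⊆ verticalStrip := by
  intro τ hτ
  have := abs_lt.mp hτ.2
  exact ⟨this.1.le, this.2⟩

lemma one_half_lt_im_of_mem_fdo {τ : ℍ} (hτ : τ ∈ ModularGroup.fdo) : 1 / 2 < τ.im := by
  have := ModularGroup.three_lt_four_mul_im_sq_of_mem_fdo hτ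
  nlinarith [τ.im_pos]

/-! ### The lattice partition function on the strip -/

namespace NarainModuli

variable {d : ℕ} (M : NarainModuli d)

lemma measurable_latticePartition : Measurable M.latticePartition := by
  unfold latticePartition
  refine Measurable.mul ?_ (Measurable.tsum fun p => ?_)
  · exact Complex.measurable_ofReal.comp (UpperHalfPlane.measurable_im.pow_const _)
  · have h1 := Complex.measurable_ofReal.comp UpperHalfPlane.measurable_im
    have h2 := Complex.measurable_ofReal.comp UpperHalfPlane.measurable_re
    simp only [Function.comp_def] at h1 h2
    exact Complex.measurable_exp.comp
      (((h1.const_mul _).mul_const _).sub ((h2.const_mul _).mul_const _))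

/-- The zero charge contributes exactly 1 to the lattice sum; the phases of the other terms are
dropped. -/
lemma norm_latticePartition_sub_le (τ : ℍ) :
    ‖M.latticePartition τ - ((τ.im ^ ((d : ℝ) / 2) : ℝ) : ℂ)‖ ≤
      τ.im ^ ((d : ℝ) / 2) * M.nonzeroSum τ.im := by
  have hs := M.summable_latticeTerm τ.re τ.im_pos
  have h := hs.tsum_subtype_add_tsum_subtype_compl {0}
  have hy := τ.im_pos
  unfold latticePartition
  rw [← h]
  have h0 : ∑' p : ({0} : Set (NarainCharge d)), Complex.exp (-(Real.pi : ℂ) * (τ.im : ℂ) *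
      (M.massSq p : ℂ) - 2 * (Real.pi : ℂ) * Complex.I * (τ.re : ℂ) *
        ((p : NarainCharge d).pairing : ℂ)) = 1 := by
    simp [NarainCharge.pairing]
  rw [h0, mul_add, mul_one, add_sub_cancel_left, norm_mul, Complex.norm_real,
    Real.norm_of_nonneg (by positivity)]
  gcongr
  refine tsum_of_norm_bounded (((M.summable_exp_massSq hy).subtype _).hasSum) fun p => ?_
  exact (M.norm_exp_massSq_pairing _ _ _).le

/-- The contribution of the half-BPS charges to the lattice sum. -/
def halfBPSSum (y : ℝ) : ℝ := ∑' p : HalfBPSCharge d, Real.exp (-Real.pi * y * M.massSq p.1)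

lemma summable_halfBPS {y : ℝ} (hy : 0 < y) :
    Summable fun p : HalfBPSCharge d => Real.exp (-Real.pi * y * M.massSq p.1) :=
  (M.summable_exp_massSq hy).subtype _

lemma halfBPSSum_nonneg (y : ℝ) : 0 ≤ M.halfBPSSum y := tsum_nonneg fun _ => (Real.exp_pos _).le

lemma halfBPSSum_le_nonzeroSum {y : ℝ} (hy : 0 < y) : M.halfBPSSum y ≤ M.nonzeroSum y := by
  let i : HalfBPSCharge d → {p : NarainCharge d // p ≠ 0} := fun p => ⟨p.1, p.2.1⟩
  refine (M.summable_halfBPS hy).tsum_le_tsum_of_inj i (fun a b h => Subtype.ext ?_)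
    (fun _ _ => (Real.exp_pos _).le) (fun _ => le_rfl) ((M.summable_exp_massSq hy).subtype _)
  simpa [i] using h

lemma measurable_halfBPSSum : Measurable M.halfBPSSum :=
  Measurable.tsum fun p => by fun_prop

lemma integral_exp_two_pi_Ico (k : ℤ) :
    ∫ x in Set.Ico (-(1 / 2) : ℝ) (1 / 2),
      Complex.exp (-(2 * (Real.pi : ℂ) * Complex.I * (x : ℂ) * (k : ℂ))) = if k = 0 then 1 else 0 := by
  split_ifs with hk
  · simp [hk]; norm_num
  · rw [integral_Ico_eq_integral_Ioc, ← intervalIntegral.integral_of_le (by norm_num)]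
    have hc : (-(2 * (Real.pi : ℂ) * Complex.I * (k : ℂ))) ≠ 0 := by
      simp [hk, Real.pi_ne_zero]
    have := integral_exp_mul_complex (a := -(1 / 2)) (b := 1 / 2) hc
    rw [show (∫ x in (-(1 / 2) : ℝ)..(1 / 2), Complex.exp (-(2 * (Real.pi : ℂ) * Complex.I *
      (x : ℂ) * (k : ℂ)))) = ∫ x in (-(1 / 2) : ℝ)..(1 / 2),
        Complex.exp (-(2 * (Real.pi : ℂ) * Complex.I * (k : ℂ)) * x) by
      congr 1; ext x; ring_nf, this]
    have h2 : Complex.exp (-(2 * (Real.pi : ℂ) * Complex.I * (k : ℂ)) * ((1 / 2 : ℝ) : ℂ)) =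
        Complex.exp (-(2 * (Real.pi : ℂ) * Complex.I * (k : ℂ)) * ((-(1 / 2) : ℝ) : ℂ)) := by
      rw [Complex.exp_eq_exp_iff_exists_int]
      refine ⟨-k, ?_⟩
      push_cast
      ring
    rw [h2, sub_self, zero_div]

/-- The zeroth Fourier coefficient of the partition function. -/
lemma integral_latticePartition_upperPoint {y : ℝ} (hy : 0 < y) :
    ∫ x in Set.Ico (-(1 / 2) : ℝ) (1 / 2), M.latticePartition (upperPoint (x, y)) =
      ((y ^ ((d : ℝ) / 2) * (1 + M.halfBPSSum y) : ℝ) : ℂ) := by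
  unfold latticePartition
  simp only [upperPoint_re, upperPoint_im (q := (_, y)) hy]
  rw [integral_const_mul, Complex.ofReal_mul]
  congr 1
  set F : NarainCharge d → ℝ → ℂ := fun p x => Complex.exp (-(Real.pi : ℂ) * (y : ℂ) *
    (M.massSq p : ℂ) - 2 * (Real.pi : ℂ) * Complex.I * (x : ℂ) * (p.pairing : ℂ)) with hF
  have hFn : ∀ p x, ‖F p x‖ = Real.exp (-Real.pi * y * M.massSq p) :=
    fun p x => M.norm_exp_massSq_pairing x y p
  -- Orthogonality of characters: averaging over τ₁ keeps only the charges with m·n = 0. The zero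
  -- charge among them will become the summand 1.
  have hFi : ∀ p, ∫ x in Set.Ico (-(1 / 2) : ℝ) (1 / 2), F p x =
      Set.indicator {p | p.pairing = 0}
        (fun p => ((Real.exp (-Real.pi * y * M.massSq p) : ℝ) : ℂ)) p := by
    intro p
    have : ∀ x, F p x = Complex.exp (-(Real.pi : ℂ) * (y : ℂ) * (M.massSq p : ℂ)) *
        Complex.exp (-(2 * (Real.pi : ℂ) * Complex.I * (x : ℂ) * (p.pairing : ℂ))) := by
      intro x
      rw [← Complex.exp_add, ← sub_eq_add_neg]
    simp only [this]
    rw [integral_const_mul, integral_exp_two_pi_Ico]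
    by_cases h : p.pairing = 0 <;> simp [h]
  have key := hasSum_integral_of_summable_integral_norm (F := F)
    (μ := volume.restrict (Set.Ico (-(1 / 2) : ℝ) (1 / 2))) (fun p => ?_) ?_
  · rw [← key.tsum_eq, tsum_congr hFi, ← tsum_subtype, ← Complex.ofReal_tsum]
    congr 1
    have hs : Summable fun p : {p : NarainCharge d | p.pairing = 0} =>
      Real.exp (-Real.pi * y * M.massSq p) := (M.summable_exp_massSq hy).subtype _
    have h0 : (0 : NarainCharge d).pairing = 0 := by simp [NarainCharge.pairing]
    rw [hs.tsum_eq_add_tsum_ite ⟨0, h0⟩]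
    congr 1
    · simp
    · rw [halfBPSSum]
      let i : HalfBPSCharge d → {p : NarainCharge d | p.pairing = 0} := fun p => ⟨p.1, p.2.2⟩
      have hi : Function.Injective i := fun a b h => Subtype.ext (by simpa [i] using h)
      have hne : ∀ p : HalfBPSCharge d, i p ≠ ⟨0, h0⟩ := fun p h =>
        p.2.1 (congrArg Subtype.val h)
      rw [← hi.tsum_eq]
      · exact tsum_congr fun p => by rw [if_neg (hne p)]
      · intro p hp
        have hp0 : p ≠ ⟨0, h0⟩ := by
          rintro rfl
          simp at hp
        exact ⟨⟨p.1, fun h => hp0 (Subtype.ext h), p.2⟩, rfl⟩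
  · refine Measure.integrableOn_of_bounded (by simp) (Continuous.aestronglyMeasurable (by
      simp only [hF]; fun_prop)) (M := Real.exp (-Real.pi * y * M.massSq p)) (ae_of_all _ fun x => ?_)
    exact (hFn p x).le
  · simp only [hFn]
    simp only [integral_const]
    exact (M.summable_exp_massSq hy).mul_left _

end NarainModuli

/-! ### The theta series of the two-dimensional lattice `ℤτ + ℤ` -/

/-- The moduli of a circle of squared radius `t`. -/
def circleModuli (t : ℝ) (ht : 0 < t) : NarainModuli 1 where
  g := t • 1
  B := 0
  g_posDef := Matrix.PosDef.one.smul ht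
  B_antisymm := by simp

/-- The theta series `∑_{m,n} exp(-π t |m τ + n|² / τ₂)`. -/
def torusTheta (t : ℝ) (τ : ℍ) : ℝ :=
  ∑' v : Fin 2 → ℤ, Real.exp (-Real.pi * t * (Complex.normSq (v 0 * τ + v 1) / τ.im))

/-- Charges of the circle as pairs of integers, winding first. -/
def circleChargeEquiv : NarainCharge 1 ≃ (Fin 2 → ℤ) where
  toFun p := ![p.2 0, p.1 0]
  invFun v := (fun _ => v 1, fun _ => v 0)
  left_inv p := by
    refine Prod.ext (funext fun i => ?_) (funext fun i => ?_) <;>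
      simp [Subsingleton.elim i 0]
  right_inv v := by
    funext i
    fin_cases i <;> rfl

lemma lagrangianTerm_circleModuli {t : ℝ} (ht : 0 < t) (τ : ℍ) (p : NarainCharge 1) :
    (circleModuli t ht).lagrangianTerm τ p = ((Real.exp (-Real.pi * t *
      (Complex.normSq (circleChargeEquiv p 0 * τ + circleChargeEquiv p 1) / τ.im)) : ℝ) : ℂ) := by
  have hy := τ.im_pos
  have h1 : Complex.normSq ((p.2 0 : ℂ) * τ + p.1 0) =
      (p.2 0 * τ.re + p.1 0) ^ 2 + (p.2 0 * τ.im) ^ 2 := by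
    rw [Complex.normSq_apply]
    simp [sq]
  rw [NarainModuli.lagrangianTerm, Complex.ofReal_exp]
  congr 1
  simp only [NarainModuli.lagrangianForm, circleModuli, circleChargeEquiv,
    Equiv.coe_fn_mk, Matrix.cons_val_zero, Matrix.cons_val_one, h1,
    Matrix.zero_mulVec, dotProduct_zero, Matrix.smul_mulVec, Matrix.one_mulVec]
  norm_cast
  simp [dotProduct, NarainCharge.mom, NarainCharge.wind]
  field_simp
  ring

lemma summable_torusTheta {t : ℝ} (ht : 0 < t) (τ : ℍ) : Summable fun v : Fin 2 → ℤ =>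
    Real.exp (-Real.pi * t * (Complex.normSq (v 0 * τ + v 1) / τ.im)) := by
  have h := ((circleModuli t ht).summable_lagrangianTerm τ).congr
    (lagrangianTerm_circleModuli ht τ)
  rw [Complex.summable_ofReal] at h
  exact circleChargeEquiv.summable_iff.mp h

/-- The theta series is the resummed partition function of a circle, so its functional equation and
its growth at the cusp are the case d = 1 of results already proved. -/
lemma latticePartition_circleModuli {t : ℝ} (ht : 0 < t) (τ : ℍ) :
    (circleModuli t ht).latticePartition τ = ((√t * torusTheta t τ : ℝ) : ℂ) := by
  have hd : (circleModuli t ht).g.det = t := by simp [circleModuli]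
  rw [NarainModuli.latticePartition_eq_tsum_lagrangianTerm, hd,
    tsum_congr (lagrangianTerm_circleModuli ht τ), ← Complex.ofReal_tsum, ← Complex.ofReal_mul,
    torusTheta, ← circleChargeEquiv.tsum_eq]

/-- T-duality of the circle. -/
lemma latticePartition_circleModuli_inv {t : ℝ} (ht : 0 < t) (τ : ℍ) :
    (circleModuli t⁻¹ (inv_pos.mpr ht)).latticePartition τ =
      (circleModuli t ht).latticePartition τ := by
  unfold NarainModuli.latticePartition
  congr 1
  rw [← (Equiv.prodComm (Fin 1 → ℤ) (Fin 1 → ℤ)).tsum_eq]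
  refine tsum_congr fun p => ?_
  have h1 : (circleModuli t⁻¹ (inv_pos.mpr ht)).massSq (Equiv.prodComm _ _ p) =
      (circleModuli t ht).massSq p := by
    simp [NarainModuli.massSq, NarainModuli.dressedMom, circleModuli, dotProduct,
      NarainCharge.mom, NarainCharge.wind, Matrix.inv_subsingleton, Matrix.mulVec]
    field_simp
    ring
  have h2 : NarainCharge.pairing (Equiv.prodComm (Fin 1 → ℤ) (Fin 1 → ℤ) p) =
      NarainCharge.pairing p := by
    simp [NarainCharge.pairing, mul_comm]
  rw [h1, h2]

/-- Exchanging momentum and winding inverts t; the factor t is the quotient of the prefactors √t and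
1/√t. The functional equation of the vector Eisenstein series originates here. -/
lemma torusTheta_inv {t : ℝ} (ht : 0 < t) (τ : ℍ) : torusTheta t⁻¹ τ = t * torusTheta t τ := by
  have h := latticePartition_circleModuli_inv ht τ
  rw [latticePartition_circleModuli, latticePartition_circleModuli, Complex.ofReal_inj,
    Real.sqrt_inv] at h
  have hs : 0 < √t := Real.sqrt_pos.mpr ht
  have h2 : √t * √t = t := Real.mul_self_sqrt ht.le
  calc torusTheta t⁻¹ τ = √t * ((√t)⁻¹ * torusTheta t⁻¹ τ) := by field_simp
    _ = t * torusTheta t τ := by rw [h, ← mul_assoc, h2]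

lemma torusTheta_nonneg (t : ℝ) (τ : ℍ) : 0 ≤ torusTheta t τ :=
  tsum_nonneg fun _ => (Real.exp_pos _).le

lemma measurable_torusTheta (t : ℝ) : Measurable (torusTheta t) := by
  refine Measurable.tsum fun v => ?_
  refine Real.measurable_exp.comp (Measurable.const_mul ?_ _)
  refine Measurable.div (Complex.continuous_normSq.measurable.comp ?_) UpperHalfPlane.measurable_im
  exact (UpperHalfPlane.measurable_coe.const_mul _).add_const _

namespace NarainModuli

lemma exists_nonzeroSum_le_const {d : ℕ} (M : NarainModuli d) :
    ∃ C > 0, ∀ y : ℝ, 1 / 2 ≤ y → M.nonzeroSum y ≤ C := by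
  obtain ⟨C, hC, h⟩ := M.exists_nonzeroSum_le (σ := (d : ℝ) + 1) (by linarith)
  refine ⟨C * (1 / 2) ^ (-((d : ℝ) + 1)), by positivity, fun y hy => ?_⟩
  have hy0 : 0 < y := by linarith
  have hd : -((d : ℝ) + 1) ≤ 0 := by linarith [Nat.cast_nonneg (α := ℝ) d]
  exact (h y hy0).trans (mul_le_mul_of_nonneg_left
    (Real.rpow_le_rpow_of_nonpos (by norm_num) hy hd) hC.le)

end NarainModuli

/-- The zero charge of the circle gives the main term y^{1/2}/√t, and the remaining charges are
bounded relative to it for y ≥ 1/2. -/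
lemma exists_torusTheta_le {t : ℝ} (ht : 0 < t) :
    ∃ C > 0, ∀ τ : ℍ, 1 / 2 ≤ τ.im → torusTheta t τ ≤ C * τ.im ^ (1 / 2 : ℝ) := by
  obtain ⟨C, hC, h⟩ := (circleModuli t ht).exists_nonzeroSum_le_const
  have hs : 0 < √t := Real.sqrt_pos.mpr ht
  refine ⟨(1 + C) / √t, by positivity, fun τ hτ => ?_⟩
  have h1 := (circleModuli t ht).norm_latticePartition_sub_le τ
  rw [latticePartition_circleModuli, ← Complex.ofReal_sub, Complex.norm_real, Nat.cast_one] at h1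
  have h2 := (le_abs_self _).trans h1
  have hy := Real.rpow_pos_of_pos τ.im_pos (1 / 2 : ℝ)
  have h3 := mul_le_mul_of_nonneg_left (h _ hτ) hy.le
  rw [div_mul_eq_mul_div, le_div_iff₀ hs]
  linarith

/-! ### Sums over primitive vectors -/

/-- Every nonzero integer vector is uniquely a positive multiple of a primitive one. -/
def coprimePairProdNatEquiv : CoprimePair × ℕ ≃ {v : Fin 2 → ℤ // v ≠ 0} :=
  -- The natural number k encodes the multiple k + 1, which is recovered as the gcd of the two
  -- entries.
  Equiv.ofBijective (fun q => ⟨fun i => (q.2 + 1 : ℤ) * q.1.1 i, fun h => by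
    have h0 : (q.2 + 1 : ℤ) ≠ 0 := by omega
    have h1 : ∀ i, q.1.1 i = 0 := fun i => by
      have := congrFun h i
      simpa [h0] using this
    have := q.1.2
    rw [h1, h1] at this
    exact not_isCoprime_zero_zero this⟩) <| by
  constructor
  · rintro ⟨p, k⟩ ⟨p', k'⟩ h
    rw [Subtype.mk.injEq, funext_iff] at h
    simp only at h
    have hg : ∀ (p : CoprimePair) (k : ℕ),
        Int.gcd ((k + 1 : ℤ) * p.1 0) ((k + 1 : ℤ) * p.1 1) = k + 1 := by
      intro p k
      rw [Int.gcd_mul_left, Int.isCoprime_iff_gcd_eq_one.mp p.2]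
      omega
    have hk : k = k' := by
      have h1 := hg p k
      rw [h 0, h 1, hg p' k'] at h1
      omega
    subst hk
    have h0 : (k + 1 : ℤ) ≠ 0 := by omega
    have : p = p' := Subtype.ext (funext fun i => mul_left_cancel₀ h0 (h i))
    rw [this]
  · rintro ⟨v, hv⟩
    have hpos : 0 < Int.gcd (v 0) (v 1) := by
      rw [Nat.pos_iff_ne_zero, Ne, Int.gcd_eq_zero_iff]
      rintro ⟨h0, h1⟩
      exact hv (funext fun i => by fin_cases i <;> assumption)
    obtain ⟨a, b, hab, ha, hb⟩ := Int.exists_gcd_one hpos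
    refine ⟨(⟨![a, b], by simpa [Int.isCoprime_iff_gcd_eq_one] using hab⟩,
      Int.gcd (v 0) (v 1) - 1), ?_⟩
    apply Subtype.ext
    have hc : ((Int.gcd (v 0) (v 1) - 1 : ℕ) : ℤ) + 1 = Int.gcd (v 0) (v 1) := by omega
    funext i
    simp only [hc]
    fin_cases i
    · simpa [mul_comm] using ha.symm
    · simpa [mul_comm] using hb.symm

/-- The one-sided theta series `∑_{k ≥ 1} exp(-π k² x)`. -/
def halfTheta (x : ℝ) : ℝ := ∑' k : ℕ, Real.exp (-Real.pi * (k + 1) ^ 2 * x)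

lemma summable_halfTheta {x : ℝ} (hx : 0 < x) :
    Summable fun k : ℕ => Real.exp (-Real.pi * (k + 1) ^ 2 * x) := by
  have h0 : Real.exp (-Real.pi * x) < 1 := by
    rw [Real.exp_lt_one_iff]
    nlinarith [mul_pos Real.pi_pos hx]
  refine (summable_geometric_of_lt_one (Real.exp_pos _).le h0).of_nonneg_of_le
    (fun k => (Real.exp_pos _).le) fun k => ?_
  rw [← Real.exp_nat_mul, Real.exp_le_exp]
  have h1 : (k : ℝ) ≤ ((k : ℝ) + 1) ^ 2 := by nlinarith [Nat.cast_nonneg (α := ℝ) k]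
  have h2 := mul_pos Real.pi_pos hx
  nlinarith

lemma halfTheta_nonneg (x : ℝ) : 0 ≤ halfTheta x := tsum_nonneg fun _ => (Real.exp_pos _).le

lemma measurable_halfTheta : Measurable halfTheta := Measurable.tsum fun k => by fun_prop

/-- Bounding each exponential by a power leaves ∑ (k+1)^{-2r}, which converges for r > 1/2. -/
lemma exists_halfTheta_le {r : ℝ} (hr : 1 / 2 < r) :
    ∃ C > 0, ∀ x > 0, halfTheta x ≤ C * x ^ (-r) := by
  obtain ⟨C, hC, h⟩ := Real.exists_exp_neg_le_rpow (σ := r) (by linarith)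
  have hs : Summable fun k : ℕ => ((k : ℝ) + 1) ^ (-(2 * r)) := by
    have := (Real.summable_nat_rpow (p := -(2 * r))).mpr (by linarith)
    simpa using (summable_nat_add_iff 1).mpr this
  have h0 : 0 ≤ ∑' k : ℕ, ((k : ℝ) + 1) ^ (-(2 * r)) :=
    tsum_nonneg fun k => by positivity
  have hπ := Real.pi_pos
  refine ⟨C * Real.pi ^ (-r) * (∑' k : ℕ, ((k : ℝ) + 1) ^ (-(2 * r)) + 1), by positivity,
    fun x hx => ?_⟩
  have hle : halfTheta x ≤ ∑' k : ℕ, C * Real.pi ^ (-r) * x ^ (-r) * ((k : ℝ) + 1) ^ (-(2 * r)) := by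
    refine (summable_halfTheta hx).tsum_le_tsum (fun k => ?_) (hs.mul_left _)
    have h1 := h (Real.pi * (k + 1) ^ 2 * x) (by positivity)
    rw [Real.mul_rpow (by positivity) hx.le, Real.mul_rpow hπ.le (by positivity),
      ← Real.rpow_natCast_mul (by positivity)] at h1
    rw [show -(2 * r) = ((2 : ℕ) : ℝ) * -r by push_cast; ring]
    simp only [neg_mul]
    linarith
  rw [tsum_mul_left] at hle
  have h2 : 0 < C * Real.pi ^ (-r) * x ^ (-r) := by positivity
  nlinarith

lemma rowIm_pos (p : CoprimePair) (τ : ℍ) : 0 < rowIm p.1 τ := by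
  rw [← p.im_toModular_smul]
  exact (p.toModular • τ).im_pos

/-- The unfolding kernel of the theta series. -/
lemma tsum_halfTheta_rowIm {t : ℝ} (ht : 0 < t) (τ : ℍ) :
    ∑' p : CoprimePair, ENNReal.ofReal (halfTheta (t / rowIm p.1 τ)) =
      ENNReal.ofReal (torusTheta t τ - 1) := by
  have hs := summable_torusTheta ht τ
  have hs' : Summable fun v : {v : Fin 2 → ℤ // v ≠ 0} =>
    Real.exp (-Real.pi * t * (Complex.normSq (v.1 0 * τ + v.1 1) / τ.im)) := hs.subtype _
  have h1 : torusTheta t τ - 1 = ∑' v : {v : Fin 2 → ℤ // v ≠ 0},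
      Real.exp (-Real.pi * t * (Complex.normSq (v.1 0 * τ + v.1 1) / τ.im)) := by
    rw [torusTheta, ← hs.tsum_subtype_add_tsum_subtype_compl {0}]
    simp
    rfl
  rw [h1, ENNReal.ofReal_tsum_of_nonneg (fun _ => (Real.exp_pos _).le) hs',
    ← coprimePairProdNatEquiv.tsum_eq, ENNReal.tsum_prod']
  refine tsum_congr fun p => ?_
  have hr := rowIm_pos p τ
  rw [halfTheta, ENNReal.ofReal_tsum_of_nonneg (fun _ => (Real.exp_pos _).le)
    (summable_halfTheta (by positivity))]
  refine tsum_congr fun k => ?_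
  congr 2
  -- For the (k+1)-fold multiple of a coprime row, the exponent t|mτ+n|²/τ₂ becomes (k+1)²t divided
  -- by the height `rowIm`.
  have h2 : (((coprimePairProdNatEquiv (p, k)).1 0 : ℤ) : ℂ) * τ +
      ((coprimePairProdNatEquiv (p, k)).1 1 : ℤ) = ((k + 1 : ℝ) : ℂ) * (p.1 0 * τ + p.1 1) := by
    have h3 : ∀ i, (coprimePairProdNatEquiv (p, k)).1 i = (k + 1 : ℤ) * p.1 i := fun _ => rfl
    rw [h3, h3]
    push_cast
    ring
  rw [h2, Complex.normSq_mul, Complex.normSq_ofReal, rowIm]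
  have hy := τ.im_pos
  have hn : 0 < Complex.normSq (p.1 0 * τ + p.1 1) := by
    rw [rowIm] at hr
    exact (div_pos_iff_of_pos_left hy).mp hr
  field_simp

lemma one_le_torusTheta {t : ℝ} (ht : 0 < t) (τ : ℍ) : 1 ≤ torusTheta t τ := by
  have h := (summable_torusTheta ht τ).le_tsum 0 fun _ _ => (Real.exp_pos _).le
  simpa [torusTheta] using h

/-! ### The real-analytic Eisenstein series -/

/-! ### Integrals of sums over arithmetic progressions -/

section Affine

lemma lintegral_comp_mul_add {φ : ℝ → ENNReal} (hφ : Measurable φ) {a : ℝ} (ha : a ≠ 0) (b : ℝ) :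
    ∫⁻ x, φ (a * x + b) = ENNReal.ofReal |a⁻¹| * ∫⁻ x, φ x := by
  have h1 : ∫⁻ x, φ (a * x + b) = ∫⁻ x, φ (x + b) ∂(Measure.map (a * ·) volume) :=
    (lintegral_map (hφ.comp (measurable_add_const b)) (measurable_const_mul a)).symm
  rw [h1, Real.map_volume_mul_left ha, lintegral_smul_measure, lintegral_add_right_eq_self]
  rfl

lemma tsum_lintegral_Ico_add_intCast {φ : ℝ → ENNReal} :
    ∑' q : ℤ, ∫⁻ x in Set.Ico (-(1 / 2) : ℝ) (1 / 2), φ (x + q) = ∫⁻ x, φ x := by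
  have h1 : ∀ q : ℤ, ∫⁻ x in Set.Ico (-(1 / 2) : ℝ) (1 / 2), φ (x + q) =
      ∫⁻ x in Set.Ico (-(1 / 2) + (q : ℝ)) (-(1 / 2) + q + 1), φ x := by
    intro q
    have hmp : MeasurePreserving (fun x : ℝ => x + q) volume volume :=
      measurePreserving_add_right volume (q : ℝ)
    have hpre : (fun x : ℝ => x + q) ⁻¹' Set.Ico (-(1 / 2) + (q : ℝ)) (-(1 / 2) + q + 1) =
        Set.Ico (-(1 / 2) : ℝ) (1 / 2) := by
      ext x
      simp only [Set.mem_preimage, Set.mem_Ico]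
      constructor <;> rintro ⟨h1, h2⟩ <;> constructor <;> linarith
    rw [← hpre]
    exact hmp.setLIntegral_comp_preimage_emb
      (MeasurableEquiv.addRight (q : ℝ)).measurableEmbedding φ _
  rw [tsum_congr h1, ← lintegral_iUnion (fun _ => measurableSet_Ico)
    (Set.pairwise_disjoint_Ico_add_intCast _), iUnion_Ico_add_intCast, setLIntegral_univ]

lemma tsum_int_eq_sum_fin_tsum {c : ℕ} [NeZero c] (F : ℤ → ENNReal) :
    ∑' e, F e = ∑ r : Fin c, ∑' q : ℤ, F (r + c * q) := by
  rw [← (Int.divModEquiv c).symm.tsum_eq, ENNReal.tsum_prod', ENNReal.tsum_comm, tsum_fintype]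
  refine Finset.sum_congr rfl fun r _ => tsum_congr fun q => ?_
  rw [Int.divModEquiv_symm_apply]
  congr 1
  ring

/-- Integrating a sum over a shifted arithmetic progression over a period gives an integral over
the line. -/
lemma tsum_lintegral_Ico_mul_add {φ : ℝ → ENNReal} (hφ : Measurable φ) {c : ℤ} (hc : c ≠ 0)
    (r : ℝ) :
    ∑' q : ℤ, ∫⁻ x in Set.Ico (-(1 / 2) : ℝ) (1 / 2), φ (c * x + (r + c.natAbs * q)) =
      ENNReal.ofReal |(c : ℝ)⁻¹| * ∫⁻ x, φ x := by
  have hc' : (c : ℝ) ≠ 0 := by exact_mod_cast hc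
  rw [← lintegral_comp_mul_add hφ hc' r,
    ← tsum_lintegral_Ico_add_intCast (φ := fun x => φ (c * x + r))]
  have habs : ((c.natAbs : ℕ) : ℝ) = |(c : ℝ)| := by
    rw [Nat.cast_natAbs, Int.cast_abs]
  rcases abs_choice (c : ℝ) with h | h
  · refine tsum_congr fun q => lintegral_congr fun x => ?_
    rw [habs, h]
    congr 1
    ring
  -- For negative c the progression is traversed backwards.
  · rw [← (Equiv.neg ℤ).tsum_eq]
    refine tsum_congr fun q => lintegral_congr fun x => ?_
    rw [habs, h]
    congr 1
    simp only [Equiv.neg_apply, Int.cast_neg]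
    ring

end Affine

/-- The contribution to the Eisenstein series `∑ Im(γτ)^s` over `Γ_∞ \ SL(2,ℤ)` of the nontrivial
cosets. -/
def eisensteinTail (s : ℝ) (τ : ℍ) : ENNReal :=
  2⁻¹ * ∑' p : CoprimePair, if p.1 0 = 0 then 0 else ENNReal.ofReal (rowIm p.1 τ ^ s)

/-- The Eisenstein series `∑ Im(γτ)^s` over `Γ_∞ \ SL(2,ℤ)`, as an extended real number. -/
def eisenstein (s : ℝ) (τ : ℍ) : ENNReal :=
  2⁻¹ * ∑' p : CoprimePair, ENNReal.ofReal (rowIm p.1 τ ^ s)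

/-- The coprime rows with first entry 0 are (0,1) and (0,-1), both of height y. -/
lemma tsum_rowIm_eq_add (φ : ℝ → ENNReal) (τ : ℍ) :
    ∑' p : CoprimePair, φ (rowIm p.1 τ) =
      2 * φ τ.im + ∑' p : CoprimePair, if p.1 0 = 0 then 0 else φ (rowIm p.1 τ) := by
  classical
  let a : CoprimePair := ⟨![0, 1], ⟨0, 1, by simp⟩⟩
  let b : CoprimePair := ⟨![0, -1], ⟨0, -1, by simp⟩⟩
  have hab : a ≠ b := by
    intro h
    have := congrFun (congrArg Subtype.val h) 1
    simp [a, b] at this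
  have ha : rowIm a.1 τ = τ.im := by simp [a, rowIm]
  have hb : rowIm b.1 τ = τ.im := by simp [b, rowIm]
  have hsplit : ∀ p : CoprimePair, φ (rowIm p.1 τ) =
      (if p.1 0 = 0 then φ (rowIm p.1 τ) else 0) +
        if p.1 0 = 0 then 0 else φ (rowIm p.1 τ) := by
    intro p
    split_ifs <;> simp
  rw [tsum_congr hsplit, ENNReal.tsum_add]
  congr 1
  rw [tsum_eq_sum (s := {a, b})]
  · rw [Finset.sum_pair hab, ha, hb]
    simp [a, b, two_mul]
  · intro p hp
    rw [if_neg]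
    intro h0
    apply hp
    have h1 : IsUnit (p.1 1) := by
      have := p.2
      rw [h0] at this
      exact isCoprime_zero_left.mp this
    simp only [Finset.mem_insert, Finset.mem_singleton]
    rcases Int.isUnit_iff.mp h1 with h | h
    · exact Or.inl (Subtype.ext (funext fun i => by fin_cases i <;> simp [a, h0, h]))
    · exact Or.inr (Subtype.ext (funext fun i => by fin_cases i <;> simp [b, h0, h]))

lemma eisenstein_eq_add (s : ℝ) (τ : ℍ) :
    eisenstein s τ = ENNReal.ofReal (τ.im ^ s) + eisensteinTail s τ := by
  rw [eisenstein, tsum_rowIm_eq_add (fun y => ENNReal.ofReal (y ^ s)), mul_add, ← mul_assoc,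
    ENNReal.inv_mul_cancel two_ne_zero ENNReal.ofNat_ne_top, one_mul]
  rfl

lemma measurable_eisensteinTail (s : ℝ) : Measurable (eisensteinTail s) := by
  refine Measurable.const_mul (Measurable.tsum fun p => ?_) _
  by_cases h : p.1 0 = 0
  · simp [h]
  · simp only [h, if_false]
    exact ((measurable_rowIm p.1).pow_const s).ennreal_ofReal

lemma measurable_eisenstein (s : ℝ) : Measurable (eisenstein s) := by
  simp only [funext (eisenstein_eq_add s)]
  exact ((UpperHalfPlane.measurable_im.pow_const s).ennreal_ofReal).add
    (measurable_eisensteinTail s)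

/-- Right translation of bottom rows. -/
def CoprimePair.mulRight (γ : Matrix.SpecialLinearGroup (Fin 2) ℤ) : CoprimePair ≃ CoprimePair where
  toFun p := ⟨Matrix.vecMul p.1 γ.1, p.2.vecMulSL γ⟩
  invFun p := ⟨Matrix.vecMul p.1 (γ⁻¹).1, p.2.vecMulSL γ⁻¹⟩
  left_inv p := by
    apply Subtype.ext
    simp only [Matrix.vecMul_vecMul]
    rw [← Matrix.SpecialLinearGroup.coe_mul, mul_inv_cancel]
    simp
  right_inv p := by
    apply Subtype.ext
    simp only [Matrix.vecMul_vecMul]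
    rw [← Matrix.SpecialLinearGroup.coe_mul, inv_mul_cancel]
    simp

lemma im_smul_eq_rowIm (γ : Matrix.SpecialLinearGroup (Fin 2) ℤ) (τ : ℍ) :
    (γ • τ).im = rowIm (γ 1) τ := by
  rw [ModularGroup.im_smul_eq_div_normSq, rowIm]
  simp [UpperHalfPlane.denom]

lemma rowIm_smul (p : CoprimePair) (γ : Matrix.SpecialLinearGroup (Fin 2) ℤ) (τ : ℍ) :
    rowIm p.1 (γ • τ) = rowIm (CoprimePair.mulRight γ p).1 τ := by
  rw [← p.im_toModular_smul, smul_smul, im_smul_eq_rowIm]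
  congr 1
  rw [Matrix.SpecialLinearGroup.coe_mul]
  change (p.toModular.1 * γ.1) 1 = Matrix.vecMul p.1 γ.1
  rw [← p.toModular_row]
  rfl

/-- Right multiplication by γ permutes the coprime rows. With values in [0,∞] no convergence has to
be known. -/
lemma eisenstein_smul (s : ℝ) (γ : Matrix.SpecialLinearGroup (Fin 2) ℤ) (τ : ℍ) :
    eisenstein s (γ • τ) = eisenstein s τ := by
  simp only [eisenstein, rowIm_smul]
  rw [(CoprimePair.mulRight γ).tsum_eq fun p => ENNReal.ofReal (rowIm p.1 τ ^ s)]

/-- Since |cτ + d|² ≥ c²y² ≥ y² for c ≠ 0, these terms stay bounded on the fundamental domain and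
are untouched by a cutoff at T ≥ 2. -/
lemma rowIm_le_inv {p : CoprimePair} (hp : p.1 0 ≠ 0) (τ : ℍ) : rowIm p.1 τ ≤ τ.im⁻¹ := by
  have hy := τ.im_pos
  have hn : τ.im ^ 2 ≤ Complex.normSq (p.1 0 * τ + p.1 1) := by
    have h1 : (1 : ℝ) ≤ (p.1 0 : ℝ) ^ 2 := by
      have := Int.one_le_abs hp
      rw [← sq_abs]
      have h2 : (1 : ℝ) ≤ |(p.1 0 : ℝ)| := by exact_mod_cast this
      nlinarith
    rw [Complex.normSq_apply]
    simp
    nlinarith [sq_nonneg ((p.1 0 : ℝ) * τ.re + p.1 1), sq_nonneg τ.im]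
  rw [rowIm, div_le_iff₀ (lt_of_lt_of_le (by positivity) hn), ← div_eq_inv_mul, le_div_iff₀ hy]
  nlinarith

/-- The truncated Eisenstein series integrates to the minimal counterterm. -/
lemma lintegral_fdo_truncated_eisenstein {s T : ℝ} (hs : 1 < s) (hT : 2 ≤ T) :
    ∫⁻ τ in ModularGroup.fdo, (Set.indicator (Set.Iic T) (fun y => ENNReal.ofReal (y ^ s)) τ.im +
      eisensteinTail s τ) = ENNReal.ofReal (T ^ (s - 1) / (s - 1)) := by
  set G : ℝ → ENNReal := Set.indicator (Set.Iic T) fun y => ENNReal.ofReal (y ^ s) with hG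
  have hGm : Measurable G := Measurable.indicator (by fun_prop) measurableSet_Iic
  have h1 := lintegral_fdo_mul_tsum_rowIm (h := fun _ => 2⁻¹) measurable_const (fun _ _ => rfl) hGm
  have h2 : ∀ τ ∈ ModularGroup.fdo, (2⁻¹ : ENNReal) * ∑' p : CoprimePair, G (rowIm p.1 τ) =
      G τ.im + eisensteinTail s τ := by
    intro τ hτ
    rw [tsum_rowIm_eq_add, mul_add, ← mul_assoc,
      ENNReal.inv_mul_cancel two_ne_zero ENNReal.ofNat_ne_top, one_mul, eisensteinTail]
    congr 2
    refine tsum_congr fun p => ?_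
    split_ifs with h0
    · rfl
    -- On the domain y > 1/2, so a row with c ≠ 0 has height at most 1/y ≤ 2 ≤ T: cutting off every
    -- term of the series only affects y^s itself.
    · refine Set.indicator_of_mem ?_ _
      have h3 := rowIm_le_inv h0 τ
      have h4 : τ.im⁻¹ ≤ 2 := by
        rw [inv_le_comm₀ τ.im_pos two_pos]
        have := one_half_lt_im_of_mem_fdo hτ
        linarith
      exact h3.trans (h4.trans hT)
  rw [← setLIntegral_congr_fun measurableSet_fdo h2, h1]
  have hm : Measurable fun τ : ℍ => (2⁻¹ : ENNReal) * G τ.im :=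
    (hGm.comp UpperHalfPlane.measurable_im).const_mul _
  rw [lintegral_verticalStrip hm]
  have h5 : ∀ y ∈ Set.Ioi (0 : ℝ), ENNReal.ofReal (y ^ (-2 : ℝ)) *
      ∫⁻ x in Set.Ico (-(1 / 2) : ℝ) (1 / 2), 2⁻¹ * G (upperPoint (x, y)).im =
      2⁻¹ * Set.indicator (Set.Ioc 0 T) (fun y => ENNReal.ofReal (y ^ (s - 2))) y := by
    intro y hy
    have hy : 0 < y := hy
    simp only [upperPoint_im (q := (_, y)) hy, lintegral_const, Measure.restrict_apply_univ,
      Real.volume_Ico]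
    norm_num
    rw [mul_left_comm]
    congr 1
    by_cases hyT : y ≤ T
    · rw [hG, Set.indicator_of_mem (show y ∈ Set.Iic T from hyT),
        Set.indicator_of_mem (show y ∈ Set.Ioc 0 T from ⟨hy, hyT⟩), ← ENNReal.ofReal_mul (by positivity),
        ← Real.rpow_natCast, ← Real.rpow_neg hy.le, ← Real.rpow_add hy]
      congr 2
      push_cast
      ring
    · rw [hG, Set.indicator_of_notMem (show y ∉ Set.Iic T from hyT),
        Set.indicator_of_notMem (show y ∉ Set.Ioc 0 T from fun h => hyT h.2), mul_zero]
  rw [setLIntegral_congr_fun measurableSet_Ioi h5, lintegral_const_mul _ (Measurable.indicator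
    (by fun_prop) measurableSet_Ioc), ← mul_assoc, ENNReal.mul_inv_cancel two_ne_zero
    ENNReal.ofNat_ne_top, one_mul, lintegral_indicator measurableSet_Ioc,
    Measure.restrict_restrict measurableSet_Ioc,
    Set.inter_eq_left.mpr Set.Ioc_subset_Ioi_self]
  have hint : IntervalIntegrable (fun y : ℝ => y ^ (s - 2)) volume 0 T :=
    intervalIntegral.intervalIntegrable_rpow' (by linarith)
  rw [← ofReal_integral_eq_lintegral_ofReal
    ((intervalIntegrable_iff_integrableOn_Ioc_of_le (by linarith)).mp hint)
    ((ae_restrict_iff' measurableSet_Ioc).mpr (ae_of_all _ fun y hy => Real.rpow_nonneg hy.1.le _)),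
    ← intervalIntegral.integral_of_le (by linarith), integral_rpow (Or.inl (by linarith)),
    Real.zero_rpow (by linarith), show s - 2 + 1 = s - 1 by ring, sub_zero]

/-- The coefficient of `y^{1-s}` in the constant term of the Eisenstein series. -/
def eisensteinScattering (s : ℝ) : ENNReal :=
  ∫⁻ x in Set.Ico (-(1 / 2) : ℝ) (1 / 2), eisensteinTail s (upperPoint (x, 1))

/-- For fixed c ≠ 0 coprimality depends only on the residue of the second entry modulo |c|, and
within one residue class the integrals over a period glue to an integral over ℝ. -/
lemma lintegral_eisensteinTail_aux {s y : ℝ} (hy : 0 < y) :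
    ∫⁻ x in Set.Ico (-(1 / 2) : ℝ) (1 / 2), eisensteinTail s (upperPoint (x, y)) =
      2⁻¹ * ∑' c : ℤ, if c = 0 then 0 else
        ∑ r : Fin c.natAbs, (if IsCoprime c r then 1 else 0) * (ENNReal.ofReal |(c : ℝ)⁻¹| *
          ∫⁻ u : ℝ, ENNReal.ofReal ((y / (u ^ 2 + (c * y) ^ 2)) ^ s)) := by
  classical
  set f : ℤ → ℝ → ENNReal := fun c u => ENNReal.ofReal ((y / (u ^ 2 + (c * y) ^ 2)) ^ s) with hf
  have hfm : ∀ c, Measurable (f c) := fun c => by simp only [hf]; fun_prop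
  have h1 : ∀ x : ℝ, eisensteinTail s (upperPoint (x, y)) = 2⁻¹ * ∑' c : ℤ, ∑' e : ℤ,
      if IsCoprime c e ∧ c ≠ 0 then f c (c * x + e) else 0 := by
    intro x
    have h2 : ∀ v : Fin 2 → ℤ, rowIm v (upperPoint (x, y)) =
        y / ((v 0 * x + v 1) ^ 2 + (v 0 * y) ^ 2) := by
      intro v
      rw [rowIm, upperPoint_im hy, coe_upperPoint hy, Complex.normSq_apply]
      congr 1
      simp
      ring
    rw [eisensteinTail, ← ENNReal.tsum_prod, ← (finTwoArrowEquiv ℤ).tsum_eq]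
    congr 1
    rw [← Function.Injective.tsum_eq (g := (Subtype.val : CoprimePair → Fin 2 → ℤ))
      Subtype.val_injective]
    · refine tsum_congr fun p => ?_
      have hp := p.2
      simp only [finTwoArrowEquiv_apply, hf]
      by_cases h0 : p.1 0 = 0
      · simp [h0]
      · rw [if_neg h0, if_pos ⟨hp, h0⟩, h2]
        rfl
    · intro v hv
      by_contra hcon
      apply hv
      simp only [finTwoArrowEquiv_apply]
      rw [if_neg]
      rintro ⟨h, -⟩
      exact hcon ⟨⟨v, h⟩, rfl⟩
  have hm2 : ∀ c e : ℤ, Measurable fun x : ℝ =>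
      if IsCoprime c e ∧ c ≠ 0 then f c (c * x + e) else 0 := by
    intro c e
    split_ifs
    · exact (hfm c).comp (by fun_prop)
    · exact measurable_const
  simp only [h1]
  rw [lintegral_const_mul _ (Measurable.tsum fun c => Measurable.tsum fun e => hm2 c e),
    lintegral_tsum fun c => (Measurable.tsum fun e => hm2 c e).aemeasurable]
  congr 1
  refine tsum_congr fun c => ?_
  rw [lintegral_tsum fun e => (hm2 c e).aemeasurable]
  split_ifs with hc
  · simp [hc]
  · have : NeZero c.natAbs := ⟨by simpa using hc⟩
    rw [tsum_int_eq_sum_fin_tsum (c := c.natAbs)]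
    refine Finset.sum_congr rfl fun r _ => ?_
    have hcop : ∀ q : ℤ, IsCoprime c ((r : ℤ) + c.natAbs * q) ↔ IsCoprime c (r : ℤ) := by
      intro q
      rw [Int.natCast_natAbs]
      rcases abs_choice c with h | h
      · rw [h]; exact IsCoprime.add_mul_left_right_iff
      · rw [h, neg_mul, ← mul_neg]; exact IsCoprime.add_mul_left_right_iff
    rw [← tsum_lintegral_Ico_mul_add (hfm c) hc r]
    by_cases hr : IsCoprime c (r : ℤ)
    · rw [if_pos hr, one_mul]
      refine tsum_congr fun q => lintegral_congr fun x => ?_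
      rw [if_pos ⟨(hcop q).mpr hr, hc⟩]
      simp only [Int.cast_add, Int.cast_mul, Int.cast_natCast]
    · rw [if_neg hr, zero_mul]
      refine ENNReal.tsum_eq_zero.mpr fun q => ?_
      have hn : ¬(IsCoprime c ((r : ℤ) + c.natAbs * q) ∧ c ≠ 0) := fun h => hr ((hcop q).mp h.1)
      simp only [if_neg hn, lintegral_zero]

/-- The substitution u ↦ yu extracts the same power y^{1-s} for every c. What remains is the value
at y = 1, so no explicit zeta quotient is needed. -/
lemma lintegral_eisensteinTail {s y : ℝ} (hy : 0 < y) :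
    ∫⁻ x in Set.Ico (-(1 / 2) : ℝ) (1 / 2), eisensteinTail s (upperPoint (x, y)) =
      ENNReal.ofReal (y ^ (1 - s)) * eisensteinScattering s := by
  rw [eisensteinScattering, lintegral_eisensteinTail_aux hy, lintegral_eisensteinTail_aux one_pos,
    mul_left_comm]
  congr 1
  rw [← ENNReal.tsum_mul_left]
  refine tsum_congr fun c => ?_
  split_ifs with hc
  · rw [mul_zero]
  · rw [Finset.mul_sum]
    refine Finset.sum_congr rfl fun r _ => ?_
    have h1 := lintegral_comp_mul_add
      (φ := fun u : ℝ => ENNReal.ofReal ((y / (u ^ 2 + (c * y) ^ 2)) ^ s)) (by fun_prop) hy.ne' 0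
    have h2 : ∀ u : ℝ, ENNReal.ofReal ((y / ((y * u + 0) ^ 2 + (c * y) ^ 2)) ^ s) =
        ENNReal.ofReal (y ^ (-s)) * ENNReal.ofReal ((1 / (u ^ 2 + (c * 1) ^ 2)) ^ s) := by
      intro u
      rw [← ENNReal.ofReal_mul (by positivity), Real.rpow_neg hy.le, ← Real.inv_rpow hy.le,
        ← Real.mul_rpow (by positivity) (by positivity)]
      congr 2
      have hc' : 0 < ((c : ℝ)) ^ 2 := by
        have : (c : ℝ) ≠ 0 := by exact_mod_cast hc
        positivity
      have : 0 < u ^ 2 + (c * 1 : ℝ) ^ 2 := by nlinarith [sq_nonneg u]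
      have : 0 < (y * u + 0) ^ 2 + (c * y : ℝ) ^ 2 := by
        have : 0 < (c : ℝ) ^ 2 * y ^ 2 := by positivity
        nlinarith [sq_nonneg (y * u)]
      field_simp
      ring
    simp only [h2] at h1
    rw [lintegral_const_mul _ (by fun_prop), abs_of_pos (inv_pos.mpr hy)] at h1
    have h3 : ∫⁻ u : ℝ, ENNReal.ofReal ((y / (u ^ 2 + (c * y) ^ 2)) ^ s) =
        ENNReal.ofReal (y ^ (1 - s)) * ∫⁻ u : ℝ, ENNReal.ofReal ((1 / (u ^ 2 + (c * 1) ^ 2)) ^ s) := by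
      have hyy : ENNReal.ofReal y * ENNReal.ofReal y⁻¹ = 1 := by
        rw [← ENNReal.ofReal_mul hy.le, mul_inv_cancel₀ hy.ne', ENNReal.ofReal_one]
      rw [sub_eq_add_neg, Real.rpow_add hy, Real.rpow_one, ENNReal.ofReal_mul hy.le, mul_assoc, h1,
        ← mul_assoc, hyy, one_mul]
    rw [h3]
    ring

lemma lintegral_fdo_eisensteinTail_ne_top {s : ℝ} (hs : 1 < s) :
    ∫⁻ τ in ModularGroup.fdo, eisensteinTail s τ ≠ ⊤ := by
  refine ne_top_of_le_ne_top ?_ (lintegral_mono (g := fun τ : ℍ =>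
    Set.indicator (Set.Iic 2) (fun y => ENNReal.ofReal (y ^ s)) τ.im + eisensteinTail s τ)
    fun τ => le_add_self)
  rw [lintegral_fdo_truncated_eisenstein hs le_rfl]
  exact ENNReal.ofReal_ne_top

/-- Above height 1 the domain contains almost a full period of τ₁. If the coefficient were infinite,
the tail would integrate to ∞ on each horizontal segment there, contradicting its finite integral
over the domain. -/
lemma eisensteinScattering_ne_top {s : ℝ} (hs : 1 < s) : eisensteinScattering s ≠ ⊤ := by
  intro htop
  apply lintegral_fdo_eisensteinTail_ne_top hs
  have hm : Measurable (Set.indicator ModularGroup.fdo (eisensteinTail s)) :=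
    (measurable_eisensteinTail s).indicator measurableSet_fdo
  have h2 : ∫⁻ τ in ModularGroup.fdo, eisensteinTail s τ =
      ∫⁻ τ in verticalStrip, Set.indicator ModularGroup.fdo (eisensteinTail s) τ := by
    rw [lintegral_indicator measurableSet_fdo, Measure.restrict_restrict measurableSet_fdo,
      Set.inter_eq_left.mpr fdo_subset_verticalStrip]
  rw [h2, lintegral_verticalStrip hm, eq_top_iff]
  calc (⊤ : ENNReal) = ∫⁻ _y in Set.Ioi (1 : ℝ), ⊤ := by simp
    _ ≤ ∫⁻ y in Set.Ioi (1 : ℝ), ENNReal.ofReal (y ^ (-2 : ℝ)) *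
        ∫⁻ x in Set.Ico (-(1 / 2) : ℝ) (1 / 2),
          Set.indicator ModularGroup.fdo (eisensteinTail s) (upperPoint (x, y)) := by
        refine setLIntegral_mono' measurableSet_Ioi fun y hy => ?_
        have hy1 : 1 < y := hy
        have hy : 0 < y := one_pos.trans hy
        have h3 : ∫⁻ x in Set.Ico (-(1 / 2) : ℝ) (1 / 2),
            Set.indicator ModularGroup.fdo (eisensteinTail s) (upperPoint (x, y)) = ⊤ := by
          have h4 : ∀ x ∈ Set.Ioo (-(1 / 2) : ℝ) (1 / 2),
              Set.indicator ModularGroup.fdo (eisensteinTail s) (upperPoint (x, y)) =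
                eisensteinTail s (upperPoint (x, y)) := by
            intro x hx
            have hmem : upperPoint (x, y) ∈ ModularGroup.fdo := by
              constructor
              · rw [coe_upperPoint hy, Complex.normSq_apply]
                simp only
                nlinarith [mul_self_nonneg x]
              · rw [upperPoint_re, abs_lt]
                exact hx
            exact Set.indicator_of_mem hmem _
          rw [← setLIntegral_congr (Ioo_ae_eq_Ico (μ := volume)),
            setLIntegral_congr_fun measurableSet_Ioo h4,
            setLIntegral_congr (Ioo_ae_eq_Ico (μ := volume)), lintegral_eisensteinTail hy, htop,
            ENNReal.mul_top (ENNReal.ofReal_pos.mpr (by positivity)).ne']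
        rw [h3, ENNReal.mul_top (ENNReal.ofReal_pos.mpr (by positivity)).ne']
    _ ≤ _ := lintegral_mono_set (Set.Ioi_subset_Ioi zero_le_one)

/-- Enlarging the domain to the strip above height 1/2 costs only an inequality, and on the strip
the tail is seen through its constant term. -/
lemma lintegral_fdo_eisensteinTail_mul_le {s : ℝ} {w : ℝ → ENNReal} (hw : Measurable w) :
    ∫⁻ τ in ModularGroup.fdo, eisensteinTail s τ * w τ.im ≤
      eisensteinScattering s * ∫⁻ y in Set.Ioi (1 / 2 : ℝ), ENNReal.ofReal (y ^ (-1 - s)) * w y := by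
  have hm : Measurable fun τ : ℍ => eisensteinTail s τ *
      Set.indicator (Set.Ioi (1 / 2)) w τ.im :=
    (measurable_eisensteinTail s).mul ((hw.indicator measurableSet_Ioi).comp
      UpperHalfPlane.measurable_im)
  calc ∫⁻ τ in ModularGroup.fdo, eisensteinTail s τ * w τ.im
      = ∫⁻ τ in ModularGroup.fdo, eisensteinTail s τ * Set.indicator (Set.Ioi (1 / 2)) w τ.im := by
        refine setLIntegral_congr_fun measurableSet_fdo fun τ hτ => ?_
        rw [Set.indicator_of_mem (show τ.im ∈ Set.Ioi (1 / 2) from one_half_lt_im_of_mem_fdo hτ)]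
    _ ≤ ∫⁻ τ in verticalStrip, eisensteinTail s τ * Set.indicator (Set.Ioi (1 / 2)) w τ.im :=
        lintegral_mono_set fdo_subset_verticalStrip
    _ = ∫⁻ y in Set.Ioi (0 : ℝ), eisensteinScattering s * Set.indicator (Set.Ioi (1 / 2))
          (fun y => ENNReal.ofReal (y ^ (-1 - s)) * w y) y := by
        rw [lintegral_verticalStrip hm]
        refine setLIntegral_congr_fun measurableSet_Ioi fun y hy => ?_
        have hy : 0 < y := hy
        simp only [upperPoint_im (q := (_, y)) hy]
        have hmx : Measurable fun x : ℝ => eisensteinTail s (upperPoint (x, y)) :=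
          (measurable_eisensteinTail s).comp
            (measurable_upperPoint.comp (measurable_id.prodMk measurable_const))
        rw [lintegral_mul_const _ hmx, lintegral_eisensteinTail hy]
        by_cases h : y ∈ Set.Ioi (1 / 2 : ℝ)
        · rw [Set.indicator_of_mem h, Set.indicator_of_mem h, show -1 - s = -2 + (1 - s) by ring,
            Real.rpow_add hy, ENNReal.ofReal_mul (by positivity)]
          ring
        · rw [Set.indicator_of_notMem h, Set.indicator_of_notMem h]
          ring
    _ = _ := by
        rw [lintegral_const_mul _ (Measurable.indicator (by fun_prop) measurableSet_Ioi),
          lintegral_indicator measurableSet_Ioi, Measure.restrict_restrict measurableSet_Ioi,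
          Set.inter_eq_left.mpr (Set.Ioi_subset_Ioi (by norm_num))]

/-! ### The partition function with its zero-charge contribution subtracted -/

lemma lintegral_Ioi_rpow_ne_top {a c : ℝ} (ha : a < -1) (hc : 0 < c) :
    ∫⁻ y in Set.Ioi c, ENNReal.ofReal (y ^ a) ≠ ⊤ :=
  (integrableOn_Ioi_rpow_of_lt ha hc).lintegral_lt_top.ne

lemma lintegral_fdo_comp_im_le {w : ℝ → ENNReal} (hw : Measurable w) :
    ∫⁻ τ in ModularGroup.fdo, w τ.im ≤
      ∫⁻ y in Set.Ioi (1 / 2 : ℝ), ENNReal.ofReal (y ^ (-2 : ℝ)) * w y := by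
  calc ∫⁻ τ in ModularGroup.fdo, w τ.im
      = ∫⁻ τ in ModularGroup.fdo, Set.indicator (Set.Ioi (1 / 2)) w τ.im := by
        refine setLIntegral_congr_fun measurableSet_fdo fun τ hτ => ?_
        rw [Set.indicator_of_mem (show τ.im ∈ Set.Ioi (1 / 2) from one_half_lt_im_of_mem_fdo hτ)]
    _ ≤ ∫⁻ τ in verticalStrip, Set.indicator (Set.Ioi (1 / 2)) w τ.im :=
        lintegral_mono_set fdo_subset_verticalStrip
    _ = ∫⁻ y in Set.Ioi (0 : ℝ), Set.indicator (Set.Ioi (1 / 2))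
          (fun y => ENNReal.ofReal (y ^ (-2 : ℝ)) * w y) y := by
        have hm : Measurable fun τ : ℍ => Set.indicator (Set.Ioi (1 / 2)) w τ.im :=
          (hw.indicator measurableSet_Ioi).comp UpperHalfPlane.measurable_im
        rw [lintegral_verticalStrip hm]
        refine setLIntegral_congr_fun measurableSet_Ioi fun y hy => ?_
        have hy : 0 < y := hy
        simp only [upperPoint_im (q := (_, y)) hy, lintegral_const,
          Measure.restrict_apply_univ, Real.volume_Ico]
        norm_num
        by_cases h : y ∈ Set.Ioi (1 / 2 : ℝ)
        · rw [Set.indicator_of_mem h, Set.indicator_of_mem h]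
        · rw [Set.indicator_of_notMem h, Set.indicator_of_notMem h, mul_zero]
    _ = _ := by
        rw [lintegral_indicator measurableSet_Ioi, Measure.restrict_restrict measurableSet_Ioi,
          Set.inter_eq_left.mpr (Set.Ioi_subset_Ioi (by norm_num))]

lemma integrableOn_fdo_of_norm_le {f : ℍ → ℂ} (hf : Measurable f) {a C : ℝ} (ha : a < 1)
    (h : ∀ τ : ℍ, 1 / 2 ≤ τ.im → ‖f τ‖ ≤ C * τ.im ^ a) : IntegrableOn f ModularGroup.fdo := by
  have hi : IntegrableOn (fun τ : ℍ => τ.im ^ a) ModularGroup.fdo := by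
    refine ⟨(UpperHalfPlane.measurable_im.pow_const a).aestronglyMeasurable, ?_⟩
    rw [hasFiniteIntegral_iff_ofReal (ae_of_all _ fun τ => Real.rpow_nonneg τ.im_pos.le _)]
    refine (lintegral_fdo_comp_im_le (w := fun y => ENNReal.ofReal (y ^ a)) (by fun_prop)).trans_lt ?_
    rw [setLIntegral_congr_fun (g := fun y => ENNReal.ofReal (y ^ (a - 2))) measurableSet_Ioi]
    · exact (lintegral_Ioi_rpow_ne_top (by linarith) (by norm_num)).lt_top
    · intro y hy
      have hy : 0 < y := (by norm_num : (0 : ℝ) < 1 / 2).trans hy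
      simp only
      rw [← ENNReal.ofReal_mul (by positivity), ← Real.rpow_add hy, neg_add_eq_sub]
  refine Integrable.mono' (hi.const_mul C) hf.aestronglyMeasurable ?_
  filter_upwards [ae_restrict_mem measurableSet_fdo] with τ hτ
  exact h τ (one_half_lt_im_of_mem_fdo hτ).le

lemma integrableOn_fdo_eisensteinTail_mul {s a : ℝ} (hs : 1 < s) (ha : a < s) :
    IntegrableOn (fun τ : ℍ => (eisensteinTail s τ).toReal * τ.im ^ a) ModularGroup.fdo := by
  refine ⟨((measurable_eisensteinTail s).ennreal_toReal.mul
    (UpperHalfPlane.measurable_im.pow_const a)).aestronglyMeasurable, ?_⟩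
  rw [hasFiniteIntegral_iff_ofReal (ae_of_all _ fun τ =>
    mul_nonneg ENNReal.toReal_nonneg (Real.rpow_nonneg τ.im_pos.le _))]
  calc ∫⁻ τ in ModularGroup.fdo, ENNReal.ofReal ((eisensteinTail s τ).toReal * τ.im ^ a)
      ≤ ∫⁻ τ in ModularGroup.fdo, eisensteinTail s τ * ENNReal.ofReal (τ.im ^ a) := by
        refine lintegral_mono fun τ => ?_
        rw [ENNReal.ofReal_mul ENNReal.toReal_nonneg]
        exact mul_le_mul_left ENNReal.ofReal_toReal_le _
    _ ≤ eisensteinScattering s * ∫⁻ y in Set.Ioi (1 / 2 : ℝ),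
          ENNReal.ofReal (y ^ (-1 - s)) * ENNReal.ofReal (y ^ a) :=
        lintegral_fdo_eisensteinTail_mul_le (w := fun y => ENNReal.ofReal (y ^ a)) (by fun_prop)
    _ = eisensteinScattering s * ∫⁻ y in Set.Ioi (1 / 2 : ℝ), ENNReal.ofReal (y ^ (-1 - s + a)) := by
        congr 1
        refine setLIntegral_congr_fun measurableSet_Ioi fun y hy => ?_
        have hy : 0 < y := (by norm_num : (0 : ℝ) < 1 / 2).trans hy
        rw [← ENNReal.ofReal_mul (by positivity), ← Real.rpow_add hy]
    _ < ⊤ := ENNReal.mul_lt_top (eisensteinScattering_ne_top hs).lt_top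
        (lintegral_Ioi_rpow_ne_top (by linarith) (by norm_num)).lt_top

lemma eisensteinTail_lt_top_ae {s : ℝ} (hs : 1 < s) :
    ∀ᵐ τ : ℍ ∂volume.restrict ModularGroup.fdo, eisensteinTail s τ < ⊤ :=
  ae_lt_top (measurable_eisensteinTail s) (lintegral_fdo_eisensteinTail_ne_top hs)

/-- The part below height `T` of the interior of the fundamental domain. -/
def truncatedFdo (T : ℝ) : Set ℍ := ModularGroup.fdo ∩ {τ | τ.im ≤ T}

lemma measurableSet_truncatedFdo (T : ℝ) : MeasurableSet (truncatedFdo T) :=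
  measurableSet_fdo.inter (measurableSet_le UpperHalfPlane.measurable_im measurable_const)

lemma truncatedFdo_subset (T : ℝ) : truncatedFdo T ⊆ ModularGroup.fdo := Set.inter_subset_left

lemma truncatedFdo_mono : Monotone truncatedFdo :=
  fun _ _ h _ hτ => ⟨hτ.1, le_trans hτ.2 h⟩

lemma iUnion_truncatedFdo : ⋃ T, truncatedFdo T = ModularGroup.fdo := by
  ext τ
  simp only [truncatedFdo, Set.mem_iUnion, Set.mem_inter_iff, Set.mem_ofPred_eq]
  exact ⟨fun ⟨_, h⟩ => h.1, fun h => ⟨_, h, le_rfl⟩⟩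

lemma truncatedFundamentalDomain_ae_eq (T : ℝ) :
    truncatedFundamentalDomain T =ᵐ[volume] truncatedFdo T :=
  fd_ae_eq_fdo.inter (EventuallyEq.refl _ {τ : ℍ | τ.im ≤ T})

lemma tendsto_integral_truncatedFdo {f : ℍ → ℂ} (hf : IntegrableOn f ModularGroup.fdo) :
    Tendsto (fun T => ∫ τ in truncatedFdo T, f τ) atTop (𝓝 (∫ τ in ModularGroup.fdo, f τ)) := by
  rw [← iUnion_truncatedFdo] at hf ⊢
  exact tendsto_setIntegral_of_monotone measurableSet_truncatedFdo truncatedFdo_mono hf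

lemma lintegral_truncatedFdo_add {s T : ℝ} (hs : 1 < s) (hT : 2 ≤ T) :
    (∫⁻ τ in truncatedFdo T, ENNReal.ofReal (τ.im ^ s)) + ∫⁻ τ in ModularGroup.fdo, eisensteinTail s τ =
      ENNReal.ofReal (T ^ (s - 1) / (s - 1)) := by
  rw [← lintegral_fdo_truncated_eisenstein hs hT, lintegral_add_right _ (measurable_eisensteinTail s)]
  congr 1
  have hm : MeasurableSet {τ : ℍ | τ.im ≤ T} :=
    measurableSet_le UpperHalfPlane.measurable_im measurable_const
  rw [truncatedFdo, Set.inter_comm, ← Measure.restrict_restrict hm, ← lintegral_indicator hm]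
  rfl

lemma integrableOn_truncatedFdo_rpow {s : ℝ} (hs : 1 < s) (T : ℝ) :
    IntegrableOn (fun τ : ℍ => τ.im ^ s) (truncatedFdo T) := by
  refine IntegrableOn.mono_set ?_ (truncatedFdo_mono (le_max_left T 2))
  refine ⟨(UpperHalfPlane.measurable_im.pow_const s).aestronglyMeasurable, ?_⟩
  rw [hasFiniteIntegral_iff_ofReal (ae_of_all _ fun τ => Real.rpow_nonneg τ.im_pos.le _)]
  refine lt_of_le_of_lt (le_add_right le_rfl)
    ((lintegral_truncatedFdo_add hs (le_max_right T 2)).trans_lt ENNReal.ofReal_lt_top)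

/-- Below the cutoff, the zero charge produces the minimal counterterm up to a constant, the
integral of the Eisenstein tail; subtracting the Eisenstein series restores precisely this constant.
-/
lemma integral_truncatedFdo_rpow {s T : ℝ} (hs : 1 < s) (hT : 2 ≤ T) :
    ∫ τ in truncatedFdo T, τ.im ^ s =
      T ^ (s - 1) / (s - 1) - ∫ τ in ModularGroup.fdo, (eisensteinTail s τ).toReal := by
  have h := lintegral_truncatedFdo_add hs hT
  have h0 : 0 ≤ T ^ (s - 1) / (s - 1) :=
    div_nonneg (Real.rpow_nonneg (by linarith) _) (by linarith)
  rw [integral_toReal (measurable_eisensteinTail s).aemeasurable (eisensteinTail_lt_top_ae hs),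
    integral_eq_lintegral_of_nonneg_ae (ae_of_all _ fun τ => Real.rpow_nonneg τ.im_pos.le _)
    (UpperHalfPlane.measurable_im.pow_const s).aestronglyMeasurable, eq_sub_iff_add_eq,
    ← ENNReal.toReal_add _ (lintegral_fdo_eisensteinTail_ne_top hs), h, ENNReal.toReal_ofReal h0]
  exact ne_top_of_le_ne_top (h.trans_ne ENNReal.ofReal_ne_top) (le_add_right le_rfl)

/-! ### The Eisenstein-subtracted partition function and minimal subtraction -/

namespace NarainModuli

variable {d : ℕ} (M : NarainModuli d)

/-- The partition function minus the Eisenstein series generated by the zero charge. -/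
def subtractedPartition (τ : ℍ) : ℂ :=
  M.latticePartition τ - ((eisenstein ((d : ℝ) / 2) τ).toReal : ℂ)

lemma measurable_subtractedPartition : Measurable M.subtractedPartition :=
  M.measurable_latticePartition.sub
    (Complex.measurable_ofReal.comp (measurable_eisenstein _).ennreal_toReal)

lemma subtractedPartition_smul (γ : Matrix.SpecialLinearGroup (Fin 2) ℤ) (τ : ℍ) :
    M.subtractedPartition (γ • τ) = M.subtractedPartition τ := by
  rw [subtractedPartition, latticePartition_smul, eisenstein_smul, subtractedPartition]

lemma one_lt_half_dim (hd : 3 ≤ d) : 1 < (d : ℝ) / 2 := by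
  have : (3 : ℝ) ≤ d := by exact_mod_cast hd
  linarith

/-- On the domain the leading term of the Eisenstein series cancels the growth y^{d/2}. The tail is
finite almost everywhere, so `toReal` respects the sum there. -/
lemma subtractedPartition_ae_eq (hd : 3 ≤ d) :
    ∀ᵐ τ : ℍ ∂volume.restrict ModularGroup.fdo, M.subtractedPartition τ =
      (M.latticePartition τ - ((τ.im ^ ((d : ℝ) / 2) : ℝ) : ℂ)) -
        ((eisensteinTail ((d : ℝ) / 2) τ).toReal : ℂ) := by
  filter_upwards [eisensteinTail_lt_top_ae (one_lt_half_dim hd)] with τ hτ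
  rw [subtractedPartition, eisenstein_eq_add, ENNReal.toReal_add ENNReal.ofReal_ne_top hτ.ne,
    ENNReal.toReal_ofReal (Real.rpow_nonneg τ.im_pos.le _)]
  push_cast
  ring

lemma integrableOn_fdo_smul_latticePartition_sub {K : ℍ → ℝ} (hK : Measurable K) {C : ℝ}
    (hKC : ∀ τ : ℍ, 1 / 2 ≤ τ.im → |K τ| ≤ C * τ.im ^ (1 / 2 : ℝ)) :
    IntegrableOn (fun τ => K τ • (M.latticePartition τ - ((τ.im ^ ((d : ℝ) / 2) : ℝ) : ℂ)))
      ModularGroup.fdo := by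
  obtain ⟨C', hC', h⟩ := M.exists_nonzeroSum_le (σ := (d : ℝ) + 1) (by linarith)
  -- The choice σ = d + 1 leaves the power y^{-(d+1)/2}; against dy/y² any exponent below 1 would
  -- do.
  refine integrableOn_fdo_of_norm_le (a := 1 / 2 + d / 2 - (d + 1)) (C := C * C') ?_ ?_ fun τ hτ => ?_
  · exact hK.smul (M.measurable_latticePartition.sub
      (Complex.measurable_ofReal.comp (UpperHalfPlane.measurable_im.pow_const _)))
  · linarith [Nat.cast_nonneg (α := ℝ) d]
  · rw [norm_smul, Real.norm_eq_abs]
    have hy := τ.im_pos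
    calc |K τ| * ‖M.latticePartition τ - ((τ.im ^ ((d : ℝ) / 2) : ℝ) : ℂ)‖
        ≤ (C * τ.im ^ (1 / 2 : ℝ)) * (τ.im ^ ((d : ℝ) / 2) * (C' * τ.im ^ (-((d : ℝ) + 1)))) := by
          refine mul_le_mul (hKC τ hτ) ((M.norm_latticePartition_sub_le τ).trans ?_)
            (norm_nonneg _) ((abs_nonneg _).trans (hKC τ hτ))
          exact mul_le_mul_of_nonneg_left (h _ hy) (by positivity)
      _ = _ := by
          rw [sub_eq_add_neg, Real.rpow_add hy, Real.rpow_add hy]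
          ring

/-- The weight y^{1/2} accommodates both K = 1 and the theta kernel. The partition part decays
rapidly, and the tail has constant term y^{1-d/2}, which tolerates any extra power below d/2. -/
lemma integrableOn_fdo_smul_subtractedPartition (hd : 3 ≤ d) {K : ℍ → ℝ} (hK : Measurable K) {C : ℝ}
    (hKC : ∀ τ : ℍ, 1 / 2 ≤ τ.im → |K τ| ≤ C * τ.im ^ (1 / 2 : ℝ)) :
    IntegrableOn (fun τ => K τ • M.subtractedPartition τ) ModularGroup.fdo := by
  have hs := one_lt_half_dim hd
  have h1 := M.integrableOn_fdo_smul_latticePartition_sub hK hKC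
  have h2 : IntegrableOn (fun τ => K τ • ((eisensteinTail ((d : ℝ) / 2) τ).toReal : ℂ))
      ModularGroup.fdo := by
    refine Integrable.mono' ((integrableOn_fdo_eisensteinTail_mul hs
      (a := 1 / 2) (by linarith)).const_mul C) ?_ ?_
    · exact (hK.smul (Complex.measurable_ofReal.comp
        (measurable_eisensteinTail _).ennreal_toReal)).aestronglyMeasurable
    · filter_upwards [ae_restrict_mem measurableSet_fdo] with τ hτ
      rw [norm_smul, Real.norm_eq_abs, Complex.norm_real, Real.norm_of_nonneg ENNReal.toReal_nonneg]
      calc _ ≤ (C * τ.im ^ (1 / 2 : ℝ)) * (eisensteinTail ((d : ℝ) / 2) τ).toReal :=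
            mul_le_mul_of_nonneg_right (hKC τ (one_half_lt_im_of_mem_fdo hτ).le)
              ENNReal.toReal_nonneg
        _ = _ := by ring
  refine (h1.sub h2).congr ?_
  filter_upwards [M.subtractedPartition_ae_eq hd] with τ hτ
  rw [hτ]
  simp only [Pi.sub_apply, smul_sub]

lemma one_le_two_mul_im_rpow {τ : ℍ} (hτ : 1 / 2 ≤ τ.im) : |(1 : ℝ)| ≤ 2 * τ.im ^ (1 / 2 : ℝ) := by
  have h1 : (1 / 2 : ℝ) ≤ (1 / 2 : ℝ) ^ (1 / 2 : ℝ) := by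
    conv_lhs => rw [← Real.rpow_one (1 / 2)]
    exact Real.rpow_le_rpow_of_exponent_ge (by norm_num) (by norm_num) (by norm_num)
  have h2 : (1 / 2 : ℝ) ^ (1 / 2 : ℝ) ≤ τ.im ^ (1 / 2 : ℝ) :=
    Real.rpow_le_rpow (by norm_num) hτ (by norm_num)
  rw [abs_one]
  linarith

/-- The regularized integral of the partition function over the fundamental domain. -/
def regularizedIntegral : ℂ := ∫ τ in ModularGroup.fdo, M.subtractedPartition τ

lemma integrableOn_fdo_latticePartition_sub :
    IntegrableOn (fun τ => M.latticePartition τ - ((τ.im ^ ((d : ℝ) / 2) : ℝ) : ℂ))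
      ModularGroup.fdo := by
  simpa only [one_smul] using M.integrableOn_fdo_smul_latticePartition_sub
    (K := fun _ => 1) measurable_const fun τ hτ => one_le_two_mul_im_rpow hτ

lemma integrableOn_truncatedFdo_ofReal_rpow (hd : 3 ≤ d) (T : ℝ) :
    IntegrableOn (fun τ : ℍ => ((τ.im ^ ((d : ℝ) / 2) : ℝ) : ℂ)) (truncatedFdo T) :=
  (integrableOn_truncatedFdo_rpow (one_lt_half_dim hd) T).ofReal

lemma integrableOn_truncatedFundamentalDomain (hd : 3 ≤ d) (T : ℝ) :
    IntegrableOn M.latticePartition (truncatedFundamentalDomain T) := by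
  refine IntegrableOn.congr_set_ae ?_ (truncatedFundamentalDomain_ae_eq T)
  have h1 := M.integrableOn_fdo_latticePartition_sub.mono_set
    (truncatedFdo_subset T)
  refine (h1.add (integrableOn_truncatedFdo_ofReal_rpow hd T)).congr_fun (fun τ _ => ?_)
    (measurableSet_truncatedFdo T)
  simp

lemma regularizedIntegral_eq (hd : 3 ≤ d) :
    M.regularizedIntegral = (∫ τ in ModularGroup.fdo,
      (M.latticePartition τ - ((τ.im ^ ((d : ℝ) / 2) : ℝ) : ℂ))) -
      ((∫ τ in ModularGroup.fdo, (eisensteinTail ((d : ℝ) / 2) τ).toReal : ℝ) : ℂ) := by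
  have hs := one_lt_half_dim hd
  have h2 : IntegrableOn (fun τ => (eisensteinTail ((d : ℝ) / 2) τ).toReal) ModularGroup.fdo := by
    simpa using integrableOn_fdo_eisensteinTail_mul hs (a := 0) (by linarith)
  rw [regularizedIntegral, integral_congr_ae (M.subtractedPartition_ae_eq hd),
    ← integral_complex_ofReal]
  exact integral_sub M.integrableOn_fdo_latticePartition_sub h2.ofReal

/-- Without its zero charge the partition function is integrable on the whole domain, so its cutoff
integral converges; the zero-charge integral minus the counterterm is constant for T ≥ 2. -/
lemma isRegularizedOneLoop_minimalCounterterm (hd : 3 ≤ d) :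
    M.IsRegularizedOneLoop (minimalCounterterm d) (2 * Real.pi * M.regularizedIntegral) := by
  refine ⟨M.integrableOn_truncatedFundamentalDomain hd, ?_⟩
  have h1 := (tendsto_integral_truncatedFdo M.integrableOn_fdo_latticePartition_sub).sub_const
    ((∫ τ in ModularGroup.fdo, (eisensteinTail ((d : ℝ) / 2) τ).toReal : ℝ) : ℂ)
  rw [← M.regularizedIntegral_eq hd] at h1
  refine (h1.const_mul (2 * (Real.pi : ℂ))).congr' ?_
  filter_upwards [eventually_ge_atTop 2] with T hT
  have h2 := M.integrableOn_fdo_latticePartition_sub.mono_set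
    (truncatedFdo_subset T)
  have h3 := integrableOn_truncatedFdo_ofReal_rpow (d := d) hd T
  have h4 : ∫ τ in truncatedFdo T, M.latticePartition τ =
      (∫ τ in truncatedFdo T, (M.latticePartition τ - ((τ.im ^ ((d : ℝ) / 2) : ℝ) : ℂ))) +
        ((∫ τ in truncatedFdo T, τ.im ^ ((d : ℝ) / 2) : ℝ) : ℂ) := by
    rw [← integral_complex_ofReal, ← integral_add h2 h3]
    simp
  rw [cutoffIntegral, setIntegral_congr_set (truncatedFundamentalDomain_ae_eq T), h4,
    integral_truncatedFdo_rpow (one_lt_half_dim hd) hT, minimalCounterterm]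
  push_cast
  ring

end NarainModuli

/-! ### The theta transform of the half-BPS sum -/

/-- One power bound is used on (0,1], the other beyond 1. -/
lemma integrableOn_Ioi_of_le_rpow {f : ℝ → ℝ} (hf : Measurable f) {a b C C' : ℝ} (ha : -1 < a)
    (hb : b < -1) (h0 : ∀ y > 0, |f y| ≤ C * y ^ a) (h1 : ∀ y > 0, |f y| ≤ C' * y ^ b) :
    IntegrableOn f (Set.Ioi 0) := by
  rw [← Set.Ioc_union_Ioi_eq_Ioi zero_le_one]
  refine IntegrableOn.union ?_ ?_
  · have hi : IntegrableOn (fun y : ℝ => y ^ a) (Set.Ioc 0 1) :=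
      (intervalIntegrable_iff_integrableOn_Ioc_of_le zero_le_one).mp
        (intervalIntegral.intervalIntegrable_rpow' ha)
    refine Integrable.mono' (hi.const_mul C) hf.aestronglyMeasurable ?_
    filter_upwards [ae_restrict_mem measurableSet_Ioc] with y hy using h0 y hy.1
  · refine Integrable.mono' ((integrableOn_Ioi_rpow_of_lt hb one_pos).const_mul C')
      hf.aestronglyMeasurable ?_
    filter_upwards [ae_restrict_mem measurableSet_Ioi] with y hy using h1 y (one_pos.trans hy)

lemma exists_halfTheta_div_le {t r : ℝ} (ht : 0 < t) (hr : 1 / 2 < r) :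
    ∃ C > 0, ∀ y > 0, halfTheta (t / y) ≤ C * y ^ r := by
  obtain ⟨C, hC, h⟩ := exists_halfTheta_le hr
  refine ⟨C * t ^ (-r), by positivity, fun y hy => (h _ (by positivity)).trans_eq ?_⟩
  rw [Real.div_rpow ht.le hy.le, Real.rpow_neg hy.le, div_inv_eq_mul, mul_assoc]

lemma integrableOn_halfTheta_div_mul_rpow {t s : ℝ} (ht : 0 < t) (hs : 1 / 2 < s) :
    IntegrableOn (fun y => 2 * halfTheta (t / y) * y ^ (-1 - s)) (Set.Ioi 0) := by
  obtain ⟨C, hC, h⟩ := exists_halfTheta_div_le ht (r := s + 1) (by linarith)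
  obtain ⟨C', hC', h'⟩ := exists_halfTheta_div_le ht (r := (1 / 2 + s) / 2) (by linarith)
  have hm : Measurable fun y => 2 * halfTheta (t / y) * y ^ (-1 - s) := by
    have : Measurable fun y => halfTheta (t / y) := measurable_halfTheta.comp (by fun_prop)
    fun_prop
  have key : ∀ y > 0, ∀ K r : ℝ, halfTheta (t / y) ≤ K * y ^ r →
      |2 * halfTheta (t / y) * y ^ (-1 - s)| ≤ 2 * K * y ^ (r - 1 - s) := by
    intro y hy K r hK
    rw [abs_of_nonneg (mul_nonneg (mul_nonneg zero_le_two (halfTheta_nonneg _))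
      (Real.rpow_nonneg hy.le _)), show r - 1 - s = r + (-1 - s) by ring, Real.rpow_add hy]
    have := Real.rpow_nonneg hy.le (-1 - s)
    nlinarith [mul_le_mul_of_nonneg_right hK this]
  refine integrableOn_Ioi_of_le_rpow hm (a := s + 1 - 1 - s) (b := (1 / 2 + s) / 2 - 1 - s) ?_ ?_
    (fun y hy => key y hy _ _ (h y hy)) (fun y hy => key y hy _ _ (h' y hy))
  · linarith
  · linarith

/-- The contribution of the constant term `y^{1-s}` to the theta transform at `t = 1`. -/
def scatteringConstant (s : ℝ) : ℝ :=
  (eisensteinScattering s).toReal * ∫ u in Set.Ioi (0 : ℝ), 2 * halfTheta (1 / u) * u ^ (-1 - s)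

/-- Substitute y = tu: the scattering term contributes a pure power of t, hence only simple rational
terms after a Mellin transform. -/
lemma integral_halfTheta_div_mul_rpow {t s : ℝ} (ht : 0 < t) :
    ∫ y in Set.Ioi (0 : ℝ), 2 * halfTheta (t / y) * y ^ (-1 - s) =
      t ^ (-s) * ∫ u in Set.Ioi (0 : ℝ), 2 * halfTheta (1 / u) * u ^ (-1 - s) := by
  have h := integral_comp_mul_left_Ioi (fun y => 2 * halfTheta (t / y) * y ^ (-1 - s)) 0 ht
  rw [mul_zero, smul_eq_mul, eq_inv_mul_iff_mul_eq₀ ht.ne'] at h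
  rw [← h, ← integral_const_mul, ← integral_const_mul]
  refine setIntegral_congr_fun measurableSet_Ioi fun u hu => ?_
  have hu : 0 < u := hu
  rw [Real.mul_rpow ht.le hu.le, show t / (t * u) = 1 / u by field_simp,
    show -s = 1 + (-1 - s) by ring, Real.rpow_add ht, Real.rpow_one]
  ring

namespace NarainModuli

variable {d : ℕ} (M : NarainModuli d)

lemma integrableOn_halfBPSSum_mul_rpow {α : ℝ} (hα : d < α) :
    IntegrableOn (fun y => y ^ (α - 1) * M.halfBPSSum y) (Set.Ioi 0) := by
  obtain ⟨C, hC, h⟩ := M.exists_nonzeroSum_le (σ := (d + α) / 2) (by linarith)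
  obtain ⟨C', hC', h'⟩ := M.exists_nonzeroSum_le (σ := α + 1) (by linarith)
  have key : ∀ y > 0, ∀ K σ : ℝ, M.nonzeroSum y ≤ K * y ^ (-σ) →
      |y ^ (α - 1) * M.halfBPSSum y| ≤ K * y ^ (α - 1 - σ) := by
    intro y hy K σ hK
    rw [abs_of_nonneg (mul_nonneg (Real.rpow_nonneg hy.le _) (M.halfBPSSum_nonneg _)),
      sub_eq_add_neg _ σ, Real.rpow_add hy]
    have h1 := Real.rpow_nonneg hy.le (α - 1)
    nlinarith [mul_le_mul_of_nonneg_left ((M.halfBPSSum_le_nonzeroSum hy).trans hK) h1]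
  have hm := M.measurable_halfBPSSum
  exact integrableOn_Ioi_of_le_rpow (by fun_prop) (a := α - 1 - (d + α) / 2)
    (b := α - 1 - (α + 1)) (by linarith) (by linarith)
    (fun y hy => key y hy _ _ (h y hy)) (fun y hy => key y hy _ _ (h' y hy))

/-- The half-BPS sum integrated against a theta function. -/
def thetaTransform (t : ℝ) : ℝ :=
  ∫ y in Set.Ioi (0 : ℝ), 2 * halfTheta (t / y) * (y ^ ((d : ℝ) / 2 - 2) * M.halfBPSSum y)

lemma thetaTransform_integrand_le {t r C : ℝ} (ht : 0 < t)
    (h : ∀ x > 0, halfTheta x ≤ C * x ^ (-r)) {y : ℝ} (hy : 0 < y) :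
    |2 * halfTheta (t / y) * (y ^ ((d : ℝ) / 2 - 2) * M.halfBPSSum y)| ≤
      2 * C * t ^ (-r) * (y ^ (r + d / 2 - 1 - 1) * M.halfBPSSum y) := by
  have hb := M.halfBPSSum_nonneg y
  have hy2 := Real.rpow_nonneg hy.le ((d : ℝ) / 2 - 2)
  rw [abs_of_nonneg (mul_nonneg (mul_nonneg zero_le_two (halfTheta_nonneg _))
    (mul_nonneg hy2 hb)), show r + (d : ℝ) / 2 - 1 - 1 = r + (d / 2 - 2) by ring, Real.rpow_add hy]
  have h1 := h (t / y) (by positivity)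
  rw [Real.div_rpow ht.le hy.le, Real.rpow_neg hy.le r, div_inv_eq_mul, ← mul_assoc] at h1
  nlinarith [mul_le_mul_of_nonneg_right h1 (mul_nonneg hy2 hb)]

lemma integrableOn_thetaTransform {t : ℝ} (ht : 0 < t) :
    IntegrableOn (fun y => 2 * halfTheta (t / y) * (y ^ ((d : ℝ) / 2 - 2) * M.halfBPSSum y))
      (Set.Ioi 0) := by
  have hd : (0 : ℝ) ≤ d := Nat.cast_nonneg d
  obtain ⟨C, hC, h⟩ := exists_halfTheta_le (r := d + 2) (by linarith)
  have hm := M.measurable_halfBPSSum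
  have hm' : Measurable fun y => halfTheta (t / y) := measurable_halfTheta.comp (by fun_prop)
  refine Integrable.mono' ((M.integrableOn_halfBPSSum_mul_rpow (α := (d : ℝ) + 2 + d / 2 - 1)
    (by linarith)).const_mul (2 * C * t ^ (-((d : ℝ) + 2)))) (by fun_prop) ?_
  filter_upwards [ae_restrict_mem measurableSet_Ioi] with y hy
  exact M.thetaTransform_integrand_le ht h hy

/-- The condition on r is that y^{r+d/2-2} times the half-BPS sum be integrable. As r is otherwise
arbitrary, Φ decays rapidly at ∞; its behaviour at 0 comes from the functional equation. -/
lemma exists_thetaTransform_le {r : ℝ} (hr : 1 / 2 < r) (hrd : d / 2 + 1 < r) :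
    ∃ C > 0, ∀ t > 0, |M.thetaTransform t| ≤ C * t ^ (-r) := by
  obtain ⟨C, hC, h⟩ := exists_halfTheta_le hr
  have hi := M.integrableOn_halfBPSSum_mul_rpow (α := r + d / 2 - 1) (by linarith)
  set J := ∫ y in Set.Ioi (0 : ℝ), y ^ (r + (d : ℝ) / 2 - 1 - 1) * M.halfBPSSum y with hJ
  have hJ0 : 0 ≤ J := setIntegral_nonneg measurableSet_Ioi fun y hy =>
    mul_nonneg (Real.rpow_nonneg (le_of_lt hy) _) (M.halfBPSSum_nonneg y)
  refine ⟨2 * C * (J + 1), by positivity, fun t ht => ?_⟩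
  have h1 : ‖M.thetaTransform t‖ ≤ ∫ y in Set.Ioi (0 : ℝ),
      2 * C * t ^ (-r) * (y ^ (r + (d : ℝ) / 2 - 1 - 1) * M.halfBPSSum y) :=
    norm_integral_le_of_norm_le (hi.const_mul _) (by
      filter_upwards [ae_restrict_mem measurableSet_Ioi] with y hy
      exact M.thetaTransform_integrand_le ht h hy)
  rw [integral_const_mul, Real.norm_eq_abs] at h1
  have h2 := Real.rpow_nonneg ht.le (-r)
  nlinarith [mul_nonneg hC.le h2]

/-- Both constant terms contain y^{d/2}, one from the zero charge and one from the identity coset,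
and these cancel. -/
lemma integral_subtractedPartition_upperPoint (hd : 3 ≤ d) {y : ℝ} (hy : 0 < y) :
    ∫ x in Set.Ico (-(1 / 2) : ℝ) (1 / 2), M.subtractedPartition (upperPoint (x, y)) =
      ((y ^ ((d : ℝ) / 2) * M.halfBPSSum y -
        (eisensteinScattering ((d : ℝ) / 2)).toReal * y ^ (1 - (d : ℝ) / 2) : ℝ) : ℂ) := by
  set s := (d : ℝ) / 2 with hs'
  have hs : 1 < s := one_lt_half_dim hd
  have hux : Measurable fun x : ℝ => upperPoint (x, y) :=
    measurable_upperPoint.comp (measurable_id.prodMk measurable_const)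
  have hZ : IntegrableOn (fun x => M.latticePartition (upperPoint (x, y)))
      (Set.Ico (-(1 / 2) : ℝ) (1 / 2)) := by
    refine Measure.integrableOn_of_bounded (M := y ^ s + y ^ s * M.nonzeroSum y) (by simp)
      (M.measurable_latticePartition.comp hux).aestronglyMeasurable (ae_of_all _ fun x => ?_)
    have h1 := M.norm_latticePartition_sub_le (upperPoint (x, y))
    rw [upperPoint_im (q := (_, y)) hy, ← hs'] at h1
    calc _ = ‖((y ^ s : ℝ) : ℂ) + (M.latticePartition (upperPoint (x, y)) - ((y ^ s : ℝ) : ℂ))‖ := by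
          rw [add_sub_cancel]
      _ ≤ _ := (norm_add_le _ _).trans (add_le_add (by
          rw [Complex.norm_real, Real.norm_of_nonneg (by positivity)]) h1)
  have hl : ∫⁻ x in Set.Ico (-(1 / 2) : ℝ) (1 / 2), eisenstein s (upperPoint (x, y)) =
      ENNReal.ofReal (y ^ s) + ENNReal.ofReal (y ^ (1 - s)) * eisensteinScattering s := by
    simp only [eisenstein_eq_add, upperPoint_im (q := (_, y)) hy]
    rw [lintegral_add_left measurable_const, lintegral_eisensteinTail hy]
    congr 1
    rw [lintegral_const, Measure.restrict_apply_univ, Real.volume_Ico]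
    norm_num
  have hl' : ∫⁻ x in Set.Ico (-(1 / 2) : ℝ) (1 / 2), eisenstein s (upperPoint (x, y)) ≠ ⊤ := by
    rw [hl]
    exact ENNReal.add_ne_top.mpr ⟨ENNReal.ofReal_ne_top,
      ENNReal.mul_ne_top ENNReal.ofReal_ne_top (eisensteinScattering_ne_top hs)⟩
  have hem : Measurable fun x : ℝ => eisenstein s (upperPoint (x, y)) :=
    (measurable_eisenstein s).comp hux
  have hE : IntegrableOn (fun x => (eisenstein s (upperPoint (x, y))).toReal)
      (Set.Ico (-(1 / 2) : ℝ) (1 / 2)) := integrable_toReal_of_lintegral_ne_top hem.aemeasurable hl'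
  have hEi : ∫ x in Set.Ico (-(1 / 2) : ℝ) (1 / 2), (eisenstein s (upperPoint (x, y))).toReal =
      y ^ s + (eisensteinScattering s).toReal * y ^ (1 - s) := by
    rw [integral_toReal hem.aemeasurable (ae_lt_top hem hl'), hl,
      ENNReal.toReal_add ENNReal.ofReal_ne_top
        (ENNReal.mul_ne_top ENNReal.ofReal_ne_top (eisensteinScattering_ne_top hs)),
      ENNReal.toReal_mul, ENNReal.toReal_ofReal (by positivity), ENNReal.toReal_ofReal (by positivity),
      mul_comm (y ^ (1 - s))]
  have h3 : ∫ x in Set.Ico (-(1 / 2) : ℝ) (1 / 2), M.subtractedPartition (upperPoint (x, y)) =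
      (∫ x in Set.Ico (-(1 / 2) : ℝ) (1 / 2), M.latticePartition (upperPoint (x, y))) -
      ∫ x in Set.Ico (-(1 / 2) : ℝ) (1 / 2), ((eisenstein s (upperPoint (x, y))).toReal : ℂ) :=
    integral_sub hZ hE.ofReal
  rw [h3, integral_complex_ofReal, hEi, M.integral_latticePartition_upperPoint hy]
  push_cast
  ring

lemma integrableOn_torusTheta_smul (hd : 3 ≤ d) {t : ℝ} (ht : 0 < t) :
    IntegrableOn (fun τ => torusTheta t τ • M.subtractedPartition τ) ModularGroup.fdo := by
  obtain ⟨C, hC, h⟩ := exists_torusTheta_le ht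
  refine M.integrableOn_fdo_smul_subtractedPartition hd (measurable_torusTheta t) (C := C)
    fun τ hτ => ?_
  rw [abs_of_nonneg (torusTheta_nonneg t τ)]
  exact h τ hτ

lemma integrableOn_subtractedPartition (hd : 3 ≤ d) :
    IntegrableOn M.subtractedPartition ModularGroup.fdo := by
  simpa only [one_smul] using M.integrableOn_fdo_smul_subtractedPartition hd
    (K := fun _ => 1) measurable_const fun τ hτ => one_le_two_mul_im_rpow hτ

/-- Unfolding of the theta lift of the partition function. -/
lemma integral_torusTheta_smul (hd : 3 ≤ d) {t : ℝ} (ht : 0 < t) :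
    ∫ τ in ModularGroup.fdo, torusTheta t τ • M.subtractedPartition τ =
      M.regularizedIntegral + ((M.thetaTransform t -
        scatteringConstant ((d : ℝ) / 2) * t ^ (-((d : ℝ) / 2)) : ℝ) : ℂ) := by
  have hs := one_lt_half_dim hd
  have hint : IntegrableOn (fun τ => (torusTheta t τ - 1) • M.subtractedPartition τ)
      ModularGroup.fdo := by
    refine ((M.integrableOn_torusTheta_smul hd ht).sub (M.integrableOn_subtractedPartition hd)).congr
      (ae_of_all _ fun τ => ?_)
    simp only [Pi.sub_apply, sub_smul, one_smul]
  have hG : Measurable fun y => ENNReal.ofReal (halfTheta (t / y)) :=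
    (measurable_halfTheta.comp (by fun_prop)).ennreal_ofReal
  have hK : ∀ τ, (∑' p : CoprimePair, ENNReal.ofReal (halfTheta (t / rowIm p.1 τ))).toReal =
      torusTheta t τ - 1 := by
    intro τ
    rw [tsum_halfTheta_rowIm ht, ENNReal.toReal_ofReal (by linarith [one_le_torusTheta ht τ])]
  have hKtop : ∀ τ : ℍ, ∑' p : CoprimePair, ENNReal.ofReal (halfTheta (t / rowIm p.1 τ)) ≠ ⊤ := by
    intro τ
    rw [tsum_halfTheta_rowIm ht]
    exact ENNReal.ofReal_ne_top
  have h1 := integral_fdo_tsum_rowIm_smul M.measurable_subtractedPartition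
    M.subtractedPartition_smul hG (fun _ _ => ENNReal.ofReal_ne_top) hKtop
  have h2 := integrable_strip_of_integrable_fdo M.measurable_subtractedPartition
    M.subtractedPartition_smul hG (fun _ _ => ENNReal.ofReal_ne_top) hKtop (by simpa only [hK])
  have hG2 : ∀ y : ℝ, (2 * ENNReal.ofReal (halfTheta (t / y))).toReal = 2 * halfTheta (t / y) := by
    intro y
    rw [ENNReal.toReal_mul, ENNReal.toReal_ofReal (halfTheta_nonneg _)]
    rfl
  simp only [hK, hG2] at h1 h2
  have h3 : ∀ y ∈ Set.Ioi (0 : ℝ), ((y ^ (-2 : ℝ) : ℝ) : ℂ) *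
      ∫ x in Set.Ico (-(1 / 2) : ℝ) (1 / 2), (2 * halfTheta (t / (upperPoint (x, y)).im)) •
        M.subtractedPartition (upperPoint (x, y)) =
      ((2 * halfTheta (t / y) * (y ^ ((d : ℝ) / 2 - 2) * M.halfBPSSum y) -
        (eisensteinScattering ((d : ℝ) / 2)).toReal *
          (2 * halfTheta (t / y) * y ^ (-1 - (d : ℝ) / 2)) : ℝ) : ℂ) := by
    intro y hy
    have hy : 0 < y := hy
    simp only [upperPoint_im (q := (_, y)) hy]
    rw [integral_smul, M.integral_subtractedPartition_upperPoint hd hy, Complex.real_smul,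
      ← Complex.ofReal_mul, ← Complex.ofReal_mul, sub_eq_add_neg ((d : ℝ) / 2) 2, Real.rpow_add hy,
      show -1 - (d : ℝ) / 2 = (1 - d / 2) + -2 by ring, Real.rpow_add hy]
    congr 1
    ring
  -- The zero vector of the theta series gives the regularized integral; the rest, θ_t - 1, is a sum
  -- over bottom rows and unfolds.
  have h4 : ∫ τ in ModularGroup.fdo, torusTheta t τ • M.subtractedPartition τ =
      M.regularizedIntegral +
        ∫ τ in ModularGroup.fdo, (torusTheta t τ - 1) • M.subtractedPartition τ := by
    rw [regularizedIntegral, ← integral_add (M.integrableOn_subtractedPartition hd) hint]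
    refine integral_congr_ae (ae_of_all _ fun τ => ?_)
    simp only [sub_smul, one_smul, add_sub_cancel]
  rw [h4, h1, integral_verticalStrip h2, setIntegral_congr_fun measurableSet_Ioi h3,
    integral_complex_ofReal, integral_sub (M.integrableOn_thetaTransform ht)
      ((integrableOn_halfTheta_div_mul_rpow ht (by linarith)).const_mul _), integral_const_mul,
    integral_halfTheta_div_mul_rpow ht, scatteringConstant, thetaTransform]
  congr 2
  ring

/-- The functional equation inherited from Poisson resummation of the theta function. -/
lemma thetaTransform_inv (hd : 3 ≤ d) {t : ℝ} (ht : 0 < t) :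
    (M.thetaTransform t⁻¹ : ℂ) = t * M.thetaTransform t + M.regularizedIntegral * (t - 1) -
      scatteringConstant ((d : ℝ) / 2) * ((t ^ (1 - (d : ℝ) / 2) : ℝ) - (t ^ ((d : ℝ) / 2) : ℝ)) := by
  have h1 := M.integral_torusTheta_smul hd ht
  have h2 := M.integral_torusTheta_smul hd (inv_pos.mpr ht)
  -- The integral at 1/t is t times the integral at t; equating the two unfolded expressions gives
  -- the functional equation.
  simp only [torusTheta_inv ht, mul_smul] at h2
  rw [integral_smul, h1, Complex.real_smul, Real.inv_rpow ht.le, Real.rpow_neg ht.le, inv_inv] at h2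
  rw [sub_eq_add_neg 1 ((d : ℝ) / 2), Real.rpow_add ht, Real.rpow_one, Real.rpow_neg ht.le]
  push_cast at h2 ⊢
  linear_combination -h2

end NarainModuli

/-! ### Mellin transforms -/

/-- The Mellin transform of a multiplicative convolution, in additive normalization. -/
lemma integral_integral_div_mul {G H : ℝ → ℂ} (hG : Measurable G) (hH : Measurable H)
    (hGi : IntegrableOn G (Set.Ioi 0)) (hHi : IntegrableOn (fun y : ℝ => (y : ℂ) * H y) (Set.Ioi 0)) :
    ∫ t in Set.Ioi (0 : ℝ), ∫ y in Set.Ioi (0 : ℝ), G (t / y) * H y =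
      (∫ u in Set.Ioi (0 : ℝ), G u) * ∫ y in Set.Ioi (0 : ℝ), (y : ℂ) * H y := by
  have hscale : ∀ (F : ℝ → ℂ), ∀ y > 0, ∫ t in Set.Ioi (0 : ℝ), F (t / y) =
      (y : ℂ) * ∫ u in Set.Ioi (0 : ℝ), F u := by
    intro F y hy
    have h := integral_comp_mul_right_Ioi F 0 (inv_pos.mpr hy)
    rw [zero_mul, inv_inv, Complex.real_smul] at h
    simpa only [div_eq_mul_inv] using h
  have hm : Measurable fun q : ℝ × ℝ => G (q.1 / q.2) * H q.2 :=
    (hG.comp (measurable_fst.div measurable_snd)).mul (hH.comp measurable_snd)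
  have hint : Integrable (fun q : ℝ × ℝ => G (q.1 / q.2) * H q.2)
      ((volume.restrict (Set.Ioi 0)).prod (volume.restrict (Set.Ioi 0))) := by
    rw [integrable_prod_iff' hm.aestronglyMeasurable]
    constructor
    · filter_upwards [ae_restrict_mem measurableSet_Ioi] with y hy
      have h := (integrableOn_Ioi_comp_mul_right_iff G 0 (inv_pos.mpr hy)).mpr (by rwa [zero_mul])
      simp only [← div_eq_mul_inv] at h
      exact h.mul_const _
    · refine (hHi.norm.mul_const (∫ u in Set.Ioi (0 : ℝ), ‖G u‖)).congr ?_
      filter_upwards [ae_restrict_mem measurableSet_Ioi] with y hy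
      have hy : 0 < y := hy
      have h := integral_comp_mul_right_Ioi (fun u => ‖G u‖) 0 (inv_pos.mpr hy)
      rw [zero_mul, inv_inv, smul_eq_mul] at h
      simp only [norm_mul, ← div_eq_mul_inv] at h ⊢
      rw [integral_mul_const, h, Complex.norm_real, Real.norm_of_nonneg hy.le]
      ring
  rw [integral_integral_swap hint, ← integral_const_mul]
  refine setIntegral_congr_fun measurableSet_Ioi fun y hy => ?_
  rw [integral_mul_const, hscale G y hy]
  ring

lemma integrableOn_Ioi_cpow_mul_of_le_rpow {f : ℝ → ℝ} (hf : Measurable f) {w : ℂ} {a b C C' : ℝ}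
    (ha : a < w.re) (hb : w.re < b) (h0 : ∀ y > 0, |f y| ≤ C * y ^ (-a))
    (h1 : ∀ y > 0, |f y| ≤ C' * y ^ (-b)) : MellinConvergent (fun t => (f t : ℂ)) w := by
  have hm : Measurable fun y : ℝ => y ^ (w.re - 1) * f y := by fun_prop
  have key : ∀ y > 0, ∀ K r : ℝ, |f y| ≤ K * y ^ (-r) →
      |y ^ (w.re - 1) * f y| ≤ K * y ^ (w.re - 1 - r) := by
    intro y hy K r hK
    rw [abs_mul, abs_of_nonneg (Real.rpow_nonneg hy.le _), sub_eq_add_neg _ r, Real.rpow_add hy]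
    nlinarith [mul_le_mul_of_nonneg_left hK (Real.rpow_nonneg hy.le (w.re - 1))]
  have hi := integrableOn_Ioi_of_le_rpow hm (a := w.re - 1 - a) (b := w.re - 1 - b) (by linarith)
    (by linarith) (fun y hy => key y hy _ _ (h0 y hy)) (fun y hy => key y hy _ _ (h1 y hy))
  refine Integrable.mono hi (by fun_prop) ?_
  filter_upwards [ae_restrict_mem measurableSet_Ioi] with y hy
  rw [norm_smul, norm_mul, Complex.norm_cpow_eq_rpow_re_of_pos hy, Complex.norm_real,
    Real.norm_of_nonneg (Real.rpow_nonneg (le_of_lt hy) _), Complex.sub_re, Complex.one_re]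

lemma mellinConvergent_halfTheta {w : ℂ} (hw : 1 / 2 < w.re) :
    MellinConvergent (fun t => (halfTheta t : ℂ)) w := by
  obtain ⟨C, -, h⟩ := exists_halfTheta_le (r := (1 / 2 + w.re) / 2) (by linarith)
  obtain ⟨C', -, h'⟩ := exists_halfTheta_le (r := w.re + 1) (by linarith)
  refine integrableOn_Ioi_cpow_mul_of_le_rpow measurable_halfTheta (a := (1 / 2 + w.re) / 2)
    (C := C) (C' := C') (b := w.re + 1) (by linarith) (by linarith) (fun y hy => ?_) (fun y hy => ?_)
  · rw [abs_of_nonneg (halfTheta_nonneg y)]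
    exact h y hy
  · rw [abs_of_nonneg (halfTheta_nonneg y)]
    exact h' y hy

/-- Termwise, the Mellin transform is π^{-w}Γ(w) ∑ (k+1)^{-2w}, the completed zeta function at 2w.
-/
lemma mellin_halfTheta {w : ℂ} (hw : 1 / 2 < w.re) :
    mellin (fun t => (halfTheta t : ℂ)) w = completedRiemannZeta (2 * w) := by
  have hF : ∀ t ∈ Set.Ioi (0 : ℝ), HasSum (fun k : ℕ => (1 : ℂ) *
      (Real.exp (-Real.pi * ((k : ℝ) + 1) ^ 2 * t) : ℝ)) (halfTheta t : ℂ) := by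
    intro t ht
    simp only [one_mul]
    exact Complex.hasSum_ofReal.mpr (summable_halfTheta ht).hasSum
  have hsum : Summable fun k : ℕ => ‖(1 : ℂ)‖ / (((k : ℝ) + 1) ^ 2) ^ w.re := by
    have h := (Real.summable_nat_rpow (p := -(2 * w.re))).mpr (by linarith)
    have h := (summable_nat_add_iff 1).mpr h
    refine h.congr fun k => ?_
    have hk : (0 : ℝ) ≤ (k : ℝ) + 1 := by positivity
    rw [norm_one, ← Real.rpow_natCast, ← Real.rpow_mul hk, one_div, ← Real.rpow_neg hk]
    push_cast
    rfl
  have h := hasSum_mellin_pi_mul (a := fun _ => 1) (q := fun k : ℕ => ((k : ℝ) + 1) ^ 2)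
    (fun k => Or.inr (by positivity)) (by linarith) hF hsum
  have hre : (2 * w).re = 2 * w.re := by simp
  have h0 : 2 * w ≠ 0 := fun h0 => by
    rw [h0, Complex.zero_re] at hre
    linarith
  have hζ : completedRiemannZeta (2 * w) = Complex.Gammaℝ (2 * w) * riemannZeta (2 * w) := by
    rw [riemannZeta_def_of_ne_zero h0,
      mul_div_cancel₀ _ (Complex.Gammaℝ_ne_zero_of_re_pos (by linarith))]
  rw [← h.tsum_eq, hζ, Complex.Gammaℝ_def, zeta_eq_tsum_one_div_nat_add_one_cpow (by linarith),
    ← tsum_mul_left]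
  refine tsum_congr fun k => ?_
  have hk : (0 : ℝ) ≤ (k : ℝ) + 1 := by positivity
  rw [show -(2 * w) / 2 = -w by ring, show 2 * w / 2 = w by ring, mul_one_div, mul_one]
  congr 1
  have h2 : ((k : ℂ) + 1) ^ (2 * w) = (((k : ℂ) + 1) ^ 2) ^ w := by
    rw [show 2 * w = ((2 : ℕ) : ℂ) * w by push_cast; ring, Complex.cpow_nat_mul']
    · rw [← Nat.cast_add_one, Complex.natCast_arg]
      simpa using Real.pi_pos
    · rw [← Nat.cast_add_one, Complex.natCast_arg]
      simpa using Real.pi_pos.le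
  rw [h2]
  push_cast
  rfl

namespace NarainModuli

variable {d : ℕ} (M : NarainModuli d)

lemma mellinConvergent_halfBPSSum {z : ℂ} (hz : d < z.re) :
    MellinConvergent (fun t => (M.halfBPSSum t : ℂ)) z := by
  obtain ⟨C, -, h⟩ := M.exists_nonzeroSum_le (σ := (d + z.re) / 2) (by linarith)
  obtain ⟨C', -, h'⟩ := M.exists_nonzeroSum_le (σ := z.re + 1) (by linarith)
  refine integrableOn_Ioi_cpow_mul_of_le_rpow M.measurable_halfBPSSum (a := (d + z.re) / 2)
    (C := C) (C' := C') (b := z.re + 1) (by linarith) (by linarith) (fun y hy => ?_) (fun y hy => ?_)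
  · rw [abs_of_nonneg (M.halfBPSSum_nonneg y)]
    exact (M.halfBPSSum_le_nonzeroSum hy).trans (h y hy)
  · rw [abs_of_nonneg (M.halfBPSSum_nonneg y)]
    exact (M.halfBPSSum_le_nonzeroSum hy).trans (h' y hy)

/-- Each charge contributes π^{-z}Γ(z) times its mass squared to the power -z; absolute convergence
for Re z > d permits the interchange. -/
lemma hasSum_mellin_halfBPSSum {z : ℂ} (hz : d < z.re) :
    HasSum (fun p : HalfBPSCharge d => ((M.massSq p.1 : ℝ) : ℂ) ^ (-z))
      ((Real.pi : ℂ) ^ z * (Complex.Gamma z)⁻¹ * mellin (fun t => (M.halfBPSSum t : ℂ)) z) := by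
  have hz0 : 0 < z.re := (Nat.cast_nonneg d).trans_lt hz
  have hF : ∀ t ∈ Set.Ioi (0 : ℝ), HasSum (fun p : HalfBPSCharge d => (1 : ℂ) *
      (Real.exp (-Real.pi * M.massSq p.1 * t) : ℝ)) (M.halfBPSSum t : ℂ) := by
    intro t ht
    simp only [one_mul, mul_right_comm _ _ t]
    exact Complex.hasSum_ofReal.mpr (M.summable_halfBPS ht).hasSum
  have hsum : Summable fun p : HalfBPSCharge d => ‖(1 : ℂ)‖ / M.massSq p.1 ^ z.re := by
    have hi : Function.Injective fun p : HalfBPSCharge d =>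
        (⟨p.1, p.2.1⟩ : {p : NarainCharge d // p ≠ 0}) := fun a b h =>
      Subtype.ext (congrArg (fun q : {p : NarainCharge d // p ≠ 0} => q.1) h)
    refine ((M.summable_massSq_rpow hz).comp_injective hi).congr fun p => ?_
    rw [norm_one, one_div, Function.comp_apply, Real.rpow_neg (M.massSq_nonneg _)]
  have h := hasSum_mellin_pi_mul (a := fun _ => 1) (q := fun p : HalfBPSCharge d => M.massSq p.1)
    (fun p => Or.inr (M.massSq_pos p.2.1)) hz0 hF hsum
  have hπ : (Real.pi : ℂ) ≠ 0 := Complex.ofReal_ne_zero.mpr Real.pi_ne_zero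
  have hπz : (Real.pi : ℂ) ^ z ≠ 0 := by simp [Complex.cpow_eq_zero_iff, hπ]
  have hΓ : Complex.Gamma z ≠ 0 := Complex.Gamma_ne_zero_of_re_pos hz0
  refine (h.mul_left ((Real.pi : ℂ) ^ z * (Complex.Gamma z)⁻¹)).congr_fun fun p => ?_
  rw [Complex.cpow_neg, Complex.cpow_neg]
  field_simp

lemma measurable_thetaTransform : Measurable M.thetaTransform := by
  have hm := M.measurable_halfBPSSum
  have hm' : Measurable fun q : ℝ × ℝ => halfTheta (q.1 / q.2) :=
    measurable_halfTheta.comp (measurable_fst.div measurable_snd)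
  have h : Measurable fun q : ℝ × ℝ =>
      2 * halfTheta (q.1 / q.2) * (q.2 ^ ((d : ℝ) / 2 - 2) * M.halfBPSSum q.2) := by fun_prop
  exact h.stronglyMeasurable.integral_prod_right.measurable

/-- Φ is a multiplicative convolution, so its Mellin transform factors. The weight y^{d/2-2},
together with the Jacobian y of t = uy, shifts the argument from w to z = w + d/2 - 1. -/
lemma mellin_thetaTransform {z : ℂ} (hz : d < z.re) :
    mellin (fun t => (M.thetaTransform t : ℂ)) (z - d / 2 + 1) =
      2 * completedRiemannZeta (2 * (z - d / 2 + 1)) *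
        mellin (fun t => (M.halfBPSSum t : ℂ)) z := by
  set w : ℂ := z - d / 2 + 1 with hw
  have hre : w.re = z.re - d / 2 + 1 := by simp [hw]
  have hw2 : 1 / 2 < w.re := by
    rw [hre]
    linarith [Nat.cast_nonneg (α := ℝ) d]
  set G : ℝ → ℂ := fun u => (u : ℂ) ^ (w - 1) • (halfTheta u : ℂ) with hGdef
  set H : ℝ → ℂ := fun y => 2 * ((y : ℂ) ^ (z - 2) * (M.halfBPSSum y : ℂ)) with hHdef
  have hm := M.measurable_halfBPSSum
  have hm' := measurable_halfTheta
  have hyH : ∀ y ∈ Set.Ioi (0 : ℝ), (y : ℂ) * H y =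
      2 * ((y : ℂ) ^ (z - 1) • (M.halfBPSSum y : ℂ)) := by
    intro y hy
    have hy : (y : ℂ) ≠ 0 := Complex.ofReal_ne_zero.mpr (ne_of_gt hy)
    rw [hHdef, show z - 1 = 1 + (z - 2) by ring, Complex.cpow_add _ _ hy, Complex.cpow_one,
      smul_eq_mul]
    ring
  have key := integral_integral_div_mul (G := G) (H := H) (by fun_prop) (by fun_prop)
    (mellinConvergent_halfTheta hw2)
    (IntegrableOn.congr_fun ((M.mellinConvergent_halfBPSSum hz).const_mul 2)
      (fun y hy => (hyH y hy).symm) measurableSet_Ioi)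
  rw [setIntegral_congr_fun measurableSet_Ioi hyH, integral_const_mul] at key
  calc mellin (fun t => (M.thetaTransform t : ℂ)) w
      = ∫ t in Set.Ioi (0 : ℝ), ∫ y in Set.Ioi (0 : ℝ), G (t / y) * H y := by
        refine setIntegral_congr_fun measurableSet_Ioi fun t ht => ?_
        have ht : 0 < t := ht
        simp only [thetaTransform]
        rw [← integral_complex_ofReal, smul_eq_mul, ← integral_const_mul]
        refine setIntegral_congr_fun measurableSet_Ioi fun y hy => ?_
        have hy : 0 < y := hy
        have hy' : (y : ℂ) ≠ 0 := Complex.ofReal_ne_zero.mpr hy.ne'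
        simp only [hGdef, hHdef, smul_eq_mul]
        have hdiv : ((t / y : ℝ) : ℂ) ^ (w - 1) = (t : ℂ) ^ (w - 1) / (y : ℂ) ^ (w - 1) := by
          rw [div_eq_mul_inv, Complex.ofReal_mul,
            Complex.mul_cpow_ofReal_nonneg ht.le (inv_pos.mpr hy).le, Complex.ofReal_inv,
            Complex.inv_cpow _ _ (by
              rw [Complex.arg_ofReal_of_nonneg hy.le]; exact Real.pi_pos.ne), div_eq_mul_inv]
        rw [hdiv, show z - 2 = (w - 1) + (((d : ℝ) / 2 - 2 : ℝ) : ℂ) by rw [hw]; push_cast; ring,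
          Complex.cpow_add _ _ hy', ← Complex.ofReal_cpow hy.le, Complex.ofReal_mul, Complex.ofReal_mul, Complex.ofReal_mul, Complex.ofReal_ofNat]
        have : (y : ℂ) ^ (w - 1) ≠ 0 := by simp [Complex.cpow_eq_zero_iff, hy']
        field_simp
    _ = _ := by
        rw [key, ← mellin_halfTheta hw2]
        simp only [mellin, hGdef]
        ring

end NarainModuli

/-! ### Meromorphic continuation of the vector Eisenstein series -/

lemma HasMellin.mellin_eq_of_ae {f g : ℝ → ℂ} {w m : ℂ} (hg : HasMellin g w m)
    (h : ∀ᵐ t, 0 < t → f t = g t) : mellin f w = m := by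
  rw [← hg.2]
  refine setIntegral_congr_ae measurableSet_Ioi ?_
  filter_upwards [h] with t ht ht0
  rw [ht ht0]

namespace NarainModuli

variable {d : ℕ} (M : NarainModuli d)

/-- The theta transform cut off to arguments larger than one. -/
def thetaTransformTail (t : ℝ) : ℂ := Set.indicator (Set.Ioi 1) (fun t => (M.thetaTransform t : ℂ)) t

lemma norm_thetaTransformTail_le (t : ℝ) : ‖M.thetaTransformTail t‖ ≤ |M.thetaTransform t| := by
  refine (norm_indicator_le_norm_self _ _).trans_eq ?_
  rw [Complex.norm_real, Real.norm_eq_abs]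

lemma locallyIntegrable_thetaTransformTail : LocallyIntegrable M.thetaTransformTail := by
  have hd : (0 : ℝ) ≤ d := Nat.cast_nonneg d
  obtain ⟨C, hC, h⟩ := M.exists_thetaTransform_le (r := d / 2 + 2) (by linarith) (by linarith)
  refine Integrable.locallyIntegrable ?_
  have h1 : IntegrableOn (fun t => (M.thetaTransform t : ℂ)) (Set.Ioi 1) := by
    refine Integrable.mono' ((integrableOn_Ioi_rpow_of_lt (a := -((d : ℝ) / 2 + 2)) (c := 1)
      (by linarith) one_pos).const_mul C)
      (Complex.measurable_ofReal.comp M.measurable_thetaTransform).aestronglyMeasurable ?_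
    filter_upwards [ae_restrict_mem measurableSet_Ioi] with t ht
    rw [Complex.norm_real]
    exact h t (one_pos.trans ht)
  exact (integrable_indicator_iff measurableSet_Ioi).mpr h1

lemma thetaTransformTail_isBigO_atTop {r : ℝ} (hr : 1 / 2 < r) (hrd : d / 2 + 1 < r) :
    M.thetaTransformTail =O[atTop] fun t : ℝ => t ^ (-r) := by
  obtain ⟨C, hC, h⟩ := M.exists_thetaTransform_le hr hrd
  refine Asymptotics.IsBigO.of_bound C ?_
  filter_upwards [eventually_gt_atTop 0] with t ht
  rw [Real.norm_of_nonneg (Real.rpow_nonneg ht.le _)]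
  exact (M.norm_thetaTransformTail_le t).trans (h t ht)

lemma thetaTransformTail_isBigO_zero (r : ℝ) :
    M.thetaTransformTail =O[𝓝[>] 0] fun t : ℝ => t ^ r := by
  refine Asymptotics.IsBigO.of_bound 1 ?_
  filter_upwards [Ioo_mem_nhdsGT (zero_lt_one (α := ℝ))] with t ht
  rw [thetaTransformTail, Set.indicator_of_notMem (fun h : t ∈ Set.Ioi (1 : ℝ) => lt_asymm ht.2 h), norm_zero]
  positivity

lemma mellinConvergent_thetaTransformTail (w : ℂ) : MellinConvergent M.thetaTransformTail w := by
  have hd : (0 : ℝ) ≤ d := Nat.cast_nonneg d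
  have h1 := le_abs_self w.re
  have h0 := abs_nonneg w.re
  exact mellinConvergent_of_isBigO_rpow (a := |w.re| + d / 2 + 2) (b := w.re - 1)
    (M.locallyIntegrable_thetaTransformTail.locallyIntegrableOn _)
    (M.thetaTransformTail_isBigO_atTop (by linarith) (by linarith)) (by linarith)
    (M.thetaTransformTail_isBigO_zero _) (by linarith)

lemma differentiable_mellin_thetaTransformTail :
    Differentiable ℂ (mellin M.thetaTransformTail) := by
  intro w
  have hd : (0 : ℝ) ≤ d := Nat.cast_nonneg d
  have h1 := le_abs_self w.re
  have h0 := abs_nonneg w.re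
  exact mellin_differentiableAt_of_isBigO_rpow (a := |w.re| + d / 2 + 2) (b := w.re - 1)
    (M.locallyIntegrable_thetaTransformTail.locallyIntegrableOn _)
    (M.thetaTransformTail_isBigO_atTop (by linarith) (by linarith)) (by linarith)
    (M.thetaTransformTail_isBigO_zero _) (by linarith)

/-- For t < 1 this is the functional equation at 1/t, for t > 1 only the tail is left. At t = 1 both
tails vanish and the formula may fail, which is harmless under an integral. -/
lemma thetaTransform_eq_add (hd : 3 ≤ d) {t : ℝ} (ht : 0 < t) (ht1 : t ≠ 1) :
    (M.thetaTransform t : ℂ) = M.thetaTransformTail t +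
      (t : ℂ) ^ (-1 : ℂ) • M.thetaTransformTail t⁻¹ +
      (M.regularizedIntegral • (Set.indicator (Set.Ioc 0 1) (fun t : ℝ => (t : ℂ) ^ (-1 : ℂ)) t -
          Set.indicator (Set.Ioc 0 1) (fun t : ℝ => (t : ℂ) ^ (0 : ℂ)) t) -
        (scatteringConstant ((d : ℝ) / 2) : ℂ) •
          (Set.indicator (Set.Ioc 0 1) (fun t : ℝ => (t : ℂ) ^ ((d : ℂ) / 2 - 1)) t -
            Set.indicator (Set.Ioc 0 1) (fun t : ℝ => (t : ℂ) ^ (-((d : ℂ) / 2))) t)) := by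
  rcases lt_or_gt_of_ne ht1 with h1 | h1
  · have hinv : t⁻¹ ∈ Set.Ioi (1 : ℝ) := (one_lt_inv₀ ht).mpr h1
    have hIoc : t ∈ Set.Ioc (0 : ℝ) 1 := ⟨ht, h1.le⟩
    simp only [thetaTransformTail, Set.indicator_of_mem hinv, Set.indicator_of_mem hIoc,
      Set.indicator_of_notMem (fun h : t ∈ Set.Ioi (1 : ℝ) => lt_asymm h1 h), smul_eq_mul]
    have h2 := M.thetaTransform_inv hd (inv_pos.mpr ht)
    rw [inv_inv, Real.inv_rpow ht.le, Real.inv_rpow ht.le, ← Real.rpow_neg ht.le,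
      ← Real.rpow_neg ht.le] at h2
    rw [h2, Complex.cpow_neg_one, Complex.cpow_zero, Complex.ofReal_cpow ht.le,
      Complex.ofReal_cpow ht.le]
    push_cast
    rw [neg_sub]
    ring
  · have hinv : t⁻¹ ∉ Set.Ioi (1 : ℝ) := fun h => lt_asymm h (inv_lt_one_of_one_lt₀ h1)
    have hIoc : t ∉ Set.Ioc (0 : ℝ) 1 := fun h => h1.not_ge h.2
    simp only [thetaTransformTail, Set.indicator_of_notMem hinv, Set.indicator_of_notMem hIoc,
      Set.indicator_of_mem (show t ∈ Set.Ioi (1 : ℝ) from h1)]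
    simp

/-- The meromorphic continuation of the Mellin transform of the theta transform, multiplied by
its argument. -/
def completedNumerator (w : ℂ) : ℂ :=
  w * (mellin M.thetaTransformTail w + mellin M.thetaTransformTail (1 - w)) +
    M.regularizedIntegral * (w / (w - 1) - 1) -
    scatteringConstant ((d : ℝ) / 2) * (w / (w + (d / 2 - 1)) - w / (w - d / 2))

/-- Riemann's splitting at t = 1: the two tails give Mellin transforms at w and 1 - w, and the
powers of t on (0,1] give simple fractions. The factor w clears the pole at w = 0, where the value
is wanted. -/
lemma mul_mellin_thetaTransform (hd : 3 ≤ d) {w : ℂ} (hw : d / 2 + 1 < w.re) :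
    w * mellin (fun t => (M.thetaTransform t : ℂ)) w = M.completedNumerator w := by
  have hs := one_lt_half_dim hd
  have hdre : ((d : ℂ) / 2).re = d / 2 := by simp
  have hw0 : w ≠ 0 := fun h => by
    rw [h, Complex.zero_re] at hw
    linarith
  have e1 := hasMellin_cpow_Ioc (-1) (s := w) (by simp; linarith)
  have e2 := hasMellin_cpow_Ioc 0 (s := w) (by simp; linarith)
  have e3 := hasMellin_cpow_Ioc ((d : ℂ) / 2 - 1) (s := w) (by
    rw [Complex.sub_re, hdre, Complex.one_re]; linarith)
  have e4 := hasMellin_cpow_Ioc (-((d : ℂ) / 2)) (s := w) (by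
    rw [Complex.neg_re, hdre]; linarith)
  have e12 := hasMellin_sub e1.1 e2.1
  have e34 := hasMellin_sub e3.1 e4.1
  have f12 := hasMellin_const_smul e12.1 M.regularizedIntegral
  have f34 := hasMellin_const_smul e34.1 (scatteringConstant ((d : ℝ) / 2) : ℂ)
  have f := hasMellin_sub f12.1 f34.1
  have g1 : MellinConvergent (fun t => M.thetaTransformTail t⁻¹) (w + -1) := by
    have h := (MellinConvergent.comp_rpow (f := M.thetaTransformTail) (s := w + -1)
      (a := -1) (by norm_num)).mpr (M.mellinConvergent_thetaTransformTail _)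
    simpa only [Real.rpow_neg_one] using h
  have g2 : MellinConvergent (fun t : ℝ => (t : ℂ) ^ (-1 : ℂ) • M.thetaTransformTail t⁻¹) w :=
    MellinConvergent.cpow_smul.mpr g1
  have g2' : mellin (fun t : ℝ => (t : ℂ) ^ (-1 : ℂ) • M.thetaTransformTail t⁻¹) w =
      mellin M.thetaTransformTail (1 - w) := by
    rw [mellin_cpow_smul, mellin_comp_inv]
    congr 1
    ring
  have g3 := hasMellin_add (M.mellinConvergent_thetaTransformTail w) g2
  have g := hasMellin_add g3.1 f.1
  have hcongr := g.mellin_eq_of_ae (f := fun t => (M.thetaTransform t : ℂ)) (by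
    filter_upwards [Measure.ae_ne volume (1 : ℝ)] with t ht1 ht
      using M.thetaTransform_eq_add hd ht ht1)
  rw [hcongr, g3.2, f.2, f12.2, f34.2, e12.2, e34.2, e1.2, e2.2, e3.2, e4.2, g2',
    completedNumerator]
  simp only [smul_eq_mul, add_zero, ← sub_eq_add_neg]
  have : w * (1 / w) = 1 := mul_one_div_cancel hw0
  linear_combination (-M.regularizedIntegral) * this

/-- `2 w` times the completed Riemann zeta function at `2 w`. -/
def zetaDenominator (w : ℂ) : ℂ := 2 * w * completedRiemannZeta₀ (2 * w) - 1 - 2 * w / (1 - 2 * w)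

lemma zetaDenominator_eq {w : ℂ} (hw : w ≠ 0) :
    zetaDenominator w = w * (2 * completedRiemannZeta (2 * w)) := by
  rw [zetaDenominator, completedRiemannZeta_eq]
  field_simp

/-- The vector Eisenstein series. -/
def vectorEisenstein (z : ℂ) : ℂ :=
  (Real.pi : ℂ) ^ z * (Complex.Gamma z)⁻¹ *
    (M.completedNumerator (z - d / 2 + 1) / zetaDenominator (z - d / 2 + 1))

/-- For Re z > d the argument 2w has real part above 1, where zeta has no zeros, so the zeta factor
of the Mellin transform may be divided out. -/
lemma hasSum_vectorEisenstein (hd : 3 ≤ d) {z : ℂ} (hz : d < z.re) :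
    HasSum (fun p : HalfBPSCharge d => ((M.massSq p.1 : ℝ) : ℂ) ^ (-z)) (M.vectorEisenstein z) := by
  have hs := one_lt_half_dim hd
  have hre : (z - d / 2 + 1).re = z.re - d / 2 + 1 := by simp
  have hw0 : z - d / 2 + 1 ≠ 0 := fun h => by
    rw [h, Complex.zero_re] at hre
    linarith
  have hζ : completedRiemannZeta (2 * (z - d / 2 + 1)) ≠ 0 := by
    intro h
    have h1 : 1 ≤ (2 * (z - d / 2 + 1)).re := by
      have h2 : ∀ x : ℂ, (2 * x).re = 2 * x.re := fun x => by simp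
      rw [h2, hre]
      linarith
    apply riemannZeta_ne_zero_of_one_le_re h1
    rw [riemannZeta_def_of_ne_zero (mul_ne_zero two_ne_zero hw0), h, zero_div]
  have h := M.hasSum_mellin_halfBPSSum hz
  rw [vectorEisenstein, ← M.mul_mellin_thetaTransform hd (by rw [hre]; linarith),
    zetaDenominator_eq hw0, mul_div_mul_left _ _ hw0, M.mellin_thetaTransform hz,
    mul_div_cancel_left₀ _ (mul_ne_zero two_ne_zero hζ)]
  exact h

lemma differentiable_completedNumerator_entire : Differentiable ℂ fun w =>
    w * (mellin M.thetaTransformTail w + mellin M.thetaTransformTail (1 - w)) := by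
  have h := M.differentiable_mellin_thetaTransformTail
  have h' : Differentiable ℂ fun w : ℂ => mellin M.thetaTransformTail (1 - w) :=
    h.comp (differentiable_id.const_sub 1)
  exact differentiable_id.mul (h.add h')

lemma meromorphic_completedNumerator : Meromorphic M.completedNumerator := by
  intro w
  have h := (M.differentiable_completedNumerator_entire.analyticAt w).meromorphicAt
  have h1 : MeromorphicAt (fun w : ℂ => M.regularizedIntegral * (w / (w - 1) - 1)) w := by fun_prop
  have h2 : MeromorphicAt (fun w : ℂ => (scatteringConstant ((d : ℝ) / 2) : ℂ) *
    (w / (w + (d / 2 - 1)) - w / (w - d / 2))) w := by fun_prop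
  exact (h.add h1).sub h2

lemma differentiable_two_mul_completedZeta₀ : Differentiable ℂ fun w : ℂ =>
    2 * w * completedRiemannZeta₀ (2 * w) - 1 :=
  ((differentiable_id.const_mul 2).mul
    (differentiable_completedZeta₀.comp (differentiable_id.const_mul 2))).sub_const 1

lemma meromorphic_zetaDenominator : Meromorphic zetaDenominator := by
  intro w
  have h := (differentiable_two_mul_completedZeta₀.analyticAt w).meromorphicAt
  have h1 : MeromorphicAt (fun w : ℂ => 2 * w / (1 - 2 * w)) w := by fun_prop
  exact h.sub h1

lemma differentiable_pi_cpow_mul_inv_Gamma :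
    Differentiable ℂ fun z : ℂ => (Real.pi : ℂ) ^ z * (Complex.Gamma z)⁻¹ := by
  refine Differentiable.mul (fun z => ?_) Complex.differentiable_one_div_Gamma
  exact (differentiableAt_id).const_cpow (Or.inl (Complex.ofReal_ne_zero.mpr Real.pi_ne_zero))

/-- The poles that remain are at w = 1, 1 - d/2 and d/2, all away from 0 since d ≥ 3. -/
lemma analyticAt_completedNumerator (hd : 3 ≤ d) : AnalyticAt ℂ M.completedNumerator 0 := by
  have hs := one_lt_half_dim hd
  have h := M.differentiable_completedNumerator_entire.analyticAt 0
  have hd0 : (d : ℂ) / 2 ≠ 0 := by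
    have : (d : ℂ) ≠ 0 := Nat.cast_ne_zero.mpr (by omega)
    simpa using this
  have hd1 : (d : ℂ) / 2 - 1 ≠ 0 := by
    intro h0
    have h1 := congrArg Complex.re h0
    simp at h1
    linarith
  have h1 : AnalyticAt ℂ (fun w : ℂ => M.regularizedIntegral * (w / (w - 1) - 1)) 0 :=
    analyticAt_const.mul ((analyticAt_id.div (analyticAt_id.sub analyticAt_const) (by simp)).sub
      analyticAt_const)
  have h2 : AnalyticAt ℂ (fun w : ℂ => (scatteringConstant ((d : ℝ) / 2) : ℂ) *
      (w / (w + (d / 2 - 1)) - w / (w - d / 2))) 0 :=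
    analyticAt_const.mul ((analyticAt_id.div (analyticAt_id.add analyticAt_const)
      (by simpa using hd1)).sub (analyticAt_id.div (analyticAt_id.sub analyticAt_const)
      (by simpa using hd0)))
  exact (h.add h1).sub h2

lemma analyticAt_zetaDenominator : AnalyticAt ℂ zetaDenominator 0 :=
  (differentiable_two_mul_completedZeta₀.analyticAt 0).sub
    ((analyticAt_const.mul analyticAt_id).div
      (analyticAt_const.sub (analyticAt_const.mul analyticAt_id)) (by simp))

lemma meromorphic_vectorEisenstein : Meromorphic M.vectorEisenstein := by
  intro z
  have h0 : AnalyticAt ℂ (fun z : ℂ => z - d / 2 + 1) z := by fun_prop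
  have h1 : MeromorphicAt (fun z : ℂ => M.completedNumerator (z - d / 2 + 1)) z :=
    (M.meromorphic_completedNumerator _).comp_analyticAt (g := fun z : ℂ => z - d / 2 + 1) h0
  have h2 : MeromorphicAt (fun z : ℂ => zetaDenominator (z - d / 2 + 1)) z :=
    (meromorphic_zetaDenominator _).comp_analyticAt (g := fun z : ℂ => z - d / 2 + 1) h0
  exact (differentiable_pi_cpow_mul_inv_Gamma.analyticAt z).meromorphicAt.mul (h1.div h2)

lemma isVectorEisenstein (hd : 3 ≤ d) : M.IsVectorEisenstein M.vectorEisenstein :=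
  ⟨M.meromorphic_vectorEisenstein, fun _ hz => M.hasSum_vectorEisenstein hd hz⟩

/-- The completed zeta function has residue -1 at 0; in particular the denominator does not vanish
at the point of interest. -/
lemma zetaDenominator_zero : zetaDenominator 0 = -1 := by simp [zetaDenominator]

lemma completedNumerator_zero : M.completedNumerator 0 = -M.regularizedIntegral := by
  simp [completedNumerator]

lemma analyticAt_vectorEisenstein (hd : 3 ≤ d) :
    AnalyticAt ℂ M.vectorEisenstein ((d : ℂ) / 2 - 1) := by
  have h0 : AnalyticAt ℂ (fun z : ℂ => z - d / 2 + 1) ((d : ℂ) / 2 - 1) := by fun_prop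
  have hz : (d : ℂ) / 2 - 1 - d / 2 + 1 = 0 := by ring
  have h1 : AnalyticAt ℂ (fun z : ℂ => M.completedNumerator (z - d / 2 + 1)) ((d : ℂ) / 2 - 1) :=
    AnalyticAt.fun_comp (by rw [hz]; exact M.analyticAt_completedNumerator hd) h0
  have h2 : AnalyticAt ℂ (fun z : ℂ => zetaDenominator (z - d / 2 + 1)) ((d : ℂ) / 2 - 1) :=
    AnalyticAt.fun_comp (by rw [hz]; exact analyticAt_zetaDenominator) h0
  refine (differentiable_pi_cpow_mul_inv_Gamma.analyticAt _).mul (h1.div h2 ?_)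
  rw [hz, zetaDenominator_zero]
  norm_num

/-- At w = 0 the quotient of -R by -1 is R. The prefactor π^{d/2-1}/Γ(d/2-1) then meets
2Γ(d/2-1)/π^{d/2-2}, and 2π is left. -/
lemma eisensteinFactor_mul_vectorEisenstein (hd : 3 ≤ d) :
    eisensteinFactor d * M.vectorEisenstein ((d : ℂ) / 2 - 1) =
      2 * Real.pi * M.regularizedIntegral := by
  have hs := one_lt_half_dim hd
  have hπ := Real.pi_pos
  have hΓ : (Real.Gamma ((d : ℝ) / 2 - 1) : ℂ) ≠ 0 :=
    Complex.ofReal_ne_zero.mpr (Real.Gamma_pos_of_pos (by linarith)).ne'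
  have hz : (d : ℂ) / 2 - 1 - d / 2 + 1 = 0 := by ring
  have hcast : (d : ℂ) / 2 - 1 = (((d : ℝ) / 2 - 1 : ℝ) : ℂ) := by push_cast; rfl
  have hpow : Real.pi ^ ((d : ℝ) / 2 - 1) = Real.pi * Real.pi ^ ((d : ℝ) / 2 - 2) := by
    rw [show (d : ℝ) / 2 - 1 = 1 + (d / 2 - 2) by ring, Real.rpow_add hπ, Real.rpow_one]
  have hp : ((Real.pi ^ ((d : ℝ) / 2 - 2) : ℝ) : ℂ) ≠ 0 :=
    Complex.ofReal_ne_zero.mpr (Real.rpow_pos_of_pos hπ _).ne'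
  rw [vectorEisenstein, hz, zetaDenominator_zero, completedNumerator_zero, hcast,
    Complex.Gamma_ofReal, ← Complex.ofReal_cpow hπ.le, hpow, eisensteinFactor, Complex.ofReal_div,
    Complex.ofReal_mul, Complex.ofReal_mul, Complex.ofReal_ofNat]
  generalize (Real.Gamma ((d : ℝ) / 2 - 1) : ℂ) = G at hΓ ⊢
  generalize ((Real.pi ^ ((d : ℝ) / 2 - 2) : ℝ) : ℂ) = P at hp ⊢
  field_simp

end NarainModuli

end

/-! ### The main theorem -/

theorem theorem1 (d : ℕ) (hd : 3 ≤ d) :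
    ∃ E : NarainModuli d → ℂ → ℂ,
      (∀ M : NarainModuli d,
        M.IsVectorEisenstein (E M) ∧
        AnalyticAt ℂ (E M) ((d : ℂ) / 2 - 1) ∧
        M.IsRegularizedOneLoop (minimalCounterterm d)
          (eisensteinFactor d * E M ((d : ℂ) / 2 - 1))) ∧
      ∀ c : ℝ → ℂ,
        (∃ (M₀ : NarainModuli d) (I₀ : ℂ), M₀.IsRegularizedOneLoop c I₀) →
        ∃ C : ℂ, ∀ M : NarainModuli d,
          M.IsRegularizedOneLoop c
            (eisensteinFactor d * E M ((d : ℂ) / 2 - 1) + C) := by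
  have hmin : ∀ M : NarainModuli d, M.IsRegularizedOneLoop (minimalCounterterm d)
      (eisensteinFactor d * M.vectorEisenstein ((d : ℂ) / 2 - 1)) := by
    intro M
    rw [M.eisensteinFactor_mul_vectorEisenstein hd]
    exact M.isRegularizedOneLoop_minimalCounterterm hd
  refine ⟨NarainModuli.vectorEisenstein, fun M => ⟨M.isVectorEisenstein hd,
    M.analyticAt_vectorEisenstein hd, hmin M⟩, ?_⟩
  rintro c ⟨M₀, I₀, h₀⟩
  refine ⟨I₀ - eisensteinFactor d * M₀.vectorEisenstein ((d : ℂ) / 2 - 1), fun M =>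
    ⟨(hmin M).integrableOn, ?_⟩⟩
  -- At M₀ the limits for c and for the minimal counterterm determine the limit of their difference,
  -- which does not involve M; adding it to the limit at M replaces one counterterm by the other.
  refine ((hmin M).tendsto.add (h₀.tendsto.sub (hmin M₀).tendsto)).congr fun T => ?_
  ring
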